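/- **Curves.** A curve is a differentiable $f:[a,b]\to\mathbb C$ ($a<b$) whose derivative is absolutely continuous and never zero. Write $ds=|f'(t)|\,dt$ for arclength. A direction angle is an absolutely continuous $\tau$ with $f'=|f'|e^{i\tau}$; the signed curvature is $\kappa=d\tau/ds$, the turning angle is $\Delta(f)=\int\kappa\,ds$, and the bending energy is $\|f\|^2=\frac14\int\kappa^2\,ds\in[0,\infty]$. Curves $f,g$ are equivalent, $f\equiv g$, if their unit speed reparametrisations coincide. The concatenation of curves is denoted $\sqcup$ (segments of length $0$ are omitted), and $[A,B]$ is the line segment from $A$ to $B$. A left (right) c-curve is a curve with $\kappa\ge0$ a.e. ($\kappa\le0$ a.e.) and $|\Delta(f)|\le\pi$; a u-turn is a c-curve with $|\Delta(f)|=\pi$. Elongating a u-turn contained in a curve means inserting a line segment before the u-turn, in its initial direction, and a congruent one after it. A right-left (left-right) s-curve is a right (left) c-curve followed by a left (right) one; an s-curve is a c-curve or one of these, and it is non-degenerate if it is not a c-curve. **Elastica.** Let $E(t)=\sin t+i\xi(t)$, $\xi(t)=\int_0^t\frac{\sin^2 r}{\sqrt{1+\sin^2 r}}\,dr$, and let $E_{[a,b]}$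 be its restriction to $[a,b]$. A curve is similar to $f$ if it is equivalent to $T\circ f$ with $T(z)=c_1z+c_2$ or $T(z)=c_1\bar z+c_2$, $c_1\ne0$; directly similar if $T(z)=c_1z+c_2$. A curve is of first form with parameters $t_0,t$, where $-\pi<t_0<t<\pi$, if it is directly similar to $E_{[t_0,t]}$; it is of second form with parameters $c\ge0$, $t\in[0,\pi]$, if it is directly similar to $E_{[-\pi,0]}\sqcup[0,c]\sqcup(c+E_{[0,t]})$. **Data.** Let $\alpha\in(0,\pi)$, $|\beta|\le\alpha$, $\beta>\alpha-\pi$, and let $u=(0,e^{i\alpha})$, $v=(1,e^{i\beta})$ be the unit tangent vectors with base points $0,1$ and the directions shown. Let $S(u,v)$ be the set of s-curves with initial unit tangent vector $u$ and terminal unit tangent vector $v$, $C_r(u,v)\subset S(u,v)$ the set of right c-curves among them, and $S'_{lr}(u,v)\subset S(u,v)$ the set of non-degenerate left-right s-curves among them. Put $\beta_0=\min\{\beta,0\}$, $\Gamma=[\alpha-\pi,\beta]$ if $\beta<0$ and $\Gamma=[\alpha-\pi,0)$ if $\beta\ge0$. For $\gamma\in\Gamma$ put $$y_1=\tfrac12\int_0^{\alpha-\gamma}\sqrt{\sin\tau}\,d\tau,\quad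 y_2=\tfrac12\int_0^{\beta-\gamma}\sqrt{\sin\tau}\,d\tau,\quad G(\gamma)=\frac{(y_1+y_2)^2}{-\sin\gamma},\quad \lambda(\gamma)=\frac{-\sin\gamma}{y_1+y_2},$$ $$\sigma(\gamma)=\cos\gamma+\frac{\sin\gamma}{y_1+y_2}\left(\sqrt{\sin(\alpha-\gamma)}+\sqrt{\sin(\beta-\gamma)}\right),$$ and let $t_1,t_2\in[0,\pi]$ be given by $\Delta(E_{[0,t_1]})=\alpha-\gamma$, $\Delta(E_{[0,t_2]})=\beta-\gamma$ (with $t_2=0$ if $\gamma=\beta$). Let $s_\gamma(u,v)=C_r(u,v)$ if $\gamma=\beta<0$; otherwise let $s_\gamma(u,v)$ be the set of non-degenerate right-left s-curves in $S(u,v)$ which have direction $e^{i\gamma}$ at an inflection point (a point where the right c-curve ends and the left one begins). Let $\ell_\gamma$ be the line of direction $e^{i\gamma}$ at distance $-\sin\gamma\,\frac{y_1}{y_1+y_2}$ from $0$, on the same side of $0$ as the point $1$ (for $\gamma=\beta<0$ this is the line through $1$ of direction $e^{i\beta}$). Let $r(u,\ell_\gamma)$ be the right c-curve that starts at $u$,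 ends tangentially on $\ell_\gamma$ and is similar to the segment $E_{[t,\pi]}$, $t\in[0,\pi)$, whose turning angle has the same magnitude. For $\gamma<\beta$ let $l(\ell_\gamma,v)$ be the left c-curve that starts tangentially on $\ell_\gamma$, ends at $v$ and is similar to the segment $E_{[0,t]}$, $t\in(0,\pi]$, of the same turning angle. Let $P_1$ be the end point of $r(u,\ell_\gamma)$ and $P_2$ the initial point of $l(\ell_\gamma,v)$. **Corollary 5.12.** Assume in addition that $\sigma(\beta)\ge0$ in case $\beta<0$. Then $G$ has a minimum value $G_{min}$ on $\Gamma$, and the following hold. (i) If $\beta<0$, then $\|f\|^2>G_{min}$ for all $f\in S'_{lr}(u,v)$. (ii) If $\gamma\in\Gamma$ and $G(\gamma)>G_{min}$, then $\|f\|^2>G_{min}$ for all $f\in s_\gamma(u,v)$. (iii) If $G(\alpha-\pi)=G_{min}$, then $\sigma(\alpha-\pi)\ge0$, and, with $\gamma=\alpha-\pi$, the curve $f_\gamma=r(u,\ell_\gamma)\sqcup[P_1,P_2]\sqcup l(\ell_\gamma,v)$ exists, is of second form with parameters $c=\sigma(\gamma)/\lambda(\gamma)$ and $t=t_2$, belongs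 to $s_\gamma(u,v)$ and has bending energy $G_{min}$; every curve in $s_\gamma(u,v)$ with bending energy $G_{min}$ is obtained from $f_\gamma$, up to equivalence, by finitely many (possibly no) elongations of u-turns. (iv) If $\gamma\in(\alpha-\pi,\beta_0)$ and $G(\gamma)=G_{min}$, then $\sigma(\gamma)=0$, and the curve $f_\gamma=r(u,\ell_\gamma)\sqcup l(\ell_\gamma,v)$ exists, is of first form with parameters $t_0=-t_1$ and $t=t_2$, belongs to $s_\gamma(u,v)$ and has bending energy $G_{min}$; every curve in $s_\gamma(u,v)$ with bending energy $G_{min}$ is equivalent to $f_\gamma$. (v) If $\beta<0$ and $G(\beta)=G_{min}$, then $\sigma(\beta)=0$, and the curve $f_\beta=r(u,\ell_\beta)$ is of first form with parameters $t_0=-t_1$ and $t=0$, belongs to $s_\beta(u,v)$ and has bending energy $G_{min}$; every curve in $s_\beta(u,v)$ with bending energy $G_{min}$ is equivalent to $f_\beta$. (vi) The minimum bending energy in $S(u,v)$ is $G_{min}$ (and it is attained). -/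

import Mathlib

open Set MeasureTheory
open scoped ENNReal

noncomputable section

namespace ElasticSpline

/-! ### Curves in the plane -/

/-- A parametrised path `toFun : [a, b] → ℂ` (only the values on `[a, b]` matter). -/
structure PlanePath where
  a : ℝ
  b : ℝ
  toFun : ℝ → ℂ

namespace PlanePath

/-- The derivative `f'` on `[a, b]` (one-sided at the end points). -/
def vel (f : PlanePath) (t : ℝ) : ℂ := derivWithin f.toFun (Icc f.a f.b) t

/-- A curve: a differentiable function on `[a, b]`, `a < b`, whose derivative is absolutely
continuous and never zero. -/
def IsCurve (f : PlanePath) : Prop :=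
  f.a < f.b ∧ DifferentiableOn ℝ f.toFun (Icc f.a f.b) ∧
    AbsolutelyContinuousOnInterval f.vel f.a f.b ∧ ∀ t ∈ Icc f.a f.b, f.vel t ≠ 0

/-- Arclength `s = ∫_a^t |f'|`. -/
def arcLength (f : PlanePath) (t : ℝ) : ℝ := ∫ r in f.a..t, ‖f.vel r‖

def len (f : PlanePath) : ℝ := f.arcLength f.b

/-- Two curves are equivalent when their unit speed curves `[f]`, `[g]` coincide: they have the same
length and they are at the same place whenever they have travelled the same arclength. -/
def Equiv (f g : PlanePath) : Prop :=
  f.len = g.len ∧ ∀ s ∈ Icc f.a f.b, ∀ t ∈ Icc g.a g.b,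
    f.arcLength s = g.arcLength t → f.toFun s = g.toFun t

/-- The sub-path of `f` with parameters in `[c, d]`. -/
def restrict (f : PlanePath) (c d : ℝ) : PlanePath := ⟨c, d, f.toFun⟩

/-- `T ∘ f`. -/
def map (T : ℂ → ℂ) (f : PlanePath) : PlanePath := ⟨f.a, f.b, fun t => T (f.toFun t)⟩

/-- The directed line segment `[A, B]`; it is a trivial path of length `0` if `A = B`. -/
def lineSeg (A B : ℂ) : PlanePath := ⟨0, 1, fun t => A + (t : ℂ) * (B - A)⟩

def start (f : PlanePath) : ℂ := f.toFun f.a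

def finish (f : PlanePath) : ℂ := f.toFun f.b

/-- The unit direction `f'(t) / |f'(t)|`. -/
def dir (f : PlanePath) (t : ℝ) : ℂ := f.vel t / (‖f.vel t‖ : ℂ)

/-- `τ` is a direction angle of `f`: it is absolutely continuous and `f' = |f'| e^{iτ}`. -/
def IsDirectionAngle (f : PlanePath) (τ : ℝ → ℝ) : Prop :=
  AbsolutelyContinuousOnInterval τ f.a f.b ∧
    ∀ t ∈ Icc f.a f.b, f.vel t = (‖f.vel t‖ : ℂ) * Complex.exp (τ t * Complex.I)

/-- A direction angle of `f`. On `[a, b]` it is unique up to a constant in `2πℤ`. -/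
def angle (f : PlanePath) : ℝ → ℝ := Classical.epsilon f.IsDirectionAngle

/-- The signed curvature `κ = dτ/ds`, at the point with parameter `t`. -/
def curvature (f : PlanePath) (t : ℝ) : ℝ := deriv f.angle t / ‖f.vel t‖

/-- The turning angle `Δ(f) = ∫ κ ds`, where `ds = |f'(t)| dt`. -/
def turning (f : PlanePath) : ℝ := ∫ t in f.a..f.b, f.curvature t * ‖f.vel t‖

/-- The bending energy `‖f‖² = (1/4) ∫ κ² ds`, possibly infinite. -/
def energy (f : PlanePath) : ℝ≥0∞ :=
  (1 / 4) * ∫⁻ t in Icc f.a f.b, ENNReal.ofReal (f.curvature t ^ 2 * ‖f.vel t‖)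

def IsLeftCurve (f : PlanePath) : Prop :=
  f.IsCurve ∧ ∀ᵐ t ∂(volume.restrict (Icc f.a f.b)), 0 ≤ f.curvature t

def IsRightCurve (f : PlanePath) : Prop :=
  f.IsCurve ∧ ∀ᵐ t ∂(volume.restrict (Icc f.a f.b)), f.curvature t ≤ 0

def IsLeftCCurve (f : PlanePath) : Prop := f.IsLeftCurve ∧ |f.turning| ≤ Real.pi

def IsRightCCurve (f : PlanePath) : Prop := f.IsRightCurve ∧ |f.turning| ≤ Real.pi

def IsCCurve (f : PlanePath) : Prop := f.IsLeftCCurve ∨ f.IsRightCCurve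

def IsUTurn (f : PlanePath) : Prop := f.IsCCurve ∧ |f.turning| = Real.pi

/-- `f` splits at the parameter `c` into a right c-curve followed by a left c-curve. -/
def SplitsRightLeft (f : PlanePath) (c : ℝ) : Prop :=
  c ∈ Ioo f.a f.b ∧ (f.restrict f.a c).IsRightCCurve ∧ (f.restrict c f.b).IsLeftCCurve

/-- `f` splits at the parameter `c` into a left c-curve followed by a right c-curve. -/
def SplitsLeftRight (f : PlanePath) (c : ℝ) : Prop :=
  c ∈ Ioo f.a f.b ∧ (f.restrict f.a c).IsLeftCCurve ∧ (f.restrict c f.b).IsRightCCurve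

/-- An s-curve: a c-curve, or two c-curves with opposite turning directions, one after the other. -/
def IsSCurve (f : PlanePath) : Prop :=
  f.IsCurve ∧ (f.IsCCurve ∨ ∃ c, f.SplitsRightLeft c ∨ f.SplitsLeftRight c)

/-- `h` is cut by finitely many parameters into consecutive pieces equivalent to the members of the
list (a member of length `0` is a single point). -/
def HasPieces : PlanePath → List PlanePath → Prop
  | h, [] => h.a = h.b
  | h, f :: fs => ∃ c ∈ Icc h.a h.b,
      (h.restrict h.a c).Equiv f ∧ HasPieces (h.restrict c h.b) fs

/-- `h ≡ f₁ ⊔ f₂ ⊔ ⋯`, the concatenation of the members of the list; in particular the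
concatenation is again a curve. -/
def IsJoin (h : PlanePath) (fs : List PlanePath) : Prop := h.IsCurve ∧ h.HasPieces fs

/-- `g` is similar to `f`: `g ≡ T ∘ f` with `T z = c₁ z + c₂` or `T z = c₁ z̄ + c₂`, `c₁ ≠ 0`. -/
def Similar (g f : PlanePath) : Prop :=
  ∃ c₁ c₂ : ℂ, c₁ ≠ 0 ∧ (g.Equiv (f.map fun z => c₁ * z + c₂) ∨
    g.Equiv (f.map fun z => c₁ * (starRingEnd ℂ) z + c₂))

/-- `g` is directly similar to `f`: `g ≡ T ∘ f` with `T z = c₁ z + c₂`, `c₁ ≠ 0`. -/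
def DirectlySimilar (g f : PlanePath) : Prop :=
  ∃ c₁ c₂ : ℂ, c₁ ≠ 0 ∧ g.Equiv (f.map fun z => c₁ * z + c₂)

/-- `g` arises from `f` by elongating a u-turn `f|[p, q]`: a segment of length `c` in the direction
of `f'(p)` is inserted before the u-turn, and a congruent one, in the opposite direction, after it. -/
def IsElongation (f g : PlanePath) : Prop :=
  ∃ p q c : ℝ, f.a ≤ p ∧ p < q ∧ q ≤ f.b ∧ 0 < c ∧ (f.restrict p q).IsUTurn ∧
    g.IsJoin
      [f.restrict f.a p,
       lineSeg (f.toFun p) (f.toFun p + c * f.dir p),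
       (f.restrict p q).map (fun z => z + c * f.dir p),
       lineSeg (f.toFun q + c * f.dir p) (f.toFun q),
       f.restrict q f.b]

/-- `g` is, up to equivalence, obtained from `f` by finitely many (possibly no) elongations of
u-turns. -/
def ElongatesTo (f g : PlanePath) : Prop :=
  Relation.ReflTransGen
    (fun x y : PlanePath => x.IsCurve ∧ y.IsCurve ∧ (x.Equiv y ∨ x.IsElongation y)) f g

end PlanePath

open ElasticSpline.PlanePath

/-! ### Unit tangent vectors, lines and the sets of curves connecting them -/

/-- A unit tangent vector `(position, direction)`; the direction has modulus `1` in all uses. -/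
abbrev UnitTangent := ℂ × ℂ

def PlanePath.tangentAt (f : PlanePath) (t : ℝ) : UnitTangent := (f.toFun t, f.dir t)

/-- The line through `f(t)` which is parallel to `f'(t)`. -/
def PlanePath.tangentLineAt (f : PlanePath) (t : ℝ) : Set ℂ :=
  {z | ∃ r : ℝ, z = f.toFun t + (r : ℂ) * f.dir t}

def PlanePath.Connects (f : PlanePath) (u v : UnitTangent) : Prop :=
  f.tangentAt f.a = u ∧ f.tangentAt f.b = v

/-- `S(u, v)`: the s-curves which connect `u` to `v`. -/
def sCurves (u v : UnitTangent) : Set PlanePath := {f | f.IsSCurve ∧ f.Connects u v}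

/-- `C_r(u, v)`: the right c-curves which connect `u` to `v`. -/
def rightCCurves (u v : UnitTangent) : Set PlanePath := {f | f.IsRightCCurve ∧ f.Connects u v}

/-- `C_r(u, ℓ)`: the right c-curves which start at `u` and end tangentially on the line `ℓ`. -/
def rightCCurvesToLine (u : UnitTangent) (l : Set ℂ) : Set PlanePath :=
  {f | f.IsRightCCurve ∧ f.tangentAt f.a = u ∧ f.tangentLineAt f.b = l}

/-- `C_l(ℓ, v)`: the left c-curves which start tangentially on the line `ℓ` and end at `v`. -/
def leftCCurvesFromLine (l : Set ℂ) (v : UnitTangent) : Set PlanePath :=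
  {f | f.IsLeftCCurve ∧ f.tangentLineAt f.a = l ∧ f.tangentAt f.b = v}

/-- `S'_lr(u, v)`: the non-degenerate left-right s-curves in `S(u, v)`. -/
def sCurvesLR (u v : UnitTangent) : Set PlanePath :=
  {f | f ∈ sCurves u v ∧ ¬ f.IsCCurve ∧ ∃ c, f.SplitsLeftRight c}

/-! ### Rectangular elastica -/

def xi (t : ℝ) : ℝ := ∫ r in (0 : ℝ)..t, Real.sin r ^ 2 / Real.sqrt (1 + Real.sin r ^ 2)

/-- The rectangular elastica `E(t) = sin t + i ξ(t)`. -/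
def elastica (t : ℝ) : ℂ := (Real.sin t : ℂ) + Complex.I * (xi t : ℂ)

/-- `E_{[a, b]}`. -/
def elasticaSeg (a b : ℝ) : PlanePath := ⟨a, b, elastica⟩

/-- `f` is the curve `r(u, ℓ)` up to parametrisation: the curve in `C_r(u, ℓ)` which is similar to
`E_{[t₁, π]}`, where `E_{[t₁, π]}` has the same magnitude of turning angle. -/
def IsOptimalRight (u : UnitTangent) (l : Set ℂ) (f : PlanePath) : Prop :=
  f ∈ rightCCurvesToLine u l ∧ ∃ t₁ ∈ Ico 0 Real.pi,
    (elasticaSeg t₁ Real.pi).turning = |f.turning| ∧ f.Similar (elasticaSeg t₁ Real.pi)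

/-- `f` is the curve `l(ℓ, v)` up to parametrisation: the curve in `C_l(ℓ, v)` which is similar to
`E_{[0, t₂]}`, where `E_{[0, t₂]}` has the same magnitude of turning angle. -/
def IsOptimalLeft (l : Set ℂ) (v : UnitTangent) (f : PlanePath) : Prop :=
  f ∈ leftCCurvesFromLine l v ∧ ∃ t₂ ∈ Ioc 0 Real.pi,
    (elasticaSeg 0 t₂).turning = |f.turning| ∧ f.Similar (elasticaSeg 0 t₂)

/-- `f` is of first form with parameters `t₀ < t`. -/
def IsFirstForm (t₀ t : ℝ) (f : PlanePath) : Prop :=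
  -Real.pi < t₀ ∧ t₀ < t ∧ t < Real.pi ∧ f.DirectlySimilar (elasticaSeg t₀ t)

/-- `f` is of second form with parameters `c, t`: it is directly similar to
`E_{[-π, 0]} ⊔ [0, c] ⊔ (c + E_{[0, t]})`. -/
def IsSecondForm (c t : ℝ) (f : PlanePath) : Prop :=
  0 ≤ c ∧ t ∈ Icc 0 Real.pi ∧ ∃ h : PlanePath,
    h.IsJoin [elasticaSeg (-Real.pi) 0, lineSeg 0 (c : ℂ),
      (elasticaSeg 0 t).map (fun z => (c : ℂ) + z)] ∧
    f.DirectlySimilar h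

/-! ### The data attached to the angles `α`, `β` -/

/-- `u = (0, e^{iα})`. -/
def uVec (α : ℝ) : UnitTangent := (0, Complex.exp (α * Complex.I))

/-- `v = (1, e^{iβ})`. -/
def vVec (β : ℝ) : UnitTangent := (1, Complex.exp (β * Complex.I))

open Classical in
/-- The set `Γ` of admissible inflection directions. -/
def GammaSet (α β : ℝ) : Set ℝ := if β < 0 then Icc (α - Real.pi) β else Ico (α - Real.pi) 0

def y₁ (α γ : ℝ) : ℝ := (1 / 2) * ∫ τ in (0 : ℝ)..(α - γ), Real.sqrt (Real.sin τ)

def y₂ (β γ : ℝ) : ℝ := (1 / 2) * ∫ τ in (0 : ℝ)..(β - γ), Real.sqrt (Real.sin τ)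

def G (α β γ : ℝ) : ℝ := 1 / (-Real.sin γ) * (y₁ α γ + y₂ β γ) ^ 2

def sigma (α β γ : ℝ) : ℝ :=
  Real.cos γ + Real.sin γ / (y₁ α γ + y₂ β γ) *
    (Real.sqrt (Real.sin (α - γ)) + Real.sqrt (Real.sin (β - γ)))

def lam (α β γ : ℝ) : ℝ := -Real.sin γ / (y₁ α γ + y₂ β γ)

/-- The line `ℓ_γ` with direction `e^{iγ}`, at distance `a_γ = -sin γ · y₁ / (y₁ + y₂)` from `0`, on
the same side of `0` as the point `1` (whose signed distance in these terms is `-sin γ`). For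
`γ = β < 0` one has `y₂ = 0` and this is the line through `1` with direction `e^{iβ}`. -/
def inflectionLine (α β γ : ℝ) : Set ℂ :=
  {z | (z * Complex.exp (-(γ * Complex.I))).im =
    -Real.sin γ * (y₁ α γ / (y₁ α γ + y₂ β γ))}

open Classical in
/-- The class `s_γ(u, v)`: the set `C_r(u, v)` if `γ = β < 0`; otherwise the set of non-degenerate
right-left s-curves in `S(u, v)` whose direction at an inflection point is `e^{iγ}`. -/
def sClass (α β γ : ℝ) : Set PlanePath :=
  if β < 0 ∧ γ = β then rightCCurves (uVec α) (vVec β)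
  else {f | f ∈ sCurves (uVec α) (vVec β) ∧ ¬ f.IsCCurve ∧
    ∃ c, f.SplitsRightLeft c ∧ f.dir c = Complex.exp (γ * Complex.I)}

end ElasticSpline

end

open ElasticSpline

/-! ### Absolutely continuous functions and the existence of a continuous argument. -/

section AbsolutelyContinuous

variable {a b : ℝ}

/-! The proof is a calibration argument. Let a curve from `0` to `1` have a direction angle `τ` that
falls from `α` to `γ` and then rises from `γ` to `β`, each part turning by at most `π`. Then `sin (τ
- γ) ≥ 0` along the whole curve. Completing the square gives, for every constant `m`, `κ² = (κ ± m
√sin (τ - γ))² + (∓ 2 m κ √sin (τ - γ) - m² sin (τ - γ))`, with the upper sign on the right-turning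
part. The integral of the bracket depends only on end point data: `κ √sin (τ - γ) ds` is an exact
differential whose integrals are `-2 y₁` and `2 y₂`, and `∫ sin (τ - γ) ds` is the displacement
across the direction `γ`, which is `-sin γ`. The best constant is `m = 2 / λ(γ)`, and the energy
becomes `G(γ)` plus one quarter of the integral of a square (`IsRightLeft.energy_identity`).

Every admissible curve is of this kind, except the non-degenerate left-right s-curves. These occur
only for `β < 0`, and the same square completed at the direction `β` shows that they cost more than
`G(β)` (`SplitsLeftRight.lt_energy`). A right c-curve is the case `γ = β`. So the infimum over
s-curves is at least the minimum of `G` on `Γ`.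

Equality forces `κ = ∓ (2 / λ) √sin (τ - γ)`, which is the curvature equation of the rectangular
elastica scaled by `λ`. Since `√` is not Lipschitz at `0`, solutions may rest where the sine
vanishes, that is, in the directions `γ` and `γ + π`. The extremals are thus scaled elastica with
straight segments of parameter lengths `a`, `b`, `d` inserted at the directions `γ + π`, `γ`, `γ +
π` (`IsRightLeft.exists_equiv_model`). Closing up at the point `1` is automatic across the direction
`γ`, and along it it reads `λ (b - a - d) = σ(γ)` (`displacement_iff`).

Finally `G'` is a positive multiple of `σ` (`hasDerivAt_G`). At a minimum, `σ ≥ 0` at the left end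
of `Γ`, `σ = 0` inside, and `σ ≤ 0` at a right end `β < 0`, where the hypothesis then gives `σ = 0`.
Hence `b = σ / λ` with `a = d = 0` is admissible and `G_min` is attained. Segments with `a` or `d`
positive need a u-turn; they occur only at the left end, and there they are precisely elongations.
-/

theorem AbsolutelyContinuousOnInterval.lipschitzOnWith_comp {X Y : Type*} [PseudoMetricSpace X]
    [PseudoMetricSpace Y] {f : ℝ → X} {g : X → Y} {s : Set X} {K : NNReal}
    (hf : AbsolutelyContinuousOnInterval f a b) (hg : LipschitzOnWith K g s)
    (hs : MapsTo f (uIcc a b) s) : AbsolutelyContinuousOnInterval (fun x => g (f x)) a b := by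
  rw [absolutelyContinuousOnInterval_iff] at hf ⊢
  intro ε hε
  obtain ⟨δ, hδ, h⟩ := hf (ε / (K + 1)) (by positivity)
  refine ⟨δ, hδ, fun E hE hE' => ?_⟩
  have h1 := h E hE hE'
  calc _ ≤ ∑ i ∈ Finset.range E.1, K * dist (f (E.2 i).1) (f (E.2 i).2) :=
        Finset.sum_le_sum fun i hi =>
          hg.dist_le_mul _ (hs (hE.1 i hi).1) _ (hs (hE.1 i hi).2)
    _ = K * ∑ i ∈ Finset.range E.1, dist (f (E.2 i).1) (f (E.2 i).2) := by
        rw [Finset.mul_sum]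
    _ ≤ K * (ε / (K + 1)) := by gcongr
    _ < ε := by
        rw [mul_div_assoc', div_lt_iff₀ (by positivity)]
        nlinarith

/-- The values of `f` stay in a closed ball, and on this compact convex set a `C¹` map is Lipschitz,
so no global Lipschitz bound on `g` is needed. -/
theorem AbsolutelyContinuousOnInterval.contDiff_comp {E F : Type*} [NormedAddCommGroup E]
    [NormedSpace ℝ E] [NormedAddCommGroup F] [NormedSpace ℝ F]
    [ProperSpace E] {f : ℝ → E} {g : E → F}
    (hf : AbsolutelyContinuousOnInterval f a b) (hg : ContDiff ℝ 1 g) :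
    AbsolutelyContinuousOnInterval (fun x => g (f x)) a b := by
  obtain ⟨C, hC⟩ := hf.exists_bound
  have hg' : ContDiffOn ℝ 1 g (Metric.closedBall (0 : E) C) := hg.contDiffOn
  obtain ⟨K, hK⟩ := hg'.exists_lipschitzOnWith (by decide) (convex_closedBall 0 C)
    (isCompact_closedBall _ _)
  exact hf.lipschitzOnWith_comp hK fun x hx => by simpa using hC x hx

theorem AbsolutelyContinuousOnInterval.congr_on {X : Type*} [PseudoMetricSpace X]
    {f g : ℝ → X} (hf : AbsolutelyContinuousOnInterval f a b) (h : EqOn f g (uIcc a b)) :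
    AbsolutelyContinuousOnInterval g a b := by
  rw [absolutelyContinuousOnInterval_iff] at hf ⊢
  intro ε hε
  obtain ⟨δ, hδ, h'⟩ := hf ε hε
  refine ⟨δ, hδ, fun E hE hE' => ?_⟩
  calc _ = ∑ i ∈ Finset.range E.1, dist (f (E.2 i).1) (f (E.2 i).2) :=
        Finset.sum_congr rfl fun i hi => by rw [h (hE.1 i hi).1, h (hE.1 i hi).2]
    _ < ε := h' E hE hE'

/-- A nowhere vanishing absolutely continuous function has an absolutely continuous argument. -/
theorem AbsolutelyContinuousOnInterval.exists_arg {w : ℝ → ℂ} (hab : a ≤ b)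
    (hw : AbsolutelyContinuousOnInterval w a b) (h0 : ∀ t ∈ Icc a b, w t ≠ 0) :
    ∃ τ : ℝ → ℝ, AbsolutelyContinuousOnInterval τ a b ∧
      ∀ t ∈ Icc a b, w t = (‖w t‖ : ℂ) * Complex.exp (τ t * Complex.I) := by
  have hu : AbsolutelyContinuousOnInterval (fun t => (w t).re) a b :=
    hw.contDiff_comp (g := Complex.reCLM) Complex.reCLM.contDiff
  have hv : AbsolutelyContinuousOnInterval (fun t => (w t).im) a b :=
    hw.contDiff_comp (g := Complex.imCLM) Complex.imCLM.contDiff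
  have hpos : ∀ t ∈ uIcc a b, (w t).re ^ 2 + (w t).im ^ 2 ≠ 0 := by
    intro t ht h
    rw [uIcc_of_le hab] at ht
    refine h0 t ht (Complex.ext ?_ ?_) <;> simp <;> nlinarith [sq_nonneg (w t).re, sq_nonneg (w t).im]
  have hN : ContinuousOn (fun t => (w t).re ^ 2 + (w t).im ^ 2) (uIcc a b) :=
    (hu.continuousOn.pow 2).add (hv.continuousOn.pow 2)
  have hiu := hu.intervalIntegrable_deriv
  have hiv := hv.intervalIntegrable_deriv
  set u' := deriv fun t => (w t).re
  set v' := deriv fun t => (w t).im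
  -- `ρ + i g` is the logarithmic derivative `w' / w`; it is integrable because `w'` is, and `w` is
  -- continuous without zeros.
  set ρ : ℝ → ℝ := fun t => u' t * ((w t).re / ((w t).re ^ 2 + (w t).im ^ 2)) +
    v' t * ((w t).im / ((w t).re ^ 2 + (w t).im ^ 2)) with hρ
  set g : ℝ → ℝ := fun t => v' t * ((w t).re / ((w t).re ^ 2 + (w t).im ^ 2)) -
    u' t * ((w t).im / ((w t).re ^ 2 + (w t).im ^ 2)) with hg
  have c1 := hu.continuousOn.div hN hpos
  have c2 := hv.continuousOn.div hN hpos
  have iρ : IntervalIntegrable ρ volume a b :=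
    (hiu.mul_continuousOn c1).add (hiv.mul_continuousOn c2)
  have ig : IntervalIntegrable g volume a b :=
    (hiv.mul_continuousOn c1).sub (hiu.mul_continuousOn c2)
  set N : ℝ → ℝ := fun x => ∫ t in a..x, ρ t
  set T : ℝ → ℝ := fun x => ∫ t in a..x, g t
  have aN : AbsolutelyContinuousOnInterval N a b :=
    iρ.absolutelyContinuousOnInterval_intervalIntegral left_mem_uIcc
  have aT : AbsolutelyContinuousOnInterval T a b :=
    ig.absolutelyContinuousOnInterval_intervalIntegral left_mem_uIcc
  have aH : AbsolutelyContinuousOnInterval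
      (fun x => -((N x : ℂ) + (T x : ℂ) * Complex.I)) a b := by
    have e1 := aN.contDiff_comp (g := Complex.ofRealCLM) Complex.ofRealCLM.contDiff
    have e2 := aT.contDiff_comp (g := fun x : ℝ => (x : ℂ) * Complex.I)
      (Complex.ofRealCLM.contDiff.mul contDiff_const)
    exact (e1.add e2).neg
  have aF := (aH.contDiff_comp (g := Complex.exp) Complex.contDiff_exp).smul hw
  -- `exp (-(N + iT)) · w` is absolutely continuous with derivative zero almost everywhere, hence
  -- constant. So `w = exp (N + iT) · w(a)`, and `arg w(a) + T` is an argument.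
  obtain ⟨C, hC⟩ := aF.const_of_ae_hasDerivAt_zero (by
    filter_upwards [hu.ae_differentiableAt, hv.ae_differentiableAt,
      iρ.ae_hasDerivAt_integral, ig.ae_hasDerivAt_integral] with x h1 h2 h3 h4 hx
    have d1 := (h1 hx).hasDerivAt.ofReal_comp
    have d2 := (h2 hx).hasDerivAt.ofReal_comp
    have d3 := (h3 hx a left_mem_uIcc).ofReal_comp
    have d4 := (h4 hx a left_mem_uIcc).ofReal_comp
    have dw : HasDerivAt w ((u' x : ℂ) + (v' x : ℂ) * Complex.I) x := by
      have := d1.add (d2.mul_const Complex.I)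
      refine this.congr_of_eventuallyEq (Filter.Eventually.of_forall fun t => ?_)
      exact (Complex.re_add_im (w t)).symm
    have dE := ((d3.add (d4.mul_const Complex.I)).neg).cexp
    have := dE.mul dw
    refine this.congr_deriv ?_
    have hx' := hpos x hx
    have hxC : ((w x).re : ℂ) ^ 2 + ((w x).im : ℂ) ^ 2 ≠ 0 := by exact_mod_cast hx'
    have key : (u' x : ℂ) + (v' x : ℂ) * Complex.I =
        ((ρ x : ℂ) + (g x : ℂ) * Complex.I) * w x := by
      conv_rhs => rw [← Complex.re_add_im (w x)]
      simp only [hρ, hg]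
      push_cast
      field_simp
      ring_nf
      simp only [Complex.I_sq]
      ring
    rw [key]
    simp only [Pi.add_apply, Pi.neg_apply]
    ring)
  have hCa := hC a left_mem_uIcc
  simp only [Pi.smul_apply', N, T, intervalIntegral.integral_same, smul_eq_mul] at hCa
  simp only [Complex.ofReal_zero, zero_mul, add_zero, neg_zero, Complex.exp_zero, one_mul] at hCa
  have hwt : ∀ t ∈ Icc a b, w t =
      Complex.exp ((N t : ℂ) + (T t : ℂ) * Complex.I) * w a := by
    intro t ht
    have := hC t (by rwa [uIcc_of_le hab])
    simp only [Pi.smul_apply', smul_eq_mul] at this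
    rw [hCa, ← this, ← mul_assoc, ← Complex.exp_add]
    simp
  refine ⟨fun t => (w a).arg + T t, ?_, fun t ht => ?_⟩
  · exact aT.contDiff_comp (g := fun x => (w a).arg + x) (contDiff_const.add contDiff_id)
  · have h1 := hwt t ht
    have hn : (‖w t‖ : ℂ) = Complex.exp (N t) * ‖w a‖ := by
      rw [h1, norm_mul, Complex.norm_exp]
      simp
    rw [hn]
    conv_lhs => rw [h1, ← Complex.norm_mul_exp_arg_mul_I (w a)]
    push_cast
    rw [add_mul, Complex.exp_add, Complex.exp_add]
    ring

end AbsolutelyContinuous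

/-! ### Direction angles: curvature, turning, energy and splittings in terms of them. -/

namespace ElasticSpline.PlanePath

variable {f g : PlanePath} {τ : ℝ → ℝ} {c d t : ℝ}

theorem vel_eq_of_hasDerivWithinAt (hab : f.a < f.b) (ht : t ∈ Icc f.a f.b) {w : ℂ}
    (h : HasDerivWithinAt f.toFun w (Icc f.a f.b) t) : f.vel t = w :=
  h.derivWithin (uniqueDiffOn_Icc hab t ht)

theorem vel_eq_of_hasDerivAt (hab : f.a < f.b) (ht : t ∈ Icc f.a f.b) {w : ℂ}
    (h : HasDerivAt f.toFun w t) : f.vel t = w :=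
  vel_eq_of_hasDerivWithinAt hab ht h.hasDerivWithinAt

theorem IsCurve.hasDerivWithinAt (hf : f.IsCurve) (ht : t ∈ Icc f.a f.b) :
    HasDerivWithinAt f.toFun (f.vel t) (Icc f.a f.b) t :=
  (hf.2.1 t ht).hasDerivWithinAt

theorem IsCurve.hasDerivAt (hf : f.IsCurve) (ht : t ∈ Ioo f.a f.b) :
    HasDerivAt f.toFun (f.vel t) t :=
  (hf.hasDerivWithinAt (Ioo_subset_Icc_self ht)).hasDerivAt (Icc_mem_nhds ht.1 ht.2)

theorem IsCurve.continuousOn_toFun (hf : f.IsCurve) : ContinuousOn f.toFun (Icc f.a f.b) :=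
  hf.2.1.continuousOn

theorem IsCurve.continuousOn_vel (hf : f.IsCurve) : ContinuousOn f.vel (Icc f.a f.b) := by
  simpa [uIcc_of_le hf.1.le] using hf.2.2.1.continuousOn

theorem IsCurve.norm_vel_pos (hf : f.IsCurve) (ht : t ∈ Icc f.a f.b) : 0 < ‖f.vel t‖ :=
  norm_pos_iff.2 (hf.2.2.2 t ht)

theorem IsCurve.exists_isDirectionAngle (hf : f.IsCurve) : ∃ τ, f.IsDirectionAngle τ := by
  obtain ⟨τ, h1, h2⟩ := hf.2.2.1.exists_arg hf.1.le hf.2.2.2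
  exact ⟨τ, h1, h2⟩

theorem IsCurve.isDirectionAngle_angle (hf : f.IsCurve) : f.IsDirectionAngle f.angle :=
  Classical.epsilon_spec hf.exists_isDirectionAngle

theorem IsDirectionAngle.continuousOn (hτ : f.IsDirectionAngle τ) (hab : f.a ≤ f.b) :
    ContinuousOn τ (Icc f.a f.b) := by
  simpa [uIcc_of_le hab] using hτ.1.continuousOn

theorem IsDirectionAngle.dir_eq (hτ : f.IsDirectionAngle τ) (hf : f.IsCurve)
    (ht : t ∈ Icc f.a f.b) : f.dir t = Complex.exp (τ t * Complex.I) := by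
  have h : (‖f.vel t‖ : ℂ) ≠ 0 := by exact_mod_cast (hf.norm_vel_pos ht).ne'
  rw [dir, hτ.2 t ht, norm_mul, Complex.norm_exp_ofReal_mul_I]
  simp [h]

theorem exp_mul_I_eq_iff {x y : ℝ} :
    Complex.exp (x * Complex.I) = Complex.exp (y * Complex.I) ↔
      ∃ n : ℤ, x = y + n * (2 * Real.pi) := by
  rw [Complex.exp_eq_exp_iff_exists_int]
  refine exists_congr fun n => ⟨fun h => ?_, fun h => ?_⟩
  · have := congrArg Complex.im h
    simpa using this
  · rw [h]; push_cast; ring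

theorem eq_of_exp_mul_I_eq {x y : ℝ}
    (h : Complex.exp (x * Complex.I) = Complex.exp (y * Complex.I))
    (h1 : x - y < 2 * Real.pi) (h2 : y - x < 2 * Real.pi) : x = y := by
  obtain ⟨n, hn⟩ := exp_mul_I_eq_iff.1 h
  have hπ := Real.pi_pos
  have a1 : (n : ℝ) < 1 := by nlinarith
  have a2 : (-1 : ℝ) < n := by nlinarith
  have : n = 0 := by
    have b1 : n < 1 := by exact_mod_cast a1
    have b2 : -1 < n := by exact_mod_cast a2
    omega
  simpa [this] using hn

/-- The difference of two direction angles is continuous on a connected interval with values in the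
discrete group `2πℤ`. This frees all later computations from the unspecified choice made in `angle`.
-/
theorem IsDirectionAngle.eq_add (hf : f.IsCurve) {σ : ℝ → ℝ} (hτ : f.IsDirectionAngle τ)
    (hσ : f.IsDirectionAngle σ) :
    ∃ n : ℤ, ∀ t ∈ Icc f.a f.b, τ t = σ t + n * (2 * Real.pi) := by
  have hc : ContinuousOn (fun t => τ t - σ t) (Icc f.a f.b) :=
    (hτ.continuousOn hf.1.le).sub (hσ.continuousOn hf.1.le)
  have hm : MapsTo (fun t => τ t - σ t) (Icc f.a f.b)
      (AddSubgroup.zmultiples (2 * Real.pi) : Set ℝ) := by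
    intro t ht
    obtain ⟨n, hn⟩ := exp_mul_I_eq_iff.1 ((hτ.dir_eq hf ht).symm.trans (hσ.dir_eq hf ht))
    exact ⟨n, by simp [hn]⟩
  obtain ⟨y, ⟨n, hn⟩, hy⟩ := isPreconnected_Icc.eqOn_const_of_mapsTo
    ⟨inferInstanceAs (DiscreteTopology (AddSubgroup.zmultiples (2 * Real.pi)))⟩ hc hm ⟨0, zero_mem _⟩
  refine ⟨n, fun t ht => ?_⟩
  have := hy ht
  simp at this hn
  linarith

theorem IsDirectionAngle.add_int (hτ : f.IsDirectionAngle τ) (n : ℤ) :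
    f.IsDirectionAngle fun t => τ t + n * (2 * Real.pi) := by
  refine ⟨hτ.1.contDiff_comp (g := fun x => x + n * (2 * Real.pi))
    (contDiff_id.add contDiff_const), fun t ht => ?_⟩
  rw [hτ.2 t ht]
  have : Complex.exp (((τ t + n * (2 * Real.pi) : ℝ) : ℂ) * Complex.I) =
      Complex.exp (τ t * Complex.I) := exp_mul_I_eq_iff.2 ⟨n, rfl⟩
  rw [this, norm_mul, Complex.norm_exp_ofReal_mul_I]
  simp

theorem IsCurve.exists_isDirectionAngle_start (hf : f.IsCurve) {x : ℝ}
    (hx : f.dir f.a = Complex.exp (x * Complex.I)) :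
    ∃ τ, f.IsDirectionAngle τ ∧ τ f.a = x := by
  obtain ⟨τ, hτ⟩ := hf.exists_isDirectionAngle
  obtain ⟨n, hn⟩ := exp_mul_I_eq_iff.1
    (hx.symm.trans (hτ.dir_eq hf (left_mem_Icc.2 hf.1.le)))
  exact ⟨_, hτ.add_int n, hn.symm⟩

/-- Restricted to interior points: `deriv` is two-sided, and the values of `angle` outside `[a, b]`
are arbitrary. -/
theorem IsDirectionAngle.curvature_eq (hτ : f.IsDirectionAngle τ) (hf : f.IsCurve)
    (ht : t ∈ Ioo f.a f.b) : f.curvature t = deriv τ t / ‖f.vel t‖ := by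
  obtain ⟨n, hn⟩ := hf.isDirectionAngle_angle.eq_add hf hτ
  have : f.angle =ᶠ[nhds t] fun t => τ t + n * (2 * Real.pi) := by
    filter_upwards [Icc_mem_nhds ht.1 ht.2] with s hs using hn s hs
  rw [curvature, this.deriv_eq, deriv_add_const]

theorem IsDirectionAngle.turning_eq (hτ : f.IsDirectionAngle τ) (hf : f.IsCurve) :
    f.turning = τ f.b - τ f.a := by
  rw [turning, ← hτ.1.integral_deriv_eq_sub,
    intervalIntegral.integral_of_le hf.1.le, intervalIntegral.integral_of_le hf.1.le,
    integral_Ioc_eq_integral_Ioo, integral_Ioc_eq_integral_Ioo]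
  refine setIntegral_congr_fun measurableSet_Ioo fun t ht => ?_
  have := (hf.norm_vel_pos (Ioo_subset_Icc_self ht)).ne'
  simp only [hτ.curvature_eq hf ht]
  field_simp

/-- Discards the two end points, where the formula for the curvature by a direction angle is not
available. -/
theorem ae_restrict_Icc_iff {p : ℝ → Prop} {a b : ℝ} :
    (∀ᵐ t ∂volume.restrict (Icc a b), p t) ↔ ∀ᵐ t, t ∈ Ioo a b → p t := by
  rw [← Measure.restrict_congr_set (Ioo_ae_eq_Icc (μ := volume) (a := a) (b := b)),
    ae_restrict_iff' measurableSet_Ioo]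

theorem IsDirectionAngle.energy_eq (hτ : f.IsDirectionAngle τ) (hf : f.IsCurve) :
    f.energy = (1 / 4) * ∫⁻ t in Icc f.a f.b, ENNReal.ofReal (deriv τ t ^ 2 / ‖f.vel t‖) := by
  rw [energy]
  congr 1
  refine lintegral_congr_ae (ae_restrict_Icc_iff.2 (Filter.Eventually.of_forall fun t ht => ?_))
  have := (hf.norm_vel_pos (Ioo_subset_Icc_self ht)).ne'
  simp only [hτ.curvature_eq hf ht]
  congr 1
  field_simp

theorem monotoneOn_of_ae_deriv_nonneg {σ : ℝ → ℝ} {a b : ℝ}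
    (hσ : AbsolutelyContinuousOnInterval σ a b)
    (h : ∀ᵐ t, t ∈ Ioo a b → 0 ≤ deriv σ t) : MonotoneOn σ (Icc a b) := by
  intro x hx y hy hxy
  have hsub : uIcc x y ⊆ uIcc a b := by
    rw [uIcc_of_le hxy, uIcc_of_le (hx.1.trans hx.2)]; exact Icc_subset_Icc hx.1 hy.2
  rw [← sub_nonneg, ← (hσ.mono hsub).integral_deriv_eq_sub]
  refine intervalIntegral.integral_nonneg_of_ae_restrict hxy (ae_restrict_Icc_iff.2 ?_)
  filter_upwards [h] with t ht ht'
  exact ht ⟨hx.1.trans_lt ht'.1, ht'.2.trans_le hy.2⟩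

/-- The sign of the curvature is that of `τ'`, and an absolutely continuous function is the integral
of its derivative. From here on c-curves are handled only through monotonicity of the angle. -/
theorem IsDirectionAngle.isLeftCurve_iff (hτ : f.IsDirectionAngle τ) (hf : f.IsCurve) :
    f.IsLeftCurve ↔ MonotoneOn τ (Icc f.a f.b) := by
  rw [IsLeftCurve, and_iff_right hf, ae_restrict_Icc_iff]
  refine ⟨fun h => monotoneOn_of_ae_deriv_nonneg hτ.1 ?_, fun h => ?_⟩
  · filter_upwards [h] with t ht ht'
    have h1 := ht ht'
    have h2 := hf.norm_vel_pos (Ioo_subset_Icc_self ht')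
    rw [hτ.curvature_eq hf ht'] at h1
    by_contra! h3
    exact absurd (div_neg_of_neg_of_pos h3 h2) h1.not_gt
  · refine Filter.Eventually.of_forall fun t ht => ?_
    rw [hτ.curvature_eq hf ht]
    have h1 : 0 ≤ derivWithin τ (Icc f.a f.b) t := h.derivWithin_nonneg
    rw [derivWithin_of_mem_nhds (Icc_mem_nhds ht.1 ht.2)] at h1
    positivity

theorem IsDirectionAngle.isRightCurve_iff (hτ : f.IsDirectionAngle τ) (hf : f.IsCurve) :
    f.IsRightCurve ↔ AntitoneOn τ (Icc f.a f.b) := by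
  rw [IsRightCurve, and_iff_right hf, ae_restrict_Icc_iff]
  refine ⟨fun h => ?_, fun h => ?_⟩
  · have : MonotoneOn (fun t => -τ t) (Icc f.a f.b) := by
      refine monotoneOn_of_ae_deriv_nonneg hτ.1.neg ?_
      filter_upwards [h] with t ht ht'
      have h1 := ht ht'
      have h2 := hf.norm_vel_pos (Ioo_subset_Icc_self ht')
      rw [hτ.curvature_eq hf ht'] at h1
      rw [deriv.fun_neg]
      by_contra! h3
      exact absurd (div_pos (by linarith) h2) h1.not_gt
    intro x hx y hy hxy
    have := this hx hy hxy
    simpa using this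
  · refine Filter.Eventually.of_forall fun t ht => ?_
    rw [hτ.curvature_eq hf ht]
    have h1 : derivWithin τ (Icc f.a f.b) t ≤ 0 := h.derivWithin_nonpos
    rw [derivWithin_of_mem_nhds (Icc_mem_nhds ht.1 ht.2)] at h1
    exact div_nonpos_of_nonpos_of_nonneg h1 (norm_nonneg _)

theorem IsDirectionAngle.isLeftCCurve_iff (hτ : f.IsDirectionAngle τ) (hf : f.IsCurve) :
    f.IsLeftCCurve ↔ MonotoneOn τ (Icc f.a f.b) ∧ τ f.b - τ f.a ≤ Real.pi := by
  rw [IsLeftCCurve, hτ.isLeftCurve_iff hf, hτ.turning_eq hf]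
  refine and_congr_right fun h => ?_
  rw [abs_of_nonneg (sub_nonneg.2 (h (left_mem_Icc.2 hf.1.le) (right_mem_Icc.2 hf.1.le) hf.1.le))]

theorem IsDirectionAngle.isRightCCurve_iff (hτ : f.IsDirectionAngle τ) (hf : f.IsCurve) :
    f.IsRightCCurve ↔ AntitoneOn τ (Icc f.a f.b) ∧ τ f.a - τ f.b ≤ Real.pi := by
  rw [IsRightCCurve, hτ.isRightCurve_iff hf, hτ.turning_eq hf]
  refine and_congr_right fun h => ?_
  rw [abs_sub_comm, abs_of_nonneg
    (sub_nonneg.2 (h (left_mem_Icc.2 hf.1.le) (right_mem_Icc.2 hf.1.le) hf.1.le))]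

theorem IsCurve.vel_restrict (hf : f.IsCurve) (hac : f.a ≤ c) (hcd : c < d)
    (hdb : d ≤ f.b) (ht : t ∈ Icc c d) : (f.restrict c d).vel t = f.vel t := by
  refine vel_eq_of_hasDerivWithinAt (f := f.restrict c d) hcd ht ?_
  exact (hf.hasDerivWithinAt ⟨hac.trans ht.1, ht.2.trans hdb⟩).mono (Icc_subset_Icc hac hdb)

theorem IsCurve.restrict (hf : f.IsCurve) (hac : f.a ≤ c) (hcd : c < d)
    (hdb : d ≤ f.b) : (f.restrict c d).IsCurve := by
  have hs : Icc c d ⊆ Icc f.a f.b := Icc_subset_Icc hac hdb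
  refine ⟨hcd, fun t ht => (hf.2.1 t (hs ht)).mono hs, ?_, fun t ht => ?_⟩
  · refine (hf.2.2.1.mono (c := c) (d := d) ?_).congr_on ?_
    · rwa [uIcc_of_le hcd.le, uIcc_of_le hf.1.le]
    · intro t ht
      rw [uIcc_of_le hcd.le] at ht
      exact (hf.vel_restrict hac hcd hdb ht).symm
  · rw [hf.vel_restrict hac hcd hdb ht]
    exact hf.2.2.2 t (hs ht)

theorem IsCurve.dir_restrict (hf : f.IsCurve) (hac : f.a ≤ c) (hcd : c < d)
    (hdb : d ≤ f.b) (ht : t ∈ Icc c d) : (f.restrict c d).dir t = f.dir t := by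
  rw [dir, dir, hf.vel_restrict hac hcd hdb ht]

theorem IsDirectionAngle.restrict (hf : f.IsCurve) (hac : f.a ≤ c) (hcd : c < d)
    (hdb : d ≤ f.b) (hτ : f.IsDirectionAngle τ) :
    (f.restrict c d).IsDirectionAngle τ := by
  have hs : Icc c d ⊆ Icc f.a f.b := Icc_subset_Icc hac hdb
  refine ⟨hτ.1.mono (c := c) (d := d) ?_, fun t ht => ?_⟩
  · rwa [uIcc_of_le hcd.le, uIcc_of_le hf.1.le]
  · rw [hf.vel_restrict hac hcd hdb ht]
    exact hτ.2 t (hs ht)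

theorem IsDirectionAngle.splitsRightLeft_iff (hτ : f.IsDirectionAngle τ) (hf : f.IsCurve) :
    f.SplitsRightLeft c ↔ c ∈ Ioo f.a f.b ∧
      (AntitoneOn τ (Icc f.a c) ∧ τ f.a - τ c ≤ Real.pi) ∧
      (MonotoneOn τ (Icc c f.b) ∧ τ f.b - τ c ≤ Real.pi) := by
  refine and_congr_right fun hc => ?_
  exact and_congr ((hτ.restrict hf le_rfl hc.1 hc.2.le).isRightCCurve_iff
      (hf.restrict le_rfl hc.1 hc.2.le))
    ((hτ.restrict hf hc.1.le hc.2 le_rfl).isLeftCCurve_iff (hf.restrict hc.1.le hc.2 le_rfl))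

theorem IsDirectionAngle.splitsLeftRight_iff (hτ : f.IsDirectionAngle τ) (hf : f.IsCurve) :
    f.SplitsLeftRight c ↔ c ∈ Ioo f.a f.b ∧
      (MonotoneOn τ (Icc f.a c) ∧ τ c - τ f.a ≤ Real.pi) ∧
      (AntitoneOn τ (Icc c f.b) ∧ τ c - τ f.b ≤ Real.pi) := by
  refine and_congr_right fun hc => ?_
  exact and_congr ((hτ.restrict hf le_rfl hc.1 hc.2.le).isLeftCCurve_iff
      (hf.restrict le_rfl hc.1 hc.2.le))
    ((hτ.restrict hf hc.1.le hc.2 le_rfl).isRightCCurve_iff (hf.restrict hc.1.le hc.2 le_rfl))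

end ElasticSpline.PlanePath

/-! ### The calibration: completing the square in the bending energy. -/

namespace ElasticSpline

/-- The primitive of `√sin` which vanishes at `0`. -/
noncomputable def sqrtSinPrim (x : ℝ) : ℝ := ∫ τ in (0 : ℝ)..x, Real.sqrt (Real.sin τ)

theorem continuous_sqrt_sin : Continuous fun x => Real.sqrt (Real.sin x) :=
  Real.continuous_sqrt.comp Real.continuous_sin

theorem hasDerivAt_sqrtSinPrim (x : ℝ) :
    HasDerivAt sqrtSinPrim (Real.sqrt (Real.sin x)) x :=
  continuous_sqrt_sin.integral_hasStrictDerivAt 0 x |>.hasDerivAt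

theorem contDiff_sqrtSinPrim : ContDiff ℝ 1 sqrtSinPrim := by
  rw [contDiff_one_iff_deriv]
  refine ⟨fun x => (hasDerivAt_sqrtSinPrim x).differentiableAt, ?_⟩
  rw [funext fun x => (hasDerivAt_sqrtSinPrim x).deriv]
  exact continuous_sqrt_sin

@[simp] theorem sqrtSinPrim_zero : sqrtSinPrim 0 = 0 := by simp [sqrtSinPrim]

theorem sqrtSinPrim_strictMonoOn : StrictMonoOn sqrtSinPrim (Icc 0 Real.pi) := by
  refine strictMonoOn_of_deriv_pos (convex_Icc _ _) contDiff_sqrtSinPrim.continuous.continuousOn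
    fun x hx => ?_
  rw [interior_Icc] at hx
  rw [(hasDerivAt_sqrtSinPrim x).deriv]
  exact Real.sqrt_pos.2 (Real.sin_pos_of_mem_Ioo hx)

theorem sqrtSinPrim_nonneg {x : ℝ} (h0 : 0 ≤ x) (h1 : x ≤ Real.pi) : 0 ≤ sqrtSinPrim x := by
  simpa using sqrtSinPrim_strictMonoOn.monotoneOn ⟨le_rfl, Real.pi_pos.le⟩ ⟨h0, h1⟩ h0

theorem sqrtSinPrim_pos {x : ℝ} (h0 : 0 < x) (h1 : x ≤ Real.pi) : 0 < sqrtSinPrim x := by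
  simpa using sqrtSinPrim_strictMonoOn ⟨le_rfl, Real.pi_pos.le⟩ ⟨h0.le, h1⟩ h0

theorem y₁_eq (α γ : ℝ) : y₁ α γ = 1 / 2 * sqrtSinPrim (α - γ) := rfl

theorem y₂_eq (β γ : ℝ) : y₂ β γ = 1 / 2 * sqrtSinPrim (β - γ) := rfl

namespace PlanePath

variable {f : PlanePath} {τ : ℝ → ℝ} {c p q t θ m e α β γ : ℝ}

theorem mul_exp_neg_eq (r x θ : ℝ) :
    (r : ℂ) * Complex.exp (x * Complex.I) * Complex.exp (-(θ * Complex.I)) =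
      (r * Real.cos (x - θ) : ℝ) + (r * Real.sin (x - θ) : ℝ) * Complex.I := by
  rw [mul_assoc, ← Complex.exp_add,
    show (x : ℂ) * Complex.I + -(θ * Complex.I) = ((x - θ : ℝ) : ℂ) * Complex.I by push_cast; ring,
    Complex.exp_mul_I]
  push_cast
  ring

/-- After rotation by `-θ` the imaginary part of the velocity is `sin (τ - θ) |f'|`, so the integral
is the displacement across the direction `θ`. -/
theorem IsDirectionAngle.integral_sin (hτ : f.IsDirectionAngle τ) (hf : f.IsCurve)
    (hap : f.a ≤ p) (hpq : p ≤ q) (hqb : q ≤ f.b) (θ : ℝ) :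
    ∫ t in p..q, Real.sin (τ t - θ) * ‖f.vel t‖ =
      (f.toFun q * Complex.exp (-(θ * Complex.I))).im -
        (f.toFun p * Complex.exp (-(θ * Complex.I))).im := by
  have hs : Icc p q ⊆ Icc f.a f.b := Icc_subset_Icc hap hqb
  refine intervalIntegral.integral_eq_sub_of_hasDerivAt_of_le
    (f := fun t => (f.toFun t * Complex.exp (-(θ * Complex.I))).im) hpq ?_ (fun t ht => ?_) ?_
  · exact Complex.continuous_im.comp_continuousOn
      ((hf.continuousOn_toFun.mono hs).mul continuousOn_const)
  · have ht' : t ∈ Ioo f.a f.b := Ioo_subset_Ioo hap hqb ht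
    have h1 := (hf.hasDerivAt ht').mul_const (Complex.exp (-(θ * Complex.I)))
    have h2 := Complex.imCLM.hasFDerivAt.comp_hasDerivAt t h1
    refine h2.congr_deriv ?_
    conv_lhs => rw [hτ.2 t (Ioo_subset_Icc_self ht'), mul_exp_neg_eq]
    simp only [Complex.imCLM_apply, Complex.add_im, Complex.ofReal_im, Complex.mul_im,
      Complex.I_re, Complex.I_im, Complex.ofReal_re]
    ring
  · refine ContinuousOn.intervalIntegrable ?_
    rw [uIcc_of_le hpq]
    exact (Real.continuous_sin.comp_continuousOn
      (((hτ.continuousOn hf.1.le).mono hs).sub continuousOn_const)).mul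
      (hf.continuousOn_vel.mono hs).norm

theorem IsDirectionAngle.intervalIntegrable_sin (hτ : f.IsDirectionAngle τ) (hf : f.IsCurve)
    (hap : f.a ≤ p) (hpq : p ≤ q) (hqb : q ≤ f.b) (θ : ℝ) :
    IntervalIntegrable (fun t => Real.sin (τ t - θ) * ‖f.vel t‖) volume p q := by
  have hs : Icc p q ⊆ Icc f.a f.b := Icc_subset_Icc hap hqb
  refine ContinuousOn.intervalIntegrable ?_
  rw [uIcc_of_le hpq]
  exact (Real.continuous_sin.comp_continuousOn
    (((hτ.continuousOn hf.1.le).mono hs).sub continuousOn_const)).mul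
    (hf.continuousOn_vel.mono hs).norm

/-- The integrand `κ² |f'|` of the bending energy in terms of a direction angle. -/
noncomputable def energyDensity (f : PlanePath) (τ : ℝ → ℝ) (t : ℝ) : ℝ :=
  deriv τ t ^ 2 / ‖f.vel t‖

/-- The density `(κ - m √sin (τ - θ))² |f'|`. -/
noncomputable def deviation (f : PlanePath) (τ : ℝ → ℝ) (m θ t : ℝ) : ℝ :=
  (deriv τ t - m * (Real.sqrt (Real.sin (τ t - θ)) * ‖f.vel t‖)) ^ 2 / ‖f.vel t‖

theorem deviation_nonneg : 0 ≤ deviation f τ m θ t := by unfold deviation; positivity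

theorem energyDensity_nonneg : 0 ≤ energyDensity f τ t := by unfold energyDensity; positivity

/-- The completed square. The point is that the two correction terms have integrals that depend only
on the end points: the first is an exact derivative, the second a displacement. -/
theorem energyDensity_eq (hv : 0 < ‖f.vel t‖) (hs : 0 ≤ Real.sin (τ t - θ)) :
    energyDensity f τ t = deviation f τ m θ t +
      (2 * m * (Real.sqrt (Real.sin (τ t - θ)) * deriv τ t) -
        m ^ 2 * (Real.sin (τ t - θ) * ‖f.vel t‖)) := by
  unfold energyDensity deviation
  have := Real.sq_sqrt hs
  field_simp
  rw [← this]
  simp only [Real.sqrt_sq (Real.sqrt_nonneg _)]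
  ring

/-- The integrand is almost everywhere the derivative of `sqrtSinPrim (τ - θ)`, which is absolutely
continuous because `sqrtSinPrim` is `C¹`. -/
theorem IsDirectionAngle.integral_sqrt_sin (hτ : f.IsDirectionAngle τ) (hf : f.IsCurve)
    (hap : f.a ≤ p) (hpq : p ≤ q) (hqb : q ≤ f.b) (θ : ℝ) :
    IntervalIntegrable (fun t => Real.sqrt (Real.sin (τ t - θ)) * deriv τ t) volume p q ∧
    ∫ t in p..q, Real.sqrt (Real.sin (τ t - θ)) * deriv τ t =
      sqrtSinPrim (τ q - θ) - sqrtSinPrim (τ p - θ) := by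
  have hs : uIcc p q ⊆ uIcc f.a f.b := by
    rw [uIcc_of_le hpq, uIcc_of_le hf.1.le]; exact Icc_subset_Icc hap hqb
  have hτ' := hτ.1.mono hs
  have hY := hτ'.contDiff_comp (g := fun x => sqrtSinPrim (x - θ))
    (contDiff_sqrtSinPrim.comp (contDiff_id.sub contDiff_const))
  constructor
  · exact hτ'.intervalIntegrable_deriv.continuousOn_mul
      (continuous_sqrt_sin.comp_continuousOn (hτ'.continuousOn.sub continuousOn_const))
  · rw [← hY.integral_deriv_eq_sub]
    refine intervalIntegral.integral_congr_ae ?_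
    filter_upwards [hτ'.ae_differentiableAt] with t ht ht'
    have h1 := (ht (uIoc_subset_uIcc ht')).hasDerivAt
    exact (((hasDerivAt_sqrtSinPrim _).comp t (h1.sub_const θ)).deriv).symm

theorem IsDirectionAngle.integral_energyDensity (hτ : f.IsDirectionAngle τ) (hf : f.IsCurve)
    (hap : f.a ≤ p) (hpq : p ≤ q) (hqb : q ≤ f.b)
    (hs : ∀ t ∈ Icc p q, 0 ≤ Real.sin (τ t - θ))
    (hi : IntervalIntegrable (energyDensity f τ) volume p q) (m : ℝ) :
    IntervalIntegrable (deviation f τ m θ) volume p q ∧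
    ∫ t in p..q, energyDensity f τ t = (∫ t in p..q, deviation f τ m θ t) +
      (2 * m * (sqrtSinPrim (τ q - θ) - sqrtSinPrim (τ p - θ)) -
        m ^ 2 * ((f.toFun q * Complex.exp (-(θ * Complex.I))).im -
          (f.toFun p * Complex.exp (-(θ * Complex.I))).im)) := by
  obtain ⟨i1, h1⟩ := hτ.integral_sqrt_sin hf hap hpq hqb θ
  have i2 := hτ.intervalIntegrable_sin hf hap hpq hqb θ
  have i3 := (i1.const_mul (2 * m)).sub (i2.const_mul (m ^ 2))
  have heq : ∀ t ∈ uIcc p q, energyDensity f τ t = deviation f τ m θ t +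
      (2 * m * (Real.sqrt (Real.sin (τ t - θ)) * deriv τ t) -
        m ^ 2 * (Real.sin (τ t - θ) * ‖f.vel t‖)) := by
    intro t ht
    rw [uIcc_of_le hpq] at ht
    exact energyDensity_eq (hf.norm_vel_pos ⟨hap.trans ht.1, ht.2.trans hqb⟩) (hs t ht)
  have i4 : IntervalIntegrable (deviation f τ m θ) volume p q := by
    refine (hi.sub i3).congr fun t ht => ?_
    have := heq t (uIoc_subset_uIcc ht)
    linarith
  refine ⟨i4, ?_⟩
  rw [intervalIntegral.integral_congr heq, intervalIntegral.integral_add i4 i3,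
    intervalIntegral.integral_sub (i1.const_mul _) (i2.const_mul _),
    intervalIntegral.integral_const_mul, intervalIntegral.integral_const_mul, h1,
    hτ.integral_sin hf hap hpq hqb]

theorem IsDirectionAngle.energy_eq_ofReal (hτ : f.IsDirectionAngle τ) (hf : f.IsCurve)
    (hi : IntervalIntegrable (energyDensity f τ) volume f.a f.b) :
    f.energy = ENNReal.ofReal (1 / 4 * ∫ t in f.a..f.b, energyDensity f τ t) := by
  rw [hτ.energy_eq hf, ENNReal.ofReal_mul (by norm_num), intervalIntegral.integral_of_le hf.1.le,
    ← integral_Icc_eq_integral_Ioc, ofReal_integral_eq_lintegral_ofReal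
      ((intervalIntegrable_iff_integrableOn_Icc_of_le hf.1.le).1 hi)
      (Filter.Eventually.of_forall fun t => energyDensity_nonneg)]
  congr 1
  rw [ENNReal.ofReal_div_of_pos (by norm_num)]
  simp

theorem IsDirectionAngle.intervalIntegrable_energyDensity (hτ : f.IsDirectionAngle τ)
    (hf : f.IsCurve) (hE : f.energy ≠ ⊤) :
    IntervalIntegrable (energyDensity f τ) volume f.a f.b := by
  rw [intervalIntegrable_iff_integrableOn_Icc_of_le hf.1.le]
  have hm : AEStronglyMeasurable (energyDensity f τ) (volume.restrict (Icc f.a f.b)) := by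
    refine AEMeasurable.aestronglyMeasurable ?_
    exact ((measurable_deriv τ).aemeasurable.pow_const 2).div
      (hf.continuousOn_vel.norm.aemeasurable measurableSet_Icc)
  refine ⟨hm, ?_⟩
  rw [hasFiniteIntegral_iff_ofReal (Filter.Eventually.of_forall fun t => energyDensity_nonneg)]
  rw [hτ.energy_eq hf] at hE
  rw [lt_top_iff_ne_top]
  intro h
  refine hE ?_
  have : ∫⁻ t in Icc f.a f.b, ENNReal.ofReal (deriv τ t ^ 2 / ‖f.vel t‖) = ⊤ := h
  rw [this, ENNReal.mul_top (by norm_num)]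

/-- The energy of a curve whose curvature is compared with `± m √sin (τ - θ)`. -/
theorem IsDirectionAngle.integral_energyDensity_two (hτ : f.IsDirectionAngle τ) (hf : f.IsCurve)
    (hc : c ∈ Icc f.a f.b) (hs : ∀ t ∈ Icc f.a f.b, 0 ≤ Real.sin (τ t - θ))
    (hi : IntervalIntegrable (energyDensity f τ) volume f.a f.b) (m : ℝ) :
    IntervalIntegrable (deviation f τ m θ) volume f.a c ∧
    IntervalIntegrable (deviation f τ (-m) θ) volume c f.b ∧
    ∫ t in f.a..f.b, energyDensity f τ t =
      ((∫ t in f.a..c, deviation f τ m θ t) + ∫ t in c..f.b, deviation f τ (-m) θ t) +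
      (2 * m * (2 * sqrtSinPrim (τ c - θ) - sqrtSinPrim (τ f.a - θ) - sqrtSinPrim (τ f.b - θ)) -
        m ^ 2 * ((f.toFun f.b * Complex.exp (-(θ * Complex.I))).im -
          (f.toFun f.a * Complex.exp (-(θ * Complex.I))).im)) := by
  have hi1 : IntervalIntegrable (energyDensity f τ) volume f.a c := hi.mono_set (by
    rw [uIcc_of_le hc.1, uIcc_of_le hf.1.le]; exact Icc_subset_Icc_right hc.2)
  have hi2 : IntervalIntegrable (energyDensity f τ) volume c f.b := hi.mono_set (by
    rw [uIcc_of_le hc.2, uIcc_of_le hf.1.le]; exact Icc_subset_Icc_left hc.1)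
  obtain ⟨i1, h1⟩ := hτ.integral_energyDensity hf le_rfl hc.1 hc.2
    (fun t ht => hs t ⟨ht.1, ht.2.trans hc.2⟩) hi1 m
  obtain ⟨i2, h2⟩ := hτ.integral_energyDensity hf hc.1 hc.2 le_rfl
    (fun t ht => hs t ⟨hc.1.trans ht.1, ht.2⟩) hi2 (-m)
  refine ⟨i1, i2, ?_⟩
  rw [← intervalIntegral.integral_add_adjacent_intervals hi1 hi2, h1, h2]
  ring

end PlanePath

end ElasticSpline

/-! ### The function `G` on `Γ`: derivative and existence of a minimum. -/

namespace ElasticSpline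

section objective

variable {α β γ : ℝ}

/-- The factor in front of `σ` is positive, so criticality of `G` is a condition on `σ` alone. It is
the same `σ` that later prescribes the length of the middle segment of an extremal. -/
theorem hasDerivAt_G (hs : Real.sin γ < 0) (hS : 0 < y₁ α γ + y₂ β γ) :
    HasDerivAt (G α β) ((y₁ α γ + y₂ β γ) ^ 2 / Real.sin γ ^ 2 * sigma α β γ) γ := by
  have d1 : HasDerivAt (y₁ α) (1 / 2 * (Real.sqrt (Real.sin (α - γ)) * -1)) γ :=
    (((hasDerivAt_sqrtSinPrim (α - γ)).comp γ
      ((hasDerivAt_id γ).const_sub α)).const_mul (1 / 2 : ℝ))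
  have d2 : HasDerivAt (y₂ β) (1 / 2 * (Real.sqrt (Real.sin (β - γ)) * -1)) γ :=
    (((hasDerivAt_sqrtSinPrim (β - γ)).comp γ
      ((hasDerivAt_id γ).const_sub β)).const_mul (1 / 2 : ℝ))
  have d3 := ((Real.hasDerivAt_sin γ).neg.fun_inv (by simpa using hs.ne)).mul ((d1.add d2).fun_pow 2)
  have : G α β = (fun x => (-Real.sin x)⁻¹) * fun x => (y₁ α x + y₂ β x) ^ 2 := by
    funext x; simp [G]
  rw [this]
  refine d3.congr_deriv ?_
  have := hs.ne
  have := hS.ne'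
  simp only [sigma, Pi.neg_apply, Pi.add_apply]
  field_simp
  push_cast
  ring

theorem GammaSet_bounds (hγ : γ ∈ GammaSet α β) :
    α - Real.pi ≤ γ ∧ γ < 0 ∧ γ ≤ β := by
  unfold GammaSet at hγ
  split_ifs at hγ with h
  · exact ⟨hγ.1, hγ.2.trans_lt h, hγ.2⟩
  · exact ⟨hγ.1, hγ.2, hγ.2.le.trans (not_lt.1 h)⟩

theorem convex_GammaSet : Convex ℝ (GammaSet α β) := by
  unfold GammaSet
  split_ifs
  exacts [convex_Icc _ _, convex_Ico _ _]

theorem sum_pos (hγα : γ < α) (h1 : α - γ ≤ Real.pi) (hγβ : γ ≤ β) (h2 : β - γ ≤ Real.pi) :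
    0 < y₁ α γ + y₂ β γ := by
  rw [y₁_eq, y₂_eq]
  have := sqrtSinPrim_pos (sub_pos.2 hγα) h1
  have := sqrtSinPrim_nonneg (sub_nonneg.2 hγβ) h2
  linarith

theorem GammaSet_pos (hα : α ∈ Ioo 0 Real.pi) (hβα : |β| ≤ α) (hγ : γ ∈ GammaSet α β) :
    Real.sin γ < 0 ∧ 0 < y₁ α γ + y₂ β γ := by
  obtain ⟨h1, h2, h3⟩ := GammaSet_bounds hγ
  have := abs_le.1 hβα
  exact ⟨Real.sin_neg_of_neg_of_neg_pi_lt h2 (by linarith [hα.1]),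
    sum_pos (by linarith [hα.1]) (by linarith) h3 (by linarith)⟩

/-- `σ` has the sign of the derivative of `G` at a minimum. -/
theorem sigma_mul_nonneg (hα : α ∈ Ioo 0 Real.pi) (hβα : |β| ≤ α) (hγ : γ ∈ GammaSet α β)
    (hmin : ∀ x ∈ GammaSet α β, G α β γ ≤ G α β x) {x : ℝ} (hx : x ∈ GammaSet α β) :
    0 ≤ sigma α β γ * (x - γ) := by
  obtain ⟨hs, hS⟩ := GammaSet_pos hα hβα hγ
  have hm : IsLocalMinOn (G α β) (GammaSet α β) γ := IsMinOn.localize hmin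
  -- The segment from `γ` to `x` stays in the convex set `Γ`, so `x - γ` is a tangent direction and
  -- the derivative along it is nonnegative. Interior points and end points are thereby treated
  -- alike.
  have := hm.hasFDerivWithinAt_nonneg (hasDerivAt_G hs hS).hasFDerivAt.hasFDerivWithinAt
    (sub_mem_posTangentConeAt_of_segment_subset (convex_GammaSet.segment_subset hγ hx))
  simp at this
  have hp : 0 < (y₁ α γ + y₂ β γ) ^ 2 / Real.sin γ ^ 2 := by
    have := hs.ne
    positivity
  nlinarith

/-- For `β < 0` the set `Γ` is compact. For `β ≥ 0` it is open at `0`, but there `-sin γ` tends to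
`0` while `y₁ + y₂` stays above `sqrtSinPrim α / 2`, so `G` blows up and a truncated compact
interval suffices. -/
theorem exists_isLeast_G (hα : α ∈ Ioo 0 Real.pi) (hβα : |β| ≤ α) (hβ : α - Real.pi < β) :
    ∃ Gmin : ℝ, IsLeast (G α β '' GammaSet α β) Gmin := by
  have hc : ContinuousOn (G α β) (GammaSet α β) := fun γ hγ => by
    obtain ⟨hs, hS⟩ := GammaSet_pos hα hβα hγ
    exact (hasDerivAt_G hs hS).continuousAt.continuousWithinAt
  obtain ⟨hα0, hαπ⟩ := hα
  suffices h : ∃ γ ∈ GammaSet α β, ∀ x ∈ GammaSet α β, G α β γ ≤ G α β x by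
    obtain ⟨γ, h1, h2⟩ := h
    exact ⟨G α β γ, mem_image_of_mem _ h1, by rintro _ ⟨x, hx, rfl⟩; exact h2 x hx⟩
  by_cases hb : β < 0
  · have hG : GammaSet α β = Icc (α - Real.pi) β := if_pos hb
    rw [hG] at hc ⊢
    exact isCompact_Icc.exists_isMinOn (nonempty_Icc.2 hβ.le) hc
  · have hG : GammaSet α β = Ico (α - Real.pi) 0 := if_neg hb
    have hk : 0 < sqrtSinPrim α / 2 := half_pos (sqrtSinPrim_pos hα0 hαπ.le)
    set k := sqrtSinPrim α / 2 with hkdef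
    set g := G α β (α - Real.pi)
    have hg : 0 ≤ g := by
      obtain ⟨hs, hS⟩ := GammaSet_pos ⟨hα0, hαπ⟩ hβα
        (show α - Real.pi ∈ GammaSet α β by rw [hG]; exact ⟨le_rfl, by linarith⟩)
      have : 0 < -Real.sin (α - Real.pi) := by linarith
      simp only [g, G]; positivity
    -- For `-δ < x < 0` the first bound gives `-sin x ≤ k² / (g + 1)`, hence `G(x) ≥ g + 1`, more
    -- than the value `g` at the left end. The second bound keeps the left end in the truncated
    -- interval.
    set δ := min (k ^ 2 / (g + 1)) (Real.pi - α) with hδ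
    have hδ0 : 0 < δ := lt_min (by positivity) (by linarith)
    have hsub : Icc (α - Real.pi) (-δ) ⊆ GammaSet α β := by
      rw [hG]; exact fun x hx => ⟨hx.1, by linarith [hx.2]⟩
    have hmem : α - Real.pi ∈ Icc (α - Real.pi) (-δ) :=
      ⟨le_rfl, by have := min_le_right (k ^ 2 / (g + 1)) (Real.pi - α); linarith⟩
    obtain ⟨γ, h1, h2⟩ := isCompact_Icc.exists_isMinOn ⟨_, hmem⟩ (hc.mono hsub)
    refine ⟨γ, hsub h1, fun x hx => ?_⟩
    have h2' : ∀ y ∈ Icc (α - Real.pi) (-δ), G α β γ ≤ G α β y := h2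
    by_cases hxδ : x ≤ -δ
    · rw [hG] at hx
      exact h2' x ⟨hx.1, hxδ⟩
    · refine (h2' _ hmem).trans ?_
      obtain ⟨hs, hS⟩ := GammaSet_pos ⟨hα0, hαπ⟩ hβα hx
      obtain ⟨b1, b2, b3⟩ := GammaSet_bounds hx
      have hy1 : k ≤ y₁ α x + y₂ β x := by
        rw [y₁_eq, y₂_eq]
        have e1 := sqrtSinPrim_strictMonoOn.monotoneOn ⟨hα0.le, hαπ.le⟩
          ⟨by linarith, by linarith⟩ (show α ≤ α - x by linarith)
        have e2 := sqrtSinPrim_nonneg (sub_nonneg.2 b3) (by linarith [abs_le.1 hβα])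
        linarith
      have hsx : -Real.sin x ≤ k ^ 2 / (g + 1) := by
        have := Real.sin_lt (show 0 < -x by linarith)
        rw [Real.sin_neg] at this
        have := min_le_left (k ^ 2 / (g + 1)) (Real.pi - α)
        linarith
      have hsx0 : 0 < -Real.sin x := by linarith
      change g ≤ 1 / (-Real.sin x) * (y₁ α x + y₂ β x) ^ 2
      rw [one_div, inv_mul_eq_div, le_div_iff₀ hsx0]
      rw [le_div_iff₀ (by positivity)] at hsx
      have : k ^ 2 ≤ (y₁ α x + y₂ β x) ^ 2 := by gcongr
      nlinarith

end objective

/-! ### Right-left curves: the lower bound `G(γ)` and the equality condition. -/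

namespace PlanePath

variable {f : PlanePath} {τ : ℝ → ℝ} {c p q t θ m α β γ : ℝ}

/-- A curve that never moves to the right of the direction `θ`, and somewhere moves strictly to its
left, ends strictly to the left. This is what excludes impossible configurations of end points. -/
theorem IsDirectionAngle.integral_sin_pos (hτ : f.IsDirectionAngle τ) (hf : f.IsCurve)
    (hs : ∀ t ∈ Icc f.a f.b, 0 ≤ Real.sin (τ t - θ)) (hp : ∃ t ∈ Icc f.a f.b, 0 < Real.sin (τ t - θ)) :
    0 < (f.toFun f.b * Complex.exp (-(θ * Complex.I))).im -
      (f.toFun f.a * Complex.exp (-(θ * Complex.I))).im := by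
  rw [← hτ.integral_sin hf le_rfl hf.1.le le_rfl]
  refine intervalIntegral.integral_pos hf.1 ?_ (fun t ht => ?_) ?_
  · exact (Real.continuous_sin.comp_continuousOn
      ((hτ.continuousOn hf.1.le).sub continuousOn_const)).mul hf.continuousOn_vel.norm
  · exact mul_nonneg (hs t (Ioc_subset_Icc_self ht)) (norm_nonneg _)
  · obtain ⟨t, ht, h⟩ := hp
    exact ⟨t, ht, mul_pos h (hf.norm_vel_pos ht)⟩

theorem im_exp_neg (γ : ℝ) : ((1 : ℂ) * Complex.exp (-(γ * Complex.I))).im = -Real.sin γ := by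
  rw [one_mul, show -((γ : ℂ) * Complex.I) = ((-γ : ℝ) : ℂ) * Complex.I by push_cast; ring,
    Complex.exp_ofReal_mul_I_im, Real.sin_neg]

/-- A curve from `0` to `1` whose direction angle `τ` decreases from `α` to `γ` on `[a, c]` and
increases from `γ` to `β` on `[c, b]`. -/
structure IsRightLeft (f : PlanePath) (τ : ℝ → ℝ) (c α β γ : ℝ) : Prop where
  curve : f.IsCurve
  angle : f.IsDirectionAngle τ
  mem : c ∈ Ioc f.a f.b
  anti : AntitoneOn τ (Icc f.a c)
  mono : MonotoneOn τ (Icc c f.b)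
  angle_start : τ f.a = α
  angle_mid : τ c = γ
  angle_finish : τ f.b = β
  lt : γ < α
  le₁ : α - γ ≤ Real.pi
  le₂ : β - γ ≤ Real.pi
  start : f.toFun f.a = 0
  finish : f.toFun f.b = 1

namespace IsRightLeft

theorem le (h : IsRightLeft f τ c α β γ) : γ ≤ β := by
  rw [← h.angle_mid, ← h.angle_finish]
  exact h.mono ⟨le_rfl, h.mem.2⟩ ⟨h.mem.2, le_rfl⟩ h.mem.2

/-- This is where the bound `π` on the turning of c-curves enters: it makes `sin (τ - γ)`
nonnegative, so that its square root calibrates. -/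
theorem angle_sub_mem (h : IsRightLeft f τ c α β γ) (ht : t ∈ Icc f.a f.b) :
    τ t - γ ∈ Icc 0 Real.pi := by
  rcases le_total t c with htc | htc
  · have h1 := h.anti ⟨ht.1, htc⟩ ⟨h.mem.1.le, le_rfl⟩ htc
    have h2 := h.anti ⟨le_rfl, h.mem.1.le⟩ ⟨ht.1, htc⟩ ht.1
    rw [h.angle_mid] at h1
    rw [h.angle_start] at h2
    exact ⟨by linarith, by linarith [h.le₁]⟩
  · have h1 := h.mono ⟨le_rfl, h.mem.2⟩ ⟨htc, ht.2⟩ htc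
    have h2 := h.mono ⟨htc, ht.2⟩ ⟨h.mem.2, le_rfl⟩ ht.2
    rw [h.angle_mid] at h1
    rw [h.angle_finish] at h2
    exact ⟨by linarith, by linarith [h.le₂]⟩

theorem sin_nonneg (h : IsRightLeft f τ c α β γ) (ht : t ∈ Icc f.a f.b) :
    0 ≤ Real.sin (τ t - γ) :=
  Real.sin_nonneg_of_mem_Icc (h.angle_sub_mem ht)

/-- The displacement from `0` to `1` across the direction `γ` equals `-sin γ`. It is positive, since
`sin (τ - γ)` is nonnegative throughout and positive where `τ = (α + γ) / 2`. -/
theorem neg_sin_pos (h : IsRightLeft f τ c α β γ) : 0 < -Real.sin γ := by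
  have hc : ContinuousOn τ (Icc f.a c) :=
    (h.angle.continuousOn h.curve.1.le).mono (Icc_subset_Icc_right h.mem.2)
  obtain ⟨t, ht, htv⟩ := intermediate_value_Icc' h.mem.1.le hc
    (show (α + γ) / 2 ∈ Icc (τ c) (τ f.a) by
      rw [h.angle_start, h.angle_mid]; constructor <;> linarith [h.lt])
  have := h.angle.integral_sin_pos h.curve (θ := γ) (fun t ht => h.sin_nonneg ht)
    ⟨t, ⟨ht.1, ht.2.trans h.mem.2⟩, by
      rw [htv]
      exact Real.sin_pos_of_pos_of_lt_pi (by linarith [h.lt])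
        (by linarith [h.le₁, Real.pi_pos])⟩
  rw [h.start, h.finish, im_exp_neg] at this
  simpa using this

theorem sum_pos (h : IsRightLeft f τ c α β γ) : 0 < y₁ α γ + y₂ β γ :=
  ElasticSpline.sum_pos h.lt h.le₁ h.le h.le₂

theorem lam_pos (h : IsRightLeft f τ c α β γ) : 0 < lam α β γ :=
  div_pos h.neg_sin_pos h.sum_pos

theorem G_nonneg (h : IsRightLeft f τ c α β γ) : 0 ≤ G α β γ := by
  have := h.neg_sin_pos
  unfold G
  positivity

/-- With slope `m` the end point terms add up to `m (y₁ + y₂) - m² (-sin γ) / 4`. This is maximal at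
`m = 2 / λ`, where it equals `G`. -/
theorem energy_identity (h : IsRightLeft f τ c α β γ)
    (hi : IntervalIntegrable (energyDensity f τ) volume f.a f.b) :
    IntervalIntegrable (deviation f τ (-(2 / lam α β γ)) γ) volume f.a c ∧
    IntervalIntegrable (deviation f τ (2 / lam α β γ) γ) volume c f.b ∧
    f.energy = ENNReal.ofReal (G α β γ + 1 / 4 *
      ((∫ t in f.a..c, deviation f τ (-(2 / lam α β γ)) γ t) +
        ∫ t in c..f.b, deviation f τ (2 / lam α β γ) γ t)) := by
  obtain ⟨h1, h2, h3⟩ := h.angle.integral_energyDensity_two h.curve ⟨h.mem.1.le, h.mem.2⟩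
    (fun t ht => h.sin_nonneg ht) hi (-(2 / lam α β γ))
  rw [neg_neg] at h2 h3
  refine ⟨h1, h2, ?_⟩
  rw [h.angle.energy_eq_ofReal h.curve hi, h3, h.angle_start, h.angle_mid, h.angle_finish,
    h.start, h.finish, im_exp_neg, mul_add, add_comm]
  congr 2
  have e1 : sqrtSinPrim (α - γ) = 2 * y₁ α γ := by rw [y₁_eq]; ring
  have e2 : sqrtSinPrim (β - γ) = 2 * y₂ β γ := by rw [y₂_eq]; ring
  have hs := h.neg_sin_pos.ne'
  have hS := h.sum_pos.ne'
  rw [neg_ne_zero] at hs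
  rw [e1, e2, sub_self, sqrtSinPrim_zero, lam, G]
  simp
  field_simp
  ring

theorem energy_ge (h : IsRightLeft f τ c α β γ) : ENNReal.ofReal (G α β γ) ≤ f.energy := by
  by_cases hE : f.energy = ⊤
  · simp [hE]
  obtain ⟨-, -, h3⟩ := h.energy_identity (h.angle.intervalIntegrable_energyDensity h.curve hE)
  rw [h3]
  refine ENNReal.ofReal_le_ofReal ?_
  have e1 : 0 ≤ ∫ t in f.a..c, deviation f τ (-(2 / lam α β γ)) γ t :=
    intervalIntegral.integral_nonneg h.mem.1.le fun t _ => deviation_nonneg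
  have e2 : 0 ≤ ∫ t in c..f.b, deviation f τ (2 / lam α β γ) γ t :=
    intervalIntegral.integral_nonneg h.mem.2 fun t _ => deviation_nonneg
  linarith

theorem ae_deriv_eq_of_integral_deviation (hf : f.IsCurve) (hap : f.a ≤ p) (hpq : p ≤ q)
    (hqb : q ≤ f.b) (hi : IntervalIntegrable (deviation f τ m θ) volume p q)
    (h0 : ∫ t in p..q, deviation f τ m θ t = 0) :
    ∀ᵐ t, t ∈ Ioc p q →
      deriv τ t = m * (Real.sqrt (Real.sin (τ t - θ)) * ‖f.vel t‖) := by
  rw [intervalIntegral.integral_eq_zero_iff_of_le_of_nonneg_ae hpq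
    (Filter.Eventually.of_forall fun t => deviation_nonneg) hi] at h0
  have h1 := (ae_restrict_iff' measurableSet_Ioc).1 h0
  filter_upwards [h1] with t ht htm
  have h2 := ht htm
  have h3 := (hf.norm_vel_pos (t := t) ⟨hap.trans htm.1.le, htm.2.trans hqb⟩).ne'
  simp only [deviation, Pi.zero_apply, div_eq_zero_iff, h3, or_false] at h2
  exact sub_eq_zero.1 (pow_eq_zero_iff (two_ne_zero) |>.1 h2)

theorem ae_deriv_eq (h : IsRightLeft f τ c α β γ) (hE : f.energy = ENNReal.ofReal (G α β γ)) :
    (∀ᵐ t, t ∈ Ioc f.a c → deriv τ t =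
      -(2 / lam α β γ) * (Real.sqrt (Real.sin (τ t - γ)) * ‖f.vel t‖)) ∧
    (∀ᵐ t, t ∈ Ioc c f.b → deriv τ t =
      2 / lam α β γ * (Real.sqrt (Real.sin (τ t - γ)) * ‖f.vel t‖)) := by
  obtain ⟨i1, i2, h3⟩ := h.energy_identity
    (h.angle.intervalIntegrable_energyDensity h.curve (by simp [hE]))
  have e1 : 0 ≤ ∫ t in f.a..c, deviation f τ (-(2 / lam α β γ)) γ t :=
    intervalIntegral.integral_nonneg h.mem.1.le fun t _ => deviation_nonneg
  have e2 : 0 ≤ ∫ t in c..f.b, deviation f τ (2 / lam α β γ) γ t :=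
    intervalIntegral.integral_nonneg h.mem.2 fun t _ => deviation_nonneg
  have hG := h.G_nonneg
  rw [hE, ENNReal.ofReal_eq_ofReal_iff hG (by positivity)] at h3
  exact ⟨ae_deriv_eq_of_integral_deviation h.curve le_rfl h.mem.1.le h.mem.2 i1 (by linarith),
    ae_deriv_eq_of_integral_deviation h.curve h.mem.1.le h.mem.2 le_rfl i2 (by linarith)⟩

theorem energy_eq (h : IsRightLeft f τ c α β γ)
    (h1 : ∀ t ∈ Ioo f.a c, deriv τ t =
      -(2 / lam α β γ) * (Real.sqrt (Real.sin (τ t - γ)) * ‖f.vel t‖))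
    (h2 : ∀ t ∈ Ioo c f.b, deriv τ t =
      2 / lam α β γ * (Real.sqrt (Real.sin (τ t - γ)) * ‖f.vel t‖)) :
    f.energy = ENNReal.ofReal (G α β γ) := by
  -- Under the curvature equations the energy density agrees, off the point `c`, with a continuous
  -- function. This gives the integrability required by the identity, without assuming finite
  -- energy.
  have key : ∀ᵐ t, t ∈ Ioo f.a f.b → energyDensity f τ t =
      (2 / lam α β γ) ^ 2 * (Real.sin (τ t - γ) * ‖f.vel t‖) := by
    have hne : ∀ᵐ t : ℝ, t ≠ c := by simp [ae_iff]
    filter_upwards [hne] with t htc ht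
    have hv := (h.curve.norm_vel_pos (Ioo_subset_Icc_self ht)).ne'
    have hs := Real.sq_sqrt (h.sin_nonneg (Ioo_subset_Icc_self ht))
    rw [energyDensity]
    rcases lt_or_gt_of_ne htc with hlt | hlt
    · rw [h1 t ⟨ht.1, hlt⟩, mul_pow, mul_pow, hs]; field_simp
    · rw [h2 t ⟨hlt, ht.2⟩, mul_pow, mul_pow, hs]; field_simp
  have hi : IntervalIntegrable (energyDensity f τ) volume f.a f.b := by
    refine ((h.angle.intervalIntegrable_sin h.curve le_rfl h.curve.1.le le_rfl γ).const_mul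
      ((2 / lam α β γ) ^ 2)).congr_ae ?_
    rw [uIoc_of_le h.curve.1.le, Filter.EventuallyEq,
      ← Measure.restrict_congr_set (Ioo_ae_eq_Ioc (μ := volume)),
      ae_restrict_iff' measurableSet_Ioo]
    filter_upwards [key] with t ht ht'
    exact (ht ht').symm
  obtain ⟨-, -, h3⟩ := h.energy_identity hi
  have z1 : ∫ t in f.a..c, deviation f τ (-(2 / lam α β γ)) γ t = 0 := by
    rw [intervalIntegral.integral_of_le h.mem.1.le, integral_Ioc_eq_integral_Ioo]
    refine setIntegral_eq_zero_of_forall_eq_zero fun t ht => ?_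
    rw [deviation, h1 t ht]; simp
  have z2 : ∫ t in c..f.b, deviation f τ (2 / lam α β γ) γ t = 0 := by
    rw [intervalIntegral.integral_of_le h.mem.2, integral_Ioc_eq_integral_Ioo]
    refine setIntegral_eq_zero_of_forall_eq_zero fun t ht => ?_
    rw [deviation, h2 t ht]; simp
  rw [h3, z1, z2]
  simp

end IsRightLeft

end PlanePath

end ElasticSpline

/-! ### Which s-curves join `u` to `v`, and the lower bound for all of them. -/

namespace ElasticSpline

namespace PlanePath

variable {f : PlanePath} {τ : ℝ → ℝ} {c p q t θ m α β γ : ℝ}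

theorem Connects.data (h : f.Connects (uVec α) (vVec β)) :
    f.toFun f.a = 0 ∧ f.dir f.a = Complex.exp (α * Complex.I) ∧
      f.toFun f.b = 1 ∧ f.dir f.b = Complex.exp (β * Complex.I) :=
  ⟨congrArg Prod.fst h.1, congrArg Prod.snd h.1, congrArg Prod.fst h.2, congrArg Prod.snd h.2⟩

theorem IsRightLeft.mem_GammaSet (h : IsRightLeft f τ c α β γ) (hα : α ∈ Ioo 0 Real.pi) :
    γ ∈ GammaSet α β := by
  have h1 := h.neg_sin_pos
  have h0 : γ < 0 := by
    by_contra! h2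
    have := Real.sin_nonneg_of_nonneg_of_le_pi h2 (h.lt.le.trans hα.2.le)
    linarith
  have := h.le
  have := h.le₁
  unfold GammaSet
  split_ifs
  · exact ⟨by linarith, h.le⟩
  · exact ⟨by linarith, h0⟩

/-- The terminal direction fixes the final angle only modulo `2π`. The bounds on the turning place
it in `[α - π, α + π]`, and there `β > α - π` leaves only `β` itself. -/
theorem SplitsRightLeft.exists_isRightLeft (hα : α ∈ Ioo 0 Real.pi) (hβα : |β| ≤ α)
    (hβ : α - Real.pi < β) (hf : f.IsCurve) (hc : f.Connects (uVec α) (vVec β))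
    (hs : f.SplitsRightLeft c) (hn : ¬ f.IsCCurve) :
    ∃ τ γ, IsRightLeft f τ c α β γ ∧ γ < β ∧ γ ∈ GammaSet α β := by
  obtain ⟨h0, hdir, h1, hdir'⟩ := hc.data
  obtain ⟨τ, hτ, hτa⟩ := hf.exists_isDirectionAngle_start hdir
  obtain ⟨hcm, ⟨ha, ha'⟩, ⟨hm, hm'⟩⟩ := (hτ.splitsRightLeft_iff hf).1 hs
  have hac : τ c ≤ τ f.a := ha ⟨le_rfl, hcm.1.le⟩ ⟨hcm.1.le, le_rfl⟩ hcm.1.le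
  have hcb : τ c ≤ τ f.b := hm ⟨le_rfl, hcm.2.le⟩ ⟨hcm.2.le, le_rfl⟩ hcm.2.le
  have hβ' := abs_le.1 hβα
  have hτb : τ f.b = β := by
    refine eq_of_exp_mul_I_eq ?_ (by linarith) (by linarith [Real.pi_pos])
    rw [← hdir', hτ.dir_eq hf (right_mem_Icc.2 hf.1.le)]
  -- Otherwise the angle is constant after `c` and the whole curve is a right c-curve, against
  -- non-degeneracy.
  have hlt : τ c < β := by
    refine lt_of_le_of_ne (hcb.trans_eq hτb) fun he => hn (Or.inr ?_)
    rw [hτ.isRightCCurve_iff hf]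
    refine ⟨?_, by linarith [Real.pi_pos]⟩
    have hconst : ∀ t ∈ Icc c f.b, τ t = β := fun t ht => le_antisymm
      ((hm ht ⟨hcm.2.le, le_rfl⟩ ht.2).trans_eq hτb)
      (he ▸ hm ⟨le_rfl, hcm.2.le⟩ ht ht.1)
    intro x hx y hy hxy
    rcases le_total y c with hyc | hyc
    · exact ha ⟨hx.1, hxy.trans hyc⟩ ⟨hy.1, hyc⟩ hxy
    · rw [hconst y ⟨hyc, hy.2⟩]
      rcases le_total x c with hxc | hxc
      · exact he ▸ ha ⟨hx.1, hxc⟩ ⟨hcm.1.le, le_rfl⟩ hxc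
      · rw [hconst x ⟨hxc, hx.2⟩]
  have hR : IsRightLeft f τ c α β (τ c) :=
    ⟨hf, hτ, ⟨hcm.1, hcm.2.le⟩, ha, hm, hτa, rfl, hτb, by linarith, hτa ▸ ha', hτb ▸ hm', h0, h1⟩
  exact ⟨τ, τ c, hR, hlt, hR.mem_GammaSet hα⟩

/-- A straight curve in the direction `α` leaves the real axis, since `sin α > 0`, and cannot end at
`1`. -/
theorem IsDirectionAngle.not_const (hα : α ∈ Ioo 0 Real.pi) (hτ : f.IsDirectionAngle τ)
    (hf : f.IsCurve) (h0 : f.toFun f.a = 0) (h1 : f.toFun f.b = 1)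
    (h : ∀ t ∈ Icc f.a f.b, τ t = α) : False := by
  have e := hτ.integral_sin hf le_rfl hf.1.le le_rfl α
  have z : ∫ t in f.a..f.b, Real.sin (τ t - α) * ‖f.vel t‖ = 0 := by
    rw [intervalIntegral.integral_congr (g := fun _ => 0)]
    · simp
    · intro t ht
      rw [uIcc_of_le hf.1.le] at ht
      simp [h t ht]
  rw [z, h0, h1, im_exp_neg] at e
  have := Real.sin_pos_of_mem_Ioo hα
  simp at e
  linarith

/-- A right c-curve is the limiting right-left curve whose left part is a point, `c = f.b`, and
whose inflection direction is `β`. -/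
theorem IsRightCCurve.exists_isRightLeft (hα : α ∈ Ioo 0 Real.pi) (hβα : |β| ≤ α)
    (hβ : α - Real.pi < β) (hf : f.IsRightCCurve) (hc : f.Connects (uVec α) (vVec β)) :
    ∃ τ, IsRightLeft f τ f.b α β β ∧ β < 0 := by
  have hf' := hf.1.1
  obtain ⟨h0, hdir, h1, hdir'⟩ := hc.data
  obtain ⟨τ, hτ, hτa⟩ := hf'.exists_isDirectionAngle_start hdir
  obtain ⟨ha, ha'⟩ := (hτ.isRightCCurve_iff hf').1 hf
  have hab : τ f.b ≤ τ f.a := ha ⟨le_rfl, hf'.1.le⟩ ⟨hf'.1.le, le_rfl⟩ hf'.1.le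
  have hβ' := abs_le.1 hβα
  have hτb : τ f.b = β := by
    refine eq_of_exp_mul_I_eq ?_ (by linarith) (by linarith [Real.pi_pos])
    rw [← hdir', hτ.dir_eq hf' (right_mem_Icc.2 hf'.1.le)]
  have hlt : β < α := by
    refine lt_of_le_of_ne hβ'.2 fun he => hτ.not_const hα hf' h0 h1 fun t ht => le_antisymm ?_ ?_
    · exact hτa ▸ ha ⟨le_rfl, hf'.1.le⟩ ht ht.1
    · exact (hτb.trans he) ▸ ha ht ⟨hf'.1.le, le_rfl⟩ ht.2
  have hR : IsRightLeft f τ f.b α β β :=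
    ⟨hf', hτ, ⟨hf'.1, le_rfl⟩, ha, by simp, hτa, hτb, hτb, hlt, by linarith,
      by simp [Real.pi_pos.le], h0, h1⟩
  refine ⟨τ, hR, ?_⟩
  by_contra! h2
  have := Real.sin_nonneg_of_nonneg_of_le_pi h2 (hlt.le.trans hα.2.le)
  linarith [hR.neg_sin_pos]

/-- A left c-curve would need `β ≥ α`, hence `β = α` and a constant direction angle. -/
theorem not_isLeftCCurve (hα : α ∈ Ioo 0 Real.pi) (hβα : |β| ≤ α)
    (hβ : α - Real.pi < β) (hc : f.Connects (uVec α) (vVec β)) : ¬ f.IsLeftCCurve := by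
  intro hf
  have hf' := hf.1.1
  obtain ⟨h0, hdir, h1, hdir'⟩ := hc.data
  obtain ⟨τ, hτ, hτa⟩ := hf'.exists_isDirectionAngle_start hdir
  obtain ⟨ha, ha'⟩ := (hτ.isLeftCCurve_iff hf').1 hf
  have hab : τ f.a ≤ τ f.b := ha ⟨le_rfl, hf'.1.le⟩ ⟨hf'.1.le, le_rfl⟩ hf'.1.le
  have hβ' := abs_le.1 hβα
  have hτb : τ f.b = β := by
    refine eq_of_exp_mul_I_eq ?_ (by linarith) (by linarith [Real.pi_pos])
    rw [← hdir', hτ.dir_eq hf' (right_mem_Icc.2 hf'.1.le)]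
  have he : β = α := le_antisymm hβ'.2 (by linarith)
  refine hτ.not_const hα hf' h0 h1 fun t ht => le_antisymm ?_ ?_
  · exact (hτb.trans he) ▸ ha ht ⟨hf'.1.le, le_rfl⟩ ht.2
  · exact hτa ▸ ha ⟨le_rfl, hf'.1.le⟩ ht ht.1

/-- A non-degenerate left-right s-curve exists only for `β < 0`, and has more energy than the
bound for right c-curves. -/
theorem SplitsLeftRight.lt_energy (hα : α ∈ Ioo 0 Real.pi) (hβα : |β| ≤ α)
    (hβ : α - Real.pi < β) (hf : f.IsCurve) (hc : f.Connects (uVec α) (vVec β))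
    (hs : f.SplitsLeftRight c) (hn : ¬ f.IsCCurve) :
    β < 0 ∧ ENNReal.ofReal (G α β β) < f.energy := by
  obtain ⟨h0, hdir, h1, hdir'⟩ := hc.data
  obtain ⟨τ, hτ, hτa⟩ := hf.exists_isDirectionAngle_start hdir
  obtain ⟨hcm, ⟨ha, ha'⟩, ⟨hm, hm'⟩⟩ := (hτ.splitsLeftRight_iff hf).1 hs
  have hac : τ f.a ≤ τ c := ha ⟨le_rfl, hcm.1.le⟩ ⟨hcm.1.le, le_rfl⟩ hcm.1.le
  have hcb : τ f.b ≤ τ c := hm ⟨le_rfl, hcm.2.le⟩ ⟨hcm.2.le, le_rfl⟩ hcm.2.le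
  have hβ' := abs_le.1 hβα
  have hτb : τ f.b = β := by
    refine eq_of_exp_mul_I_eq ?_ (by linarith) (by linarith [Real.pi_pos])
    rw [← hdir', hτ.dir_eq hf (right_mem_Icc.2 hf.1.le)]
  -- Otherwise the left part is straight and the curve is a right c-curve.
  have hlt : α < τ c := by
    refine lt_of_le_of_ne (hτa ▸ hac) fun he => hn (Or.inr ?_)
    rw [hτ.isRightCCurve_iff hf]
    refine ⟨?_, by linarith⟩
    have hconst : ∀ t ∈ Icc f.a c, τ t = α := fun t ht => le_antisymm
      (he ▸ ha ht ⟨hcm.1.le, le_rfl⟩ ht.2) (hτa ▸ ha ⟨le_rfl, hcm.1.le⟩ ht ht.1)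
    intro x hx y hy hxy
    rcases le_total x c with hxc | hxc
    · rw [hconst x ⟨hx.1, hxc⟩]
      rcases le_total y c with hyc | hyc
      · rw [hconst y ⟨hy.1, hyc⟩]
      · exact he ▸ hm ⟨le_rfl, hcm.2.le⟩ ⟨hyc, hy.2⟩ hyc
    · exact hm ⟨hxc, hx.2⟩ ⟨hxc.trans hxy, hy.2⟩ hxy
  have hrange : ∀ t ∈ Icc f.a f.b, β ≤ τ t ∧ τ t ≤ τ c := by
    intro t ht
    rcases le_total t c with htc | htc
    · have e1 := ha ⟨le_rfl, hcm.1.le⟩ ⟨ht.1, htc⟩ ht.1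
      exact ⟨by linarith, ha ⟨ht.1, htc⟩ ⟨hcm.1.le, le_rfl⟩ htc⟩
    · have e1 := hm ⟨htc, ht.2⟩ ⟨hcm.2.le, le_rfl⟩ ht.2
      exact ⟨by linarith, hm ⟨le_rfl, hcm.2.le⟩ ⟨htc, ht.2⟩ htc⟩
  have hneg : β < 0 := by
    by_contra! hβ0
    -- All directions lie within `π` below the largest angle `τ c`, so the displacement across it is
    -- nonpositive, which means `sin (τ c) ≥ 0`. As `τ c ≤ α + π < 2π`, this forces `τ c ≤ π`.
    have hle : τ c ≤ Real.pi := by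
      have e := hτ.integral_sin hf le_rfl hf.1.le le_rfl (τ c)
      have z : ∫ t in f.a..f.b, Real.sin (τ t - τ c) * ‖f.vel t‖ ≤ 0 := by
        rw [← neg_nonneg, ← intervalIntegral.integral_neg]
        refine intervalIntegral.integral_nonneg hf.1.le fun t ht => ?_
        have := hrange t ht
        have := Real.sin_nonpos_of_nonpos_of_neg_pi_le (show τ t - τ c ≤ 0 by linarith)
          (by linarith)
        nlinarith [norm_nonneg (f.vel t)]
      rw [e, h0, h1, im_exp_neg] at z
      simp at z
      by_contra! h2
      have := Real.sin_pos_of_mem_Ioo (show τ c - Real.pi ∈ Ioo 0 Real.pi from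
        ⟨by linarith, by linarith [hα.2]⟩)
      rw [Real.sin_sub_pi] at this
      linarith
    -- Now every direction lies in `[0, π]` and the initial one is strictly inside, so the curve
    -- ends above the real axis and not at `1`.
    have := hτ.integral_sin_pos hf (θ := 0) (fun t ht => by
      have := hrange t ht
      exact Real.sin_nonneg_of_nonneg_of_le_pi (by linarith) (by linarith))
      ⟨f.a, left_mem_Icc.2 hf.1.le, by
        rw [hτa, sub_zero]; exact Real.sin_pos_of_mem_Ioo hα⟩
    rw [h0, h1] at this
    simp at this
  refine ⟨hneg, ?_⟩
  by_cases hE : f.energy = ⊤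
  · simp [hE]
  have hi := hτ.intervalIntegrable_energyDensity hf hE
  have hsin : 0 < -Real.sin β := by
    have := Real.sin_neg_of_neg_of_neg_pi_lt hneg (by linarith [hα.1])
    linarith
  -- The slope chosen is `2 / λ(β)`, the optimal one for right c-curves. The boundary term contains
  -- `2 Y(τ c - β) - Y(α - β)` with `Y = sqrtSinPrim`, which exceeds the `Y(α - β)` of a right
  -- c-curve because `τ c > α`.
  obtain ⟨-, -, h3⟩ := hτ.integral_energyDensity_two hf ⟨hcm.1.le, hcm.2.le⟩ (θ := β)
    (fun t ht => by
      have := hrange t ht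
      exact Real.sin_nonneg_of_nonneg_of_le_pi (by linarith) (by linarith)) hi
    (sqrtSinPrim (α - β) / -Real.sin β)
  have e1 : 0 ≤ ∫ t in f.a..c, deviation f τ (sqrtSinPrim (α - β) / -Real.sin β) β t :=
    intervalIntegral.integral_nonneg hcm.1.le fun t _ => deviation_nonneg
  have e2 : 0 ≤ ∫ t in c..f.b, deviation f τ (-(sqrtSinPrim (α - β) / -Real.sin β)) β t :=
    intervalIntegral.integral_nonneg hcm.2.le fun t _ => deviation_nonneg
  have hY0 : 0 < sqrtSinPrim (α - β) := sqrtSinPrim_pos (by linarith [hα.1]) (by linarith)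
  have hY : sqrtSinPrim (α - β) < sqrtSinPrim (τ c - β) :=
    sqrtSinPrim_strictMonoOn ⟨by linarith, by linarith⟩ ⟨by linarith, by linarith⟩ (by linarith)
  have hm0 : 0 < sqrtSinPrim (α - β) / -Real.sin β := div_pos hY0 hsin
  rw [hτa, hτb, h0, h1, im_exp_neg, sub_self, sqrtSinPrim_zero] at h3
  rw [hτ.energy_eq_ofReal hf hi]
  have hG : G α β β = 1 / 4 * (2 * (sqrtSinPrim (α - β) / -Real.sin β) * sqrtSinPrim (α - β) -
      (sqrtSinPrim (α - β) / -Real.sin β) ^ 2 * -Real.sin β) := by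
    have hs := hsin.ne'
    rw [neg_ne_zero] at hs
    rw [G, y₁_eq, y₂_eq, sub_self, sqrtSinPrim_zero]
    field_simp
    ring
  simp only [zero_mul, Complex.zero_im, sub_zero] at h3
  have hlt : G α β β < 1 / 4 * ∫ t in f.a..f.b, energyDensity f τ t := by
    rw [h3, hG]
    nlinarith
  have hG0 : 0 ≤ G α β β := by unfold G; positivity
  exact (ENNReal.ofReal_lt_ofReal_iff (hG0.trans_lt hlt)).2 hlt

end PlanePath

open PlanePath

variable {f : PlanePath} {α β γ : ℝ}

/-- Elements of `Γ` differ by less than `2π`, so the direction `e^{iγ}` at the inflection point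
determines the angle `γ`. The final alternative records when the left part reduces to a point. -/
theorem exists_isRightLeft_of_mem_sClass (hα : α ∈ Ioo 0 Real.pi) (hβα : |β| ≤ α)
    (hβ : α - Real.pi < β) (hγ : γ ∈ GammaSet α β) (hf : f ∈ sClass α β γ) :
    ∃ τ c, IsRightLeft f τ c α β γ ∧ (γ < β ∨ γ = β ∧ c = f.b) := by
  unfold sClass at hf
  split_ifs at hf with hcase
  · obtain ⟨τ, hτ, -⟩ := hf.1.exists_isRightLeft hα hβα hβ hf.2
    obtain ⟨-, rfl⟩ := hcase
    exact ⟨τ, f.b, hτ, Or.inr ⟨rfl, rfl⟩⟩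
  · obtain ⟨⟨hs, hc⟩, hn, c, hsp, hd⟩ := hf
    obtain ⟨τ, γ', h, hlt, hmem⟩ := hsp.exists_isRightLeft hα hβα hβ hs.1 hc hn
    obtain ⟨a1, a2, a3⟩ := GammaSet_bounds hmem
    obtain ⟨b1, b2, b3⟩ := GammaSet_bounds hγ
    have : γ' = γ := by
      refine eq_of_exp_mul_I_eq ?_ (by linarith [hα.1, Real.pi_pos])
        (by linarith [hα.1, Real.pi_pos])
      rw [← hd, h.angle.dir_eq h.curve ⟨h.mem.1.le, h.mem.2⟩, h.angle_mid]
    subst this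
    exact ⟨τ, c, h, Or.inl hlt⟩

theorem ofReal_le_energy_of_mem_sCurves {Gmin : ℝ} (hα : α ∈ Ioo 0 Real.pi) (hβα : |β| ≤ α)
    (hβ : α - Real.pi < β) (hG : ∀ γ ∈ GammaSet α β, Gmin ≤ G α β γ)
    (hf : f ∈ sCurves (uVec α) (vVec β)) : ENNReal.ofReal Gmin ≤ f.energy := by
  obtain ⟨⟨hfc, hs⟩, hc⟩ := hf
  by_cases hn : f.IsCCurve
  · obtain hl | hr := hn
    · exact absurd hl (not_isLeftCCurve hα hβα hβ hc)
    · obtain ⟨τ, h, -⟩ := hr.exists_isRightLeft hα hβα hβ hc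
      exact (ENNReal.ofReal_le_ofReal (hG β (h.mem_GammaSet hα))).trans h.energy_ge
  · obtain hcc | ⟨c, hrl | hlr⟩ := hs
    · exact absurd hcc hn
    · obtain ⟨τ, γ, h, -, hmem⟩ := hrl.exists_isRightLeft hα hβα hβ hfc hc hn
      exact (ENNReal.ofReal_le_ofReal (hG γ hmem)).trans h.energy_ge
    · obtain ⟨hneg, hlt⟩ := hlr.lt_energy hα hβα hβ hfc hc hn
      refine (ENNReal.ofReal_le_ofReal (hG β ?_)).trans hlt.le
      rw [GammaSet, if_pos hneg]
      exact ⟨hβ.le, le_rfl⟩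

end ElasticSpline

/-! ### The rectangular elastica: direction angle and its inverse. -/

namespace ElasticSpline

variable {x y b t : ℝ}

theorem one_add_sin_sq_pos (x : ℝ) : 0 < 1 + Real.sin x ^ 2 := by positivity

/-- The velocity of the elastica `E`. -/
noncomputable def elasticaVel (x : ℝ) : ℂ :=
  (Real.cos x : ℂ) + Complex.I * (Real.sin x ^ 2 / Real.sqrt (1 + Real.sin x ^ 2) : ℝ)

/-- The direction angle of the elastica `E`. -/
noncomputable def elasticaAngle (x : ℝ) : ℝ :=
  Real.pi / 2 - 2 * Real.arcsin (Real.cos x / Real.sqrt 2)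

theorem continuous_xi_integrand :
    Continuous fun r => Real.sin r ^ 2 / Real.sqrt (1 + Real.sin r ^ 2) := by
  refine Continuous.div (by fun_prop) (by fun_prop) fun x => ?_
  exact (Real.sqrt_pos.2 (one_add_sin_sq_pos x)).ne'

theorem hasDerivAt_xi (x : ℝ) :
    HasDerivAt xi (Real.sin x ^ 2 / Real.sqrt (1 + Real.sin x ^ 2)) x :=
  (continuous_xi_integrand.integral_hasStrictDerivAt 0 x).hasDerivAt

theorem hasDerivAt_elastica (x : ℝ) : HasDerivAt elastica (elasticaVel x) x :=
  (Real.hasDerivAt_sin x).ofReal_comp.add ((hasDerivAt_xi x).ofReal_comp.const_mul Complex.I)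

@[simp] theorem xi_zero : xi 0 = 0 := by simp [xi]

theorem xi_neg (x : ℝ) : xi (-x) = -xi x := by
  have h := intervalIntegral.integral_comp_neg (a := 0) (b := x)
    (fun r => Real.sin r ^ 2 / Real.sqrt (1 + Real.sin r ^ 2))
  simp only [Real.sin_neg, neg_sq, neg_zero] at h
  rw [xi, intervalIntegral.integral_symm, ← h, xi]

@[simp] theorem elastica_zero : elastica 0 = 0 := by simp [elastica]

theorem elastica_neg (x : ℝ) : elastica (-x) = -elastica x := by
  simp only [elastica, xi_neg, Real.sin_neg]
  push_cast
  ring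

theorem continuous_elasticaVel : Continuous elasticaVel :=
  (Complex.continuous_ofReal.comp Real.continuous_cos).add
    (continuous_const.mul (Complex.continuous_ofReal.comp continuous_xi_integrand))

theorem cos_div_sqrt_two_mem (x : ℝ) :
    -(Real.sqrt 2 / 2) ≤ Real.cos x / Real.sqrt 2 ∧ Real.cos x / Real.sqrt 2 ≤ Real.sqrt 2 / 2 := by
  have h2 : 0 < Real.sqrt 2 := by positivity
  have hs := Real.mul_self_sqrt (show (0 : ℝ) ≤ 2 by norm_num)
  constructor
  · rw [le_div_iff₀ h2]; nlinarith [Real.neg_one_le_cos x]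
  · rw [div_le_iff₀ h2]; nlinarith [Real.cos_le_one x]

theorem sqrt_two_div_two_lt_one : Real.sqrt 2 / 2 < 1 := by
  have hs := Real.mul_self_sqrt (show (0 : ℝ) ≤ 2 by norm_num)
  nlinarith [Real.sqrt_nonneg 2]

theorem sin_arcsin_cos (x : ℝ) :
    Real.sin (Real.arcsin (Real.cos x / Real.sqrt 2)) = Real.cos x / Real.sqrt 2 := by
  obtain ⟨h1, h2⟩ := cos_div_sqrt_two_mem x
  have := sqrt_two_div_two_lt_one
  exact Real.sin_arcsin (by linarith) (by linarith)

theorem sqrt_one_sub_cos_sq (x : ℝ) :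
    Real.sqrt (1 - (Real.cos x / Real.sqrt 2) ^ 2) =
      Real.sqrt (1 + Real.sin x ^ 2) / Real.sqrt 2 := by
  rw [← Real.sqrt_div (one_add_sin_sq_pos x).le, div_pow, Real.sq_sqrt (by norm_num)]
  congr 1
  rw [Real.cos_sq']
  ring

/-- With `φ = arcsin (cos x / √2)` the angle is `π/2 - 2φ`, and its sine is `1 - 2 sin² φ = 1 - cos²
x`. -/
theorem sin_elasticaAngle (x : ℝ) : Real.sin (elasticaAngle x) = Real.sin x ^ 2 := by
  rw [elasticaAngle, Real.sin_pi_div_two_sub, Real.cos_two_mul, Real.cos_sq', sin_arcsin_cos,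
    div_pow, Real.sq_sqrt (by norm_num), Real.cos_sq']
  ring

theorem cos_elasticaAngle (x : ℝ) :
    Real.cos (elasticaAngle x) = Real.cos x * Real.sqrt (1 + Real.sin x ^ 2) := by
  have hs := Real.mul_self_sqrt (show (0 : ℝ) ≤ 2 by norm_num)
  have h2 : Real.sqrt 2 ≠ 0 := by positivity
  rw [elasticaAngle, Real.cos_pi_div_two_sub, Real.sin_two_mul, sin_arcsin_cos,
    Real.cos_arcsin, sqrt_one_sub_cos_sq]
  field_simp
  rw [pow_two, hs, mul_comm]

theorem elasticaVel_eq (x : ℝ) : elasticaVel x =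
    ((Real.sqrt (1 + Real.sin x ^ 2))⁻¹ : ℝ) * Complex.exp (elasticaAngle x * Complex.I) := by
  have h := (Real.sqrt_pos.2 (one_add_sin_sq_pos x)).ne'
  have hC : ((Real.sqrt (1 + Real.sin x ^ 2) : ℝ) : ℂ) ≠ 0 := by exact_mod_cast h
  rw [Complex.exp_mul_I, ← Complex.ofReal_cos, ← Complex.ofReal_sin, sin_elasticaAngle,
    cos_elasticaAngle, elasticaVel]
  rw [Complex.ofReal_mul, Complex.ofReal_div, Complex.ofReal_inv]
  field_simp

/-- Divided by the speed `1 / √(1 + sin² x)` this is the curvature `2 sin x`, that is, `±2 √sin` of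
the angle: the equality case of the calibration with `λ = 1`. It is negative on `(-π, 0)` and
positive on `(0, π)`. -/
theorem hasDerivAt_elasticaAngle (x : ℝ) :
    HasDerivAt elasticaAngle (2 * Real.sin x / Real.sqrt (1 + Real.sin x ^ 2)) x := by
  obtain ⟨h1, h2⟩ := cos_div_sqrt_two_mem x
  have := sqrt_two_div_two_lt_one
  have h3 := (Real.hasDerivAt_arcsin (x := Real.cos x / Real.sqrt 2)
    (by linarith) (by linarith)).comp x ((Real.hasDerivAt_cos x).div_const (Real.sqrt 2))
  refine ((h3.const_mul 2).const_sub (Real.pi / 2)).congr_deriv ?_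
  rw [sqrt_one_sub_cos_sq]
  have h2 : Real.sqrt 2 ≠ 0 := by positivity
  have h := (Real.sqrt_pos.2 (one_add_sin_sq_pos x)).ne'
  field_simp

theorem elasticaAngle_neg (x : ℝ) : elasticaAngle (-x) = elasticaAngle x := by
  simp [elasticaAngle]

theorem arcsin_sqrt_two_div_two : Real.arcsin (Real.sqrt 2 / 2) = Real.pi / 4 := by
  rw [← Real.sin_pi_div_four, Real.arcsin_sin] <;> linarith [Real.pi_pos]

@[simp] theorem elasticaAngle_zero : elasticaAngle 0 = 0 := by
  have : 1 / Real.sqrt 2 = Real.sqrt 2 / 2 := by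
    rw [div_eq_div_iff (by positivity) (by norm_num), Real.mul_self_sqrt (by norm_num)]; norm_num
  rw [elasticaAngle, Real.cos_zero, this, arcsin_sqrt_two_div_two]
  ring

@[simp] theorem elasticaAngle_pi : elasticaAngle Real.pi = Real.pi := by
  have : -1 / Real.sqrt 2 = -(Real.sqrt 2 / 2) := by
    rw [← neg_div, div_eq_div_iff (by positivity) (by norm_num), neg_mul,
      neg_mul, Real.mul_self_sqrt (by norm_num)]
    norm_num
  rw [elasticaAngle, Real.cos_pi, this, Real.arcsin_neg, arcsin_sqrt_two_div_two]
  ring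

theorem elasticaAngle_strictMonoOn : StrictMonoOn elasticaAngle (Icc 0 Real.pi) := by
  refine strictMonoOn_of_deriv_pos (convex_Icc _ _)
    (fun x _ => (hasDerivAt_elasticaAngle x).continuousAt.continuousWithinAt) fun x hx => ?_
  rw [interior_Icc] at hx
  rw [(hasDerivAt_elasticaAngle x).deriv]
  have := Real.sin_pos_of_mem_Ioo hx
  positivity

theorem contDiff_elasticaAngle : ContDiff ℝ 1 elasticaAngle := by
  rw [contDiff_one_iff_deriv]
  refine ⟨fun x => (hasDerivAt_elasticaAngle x).differentiableAt, ?_⟩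
  rw [funext fun x => (hasDerivAt_elasticaAngle x).deriv]
  refine Continuous.div (by fun_prop) (by fun_prop) fun x => ?_
  exact (Real.sqrt_pos.2 (one_add_sin_sq_pos x)).ne'

/-- The parameter in `[0, π]` at which the elastica has the direction angle `y`. -/
noncomputable def elasticaParam (y : ℝ) : ℝ := Real.arccos (Real.cos (y / 2) - Real.sin (y / 2))

theorem elasticaParam_mem (y : ℝ) : elasticaParam y ∈ Icc 0 Real.pi :=
  ⟨Real.arccos_nonneg _, Real.arccos_le_pi _⟩

theorem continuous_elasticaParam : Continuous elasticaParam :=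
  Real.continuous_arccos.comp (by fun_prop)

theorem cos_sub_sin_sq (y : ℝ) : (Real.cos (y / 2) - Real.sin (y / 2)) ^ 2 = 1 - Real.sin y := by
  have h1 := Real.sin_two_mul (y / 2)
  have h2 := Real.sin_sq_add_cos_sq (y / 2)
  rw [mul_div_cancel₀ y two_ne_zero] at h1
  nlinarith

theorem cos_elasticaParam (hy : y ∈ Icc 0 Real.pi) :
    Real.cos (elasticaParam y) = Real.cos (y / 2) - Real.sin (y / 2) := by
  have h := cos_sub_sin_sq y
  have := Real.sin_nonneg_of_mem_Icc hy
  exact Real.cos_arccos (by nlinarith) (by nlinarith)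

theorem sin_elasticaParam_sq (hy : y ∈ Icc 0 Real.pi) :
    Real.sin (elasticaParam y) ^ 2 = Real.sin y := by
  rw [Real.sin_sq, cos_elasticaParam hy, cos_sub_sin_sq]
  ring

theorem sin_elasticaParam (hy : y ∈ Icc 0 Real.pi) :
    Real.sin (elasticaParam y) = Real.sqrt (Real.sin y) := by
  rw [← sin_elasticaParam_sq hy, Real.sqrt_sq
    (Real.sin_nonneg_of_mem_Icc (elasticaParam_mem y))]

theorem elasticaAngle_elasticaParam (hy : y ∈ Icc 0 Real.pi) :
    elasticaAngle (elasticaParam y) = y := by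
  have h2 : Real.sqrt 2 ≠ 0 := by positivity
  have hs := Real.mul_self_sqrt (show (0 : ℝ) ≤ 2 by norm_num)
  have : (Real.cos (y / 2) - Real.sin (y / 2)) / Real.sqrt 2 = Real.sin (Real.pi / 4 - y / 2) := by
    rw [Real.sin_sub, Real.sin_pi_div_four, Real.cos_pi_div_four]
    field_simp
    rw [pow_two, hs, mul_comm]
  rw [elasticaAngle, cos_elasticaParam hy, this, Real.arcsin_sin (by linarith [hy.1, hy.2])
    (by linarith [hy.1, hy.2, Real.pi_pos])]
  ring

@[simp] theorem elasticaParam_zero : elasticaParam 0 = 0 := by simp [elasticaParam]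

@[simp] theorem elasticaParam_pi : elasticaParam Real.pi = Real.pi := by simp [elasticaParam]

theorem elasticaParam_strictMonoOn : StrictMonoOn elasticaParam (Icc 0 Real.pi) := by
  intro x hx y hy hxy
  by_contra! h
  have := elasticaAngle_strictMonoOn.monotoneOn (elasticaParam_mem y) (elasticaParam_mem x) h
  rw [elasticaAngle_elasticaParam hx, elasticaAngle_elasticaParam hy] at this
  linarith

theorem elasticaParam_lt_pi (hy : 0 ≤ y) (hy' : y < Real.pi) : elasticaParam y < Real.pi := by
  simpa using elasticaParam_strictMonoOn ⟨hy, hy'.le⟩ ⟨Real.pi_pos.le, le_rfl⟩ hy'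

theorem elasticaParam_pos (hy : 0 < y) (hy' : y ≤ Real.pi) : 0 < elasticaParam y := by
  simpa using elasticaParam_strictMonoOn ⟨le_rfl, Real.pi_pos.le⟩ ⟨hy.le, hy'⟩ hy

/-- The derivative is infinite at both ends, where `√sin` vanishes. This cancels the factor `√sin`
in the curvature equation: in the variable `elasticaParam (τ - γ)` an extremal moves at a rate that
does not degenerate, as long as it moves. -/
theorem hasDerivAt_elasticaParam (hy : y ∈ Ioo 0 Real.pi) :
    HasDerivAt elasticaParam
      (Real.sqrt (1 + Real.sin y) / (2 * Real.sqrt (Real.sin y))) y := by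
  have hs := Real.sin_pos_of_mem_Ioo hy
  have hsq := cos_sub_sin_sq y
  have d1 : HasDerivAt (fun y => Real.cos (y / 2) - Real.sin (y / 2))
      (-Real.sin (y / 2) * (1 / 2) - Real.cos (y / 2) * (1 / 2)) y :=
    (((hasDerivAt_id y).div_const 2).cos).sub (((hasDerivAt_id y).div_const 2).sin)
  have d2 := (Real.hasDerivAt_arccos (x := Real.cos (y / 2) - Real.sin (y / 2))
    (by nlinarith) (by nlinarith)).comp y d1
  refine d2.congr_deriv ?_
  have h1 : Real.sqrt (1 + Real.sin y) = Real.cos (y / 2) + Real.sin (y / 2) := by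
    have e1 := Real.sin_two_mul (y / 2)
    have e2 := Real.sin_sq_add_cos_sq (y / 2)
    rw [mul_div_cancel₀ y two_ne_zero] at e1
    rw [show 1 + Real.sin y = (Real.cos (y / 2) + Real.sin (y / 2)) ^ 2 by nlinarith]
    refine Real.sqrt_sq (add_nonneg ?_ ?_)
    · exact Real.cos_nonneg_of_mem_Icc ⟨by linarith [hy.1, Real.pi_pos], by linarith [hy.2]⟩
    · exact Real.sin_nonneg_of_nonneg_of_le_pi (by linarith [hy.1]) (by linarith [hy.1, hy.2])
  rw [hsq, h1, sub_sub_cancel]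
  have := (Real.sqrt_pos.2 hs).ne'
  field_simp
  ring

/-- `dξ = ½ √sin ϑ dϑ` for the direction angle `ϑ` of the elastica. Hence heights of elastica arcs
are the quantities `y₁`, `y₂`. -/
theorem xi_eq (hx : x ∈ Icc 0 Real.pi) : xi x = 1 / 2 * sqrtSinPrim (elasticaAngle x) := by
  have h : ∀ t ∈ uIcc 0 x, HasDerivAt (fun t => 1 / 2 * sqrtSinPrim (elasticaAngle t))
      (Real.sin t ^ 2 / Real.sqrt (1 + Real.sin t ^ 2)) t := by
    intro t ht
    rw [uIcc_of_le hx.1] at ht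
    refine (((hasDerivAt_sqrtSinPrim _).comp t (hasDerivAt_elasticaAngle t)).const_mul
      (1 / 2 : ℝ)).congr_deriv ?_
    rw [sin_elasticaAngle, Real.sqrt_sq
      (Real.sin_nonneg_of_mem_Icc ⟨ht.1, ht.2.trans hx.2⟩)]
    ring
  have := intervalIntegral.integral_eq_sub_of_hasDerivAt h
    (continuous_xi_integrand.intervalIntegrable _ _)
  simpa [xi] using this

theorem xi_elasticaParam (hy : y ∈ Icc 0 Real.pi) :
    xi (elasticaParam y) = 1 / 2 * sqrtSinPrim y := by
  rw [xi_eq (elasticaParam_mem y), elasticaAngle_elasticaParam hy]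

/-- `E(t - π)` and the complex conjugate of `E(t)` differ by a rotation and a translation. -/
theorem elastica_sub_pi (x : ℝ) : elastica (x - Real.pi) =
    -(starRingEnd ℂ) (elastica x) - Complex.I * (xi Real.pi : ℂ) := by
  have h : xi (x - Real.pi) = xi x - xi Real.pi := by
    have e1 : xi (x - Real.pi) = ∫ r in Real.pi..x,
        Real.sin r ^ 2 / Real.sqrt (1 + Real.sin r ^ 2) := by
      rw [xi]
      have := intervalIntegral.integral_comp_sub_right (a := Real.pi) (b := x)
        (fun r => Real.sin r ^ 2 / Real.sqrt (1 + Real.sin r ^ 2)) Real.pi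
      rw [sub_self] at this
      rw [← this]
      simp [Real.sin_sub_pi]
    rw [e1, xi, xi, intervalIntegral.integral_interval_sub_left
      (continuous_xi_integrand.intervalIntegrable _ _)
      (continuous_xi_integrand.intervalIntegrable _ _)]
  simp only [elastica, h, Real.sin_sub_pi, map_add, map_mul, Complex.conj_ofReal, Complex.conj_I]
  push_cast
  ring

end ElasticSpline

/-! ### Equivalence of curves, reparametrisation, segments and similarities. -/

namespace ElasticSpline.PlanePath

variable {f g : PlanePath} {s t : ℝ}

/-- Derivatives are compared in the open interval only: the difference is constant there, and also
on the closed interval by continuity. -/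
theorem eqOn_of_hasDerivAt_eq {E : Type*} [NormedAddCommGroup E] [NormedSpace ℝ E]
    {F H F' : ℝ → E} {p q r : ℝ} (hF : ContinuousOn F (Icc p q)) (hH : ContinuousOn H (Icc p q))
    (hF' : ∀ t ∈ Ioo p q, HasDerivAt F (F' t) t) (hH' : ∀ t ∈ Ioo p q, HasDerivAt H (F' t) t)
    (hr : r ∈ Icc p q) (h : F r = H r) : EqOn F H (Icc p q) := by
  rcases (hr.1.trans hr.2).eq_or_lt with rfl | hpq
  · intro t ht
    rw [Icc_self, mem_singleton_iff] at ht hr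
    rw [ht, ← hr, h]
  have hm : (p + q) / 2 ∈ Ioo p q := ⟨by linarith, by linarith⟩
  have hd : ∀ t ∈ Ioo p q, HasDerivAt (fun x => F x - H x) 0 t := fun t ht => by
    have := (hF' t ht).sub (hH' t ht)
    rw [sub_self] at this
    exact this
  have h1 : EqOn (fun x => F x - H x) (fun _ => F ((p + q) / 2) - H ((p + q) / 2)) (Ioo p q) :=
    fun t ht => isOpen_Ioo.is_const_of_deriv_eq_zero isPreconnected_Ioo
      (fun x hx => (hd x hx).differentiableAt.differentiableWithinAt)
      (fun x hx => (hd x hx).deriv) ht hm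
  have h2 := h1.of_subset_closure (hF.sub hH) continuousOn_const Ioo_subset_Icc_self
    (by rw [closure_Ioo hpq.ne])
  intro t ht
  have e1 := h2 ht
  have e2 := h2 hr
  simp only [h, sub_self] at e1 e2
  rw [← e2] at e1
  exact sub_eq_zero.1 e1

theorem Equiv.symm (h : f.Equiv g) : g.Equiv f :=
  ⟨h.1.symm, fun s hs t ht e => (h.2 t ht s hs e.symm).symm⟩

theorem IsCurve.continuousOn_arcLength (hf : f.IsCurve) :
    ContinuousOn f.arcLength (Icc f.a f.b) := by
  have := intervalIntegral.continuousOn_primitive_interval (μ := volume) (f := fun r => ‖f.vel r‖)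
    (a := f.a) (b := f.b) (by
      rw [uIcc_of_le hf.1.le]
      exact hf.continuousOn_vel.norm.integrableOn_Icc)
  rwa [uIcc_of_le hf.1.le] at this

theorem hasDerivAt_integral_of_continuousOn {F : ℝ → ℝ} {p q : ℝ}
    (hF : ContinuousOn F (Icc p q)) (ht : t ∈ Ioo p q) :
    HasDerivAt (fun x => ∫ r in p..x, F r) (F t) t := by
  refine intervalIntegral.integral_hasDerivAt_right ?_ ?_ (hF.continuousAt (Icc_mem_nhds ht.1 ht.2))
  · refine ContinuousOn.intervalIntegrable ?_
    rw [uIcc_of_le ht.1.le]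
    exact hF.mono (Icc_subset_Icc_right ht.2.le)
  · exact (hF.mono Ioo_subset_Icc_self).stronglyMeasurableAtFilter isOpen_Ioo t ht

theorem IsCurve.hasDerivAt_arcLength (hf : f.IsCurve) (ht : t ∈ Ioo f.a f.b) :
    HasDerivAt f.arcLength ‖f.vel t‖ t :=
  hasDerivAt_integral_of_continuousOn hf.continuousOn_vel.norm ht

@[simp] theorem arcLength_start : f.arcLength f.a = 0 := by simp [arcLength]

theorem IsCurve.strictMonoOn_arcLength (hf : f.IsCurve) :
    StrictMonoOn f.arcLength (Icc f.a f.b) := by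
  refine strictMonoOn_of_deriv_pos (convex_Icc _ _) hf.continuousOn_arcLength fun t ht => ?_
  rw [interior_Icc] at ht
  rw [(hf.hasDerivAt_arcLength ht).deriv]
  exact hf.norm_vel_pos (Ioo_subset_Icc_self ht)

/-- Reparametrised curves are equivalent. -/
theorem Equiv.of_reparam (hf : f.IsCurve) (hg : g.IsCurve) {ψ ψ' : ℝ → ℝ}
    (hψ : ContinuousOn ψ (Icc f.a f.b)) (hψ' : ∀ t ∈ Ioo f.a f.b, HasDerivAt ψ (ψ' t) t)
    (hpos : ∀ t ∈ Ioo f.a f.b, 0 < ψ' t) (ha : ψ f.a = g.a) (hb : ψ f.b = g.b)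
    (hfg : ∀ t ∈ Icc f.a f.b, f.toFun t = g.toFun (ψ t)) : f.Equiv g := by
  have hmono : StrictMonoOn ψ (Icc f.a f.b) := by
    refine strictMonoOn_of_deriv_pos (convex_Icc _ _) hψ fun t ht => ?_
    rw [interior_Icc] at ht
    rw [(hψ' t ht).deriv]
    exact hpos t ht
  have hfa := left_mem_Icc.2 hf.1.le
  have hfb := right_mem_Icc.2 hf.1.le
  have hIoo : ∀ t ∈ Ioo f.a f.b, ψ t ∈ Ioo g.a g.b := fun t ht => by
    rw [← ha, ← hb]
    exact ⟨hmono hfa (Ioo_subset_Icc_self ht) ht.1, hmono (Ioo_subset_Icc_self ht) hfb ht.2⟩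
  have hIcc : MapsTo ψ (Icc f.a f.b) (Icc g.a g.b) := fun t ht => by
    rw [← ha, ← hb]
    exact ⟨hmono.monotoneOn hfa ht ht.1, hmono.monotoneOn ht hfb ht.2⟩
  have key : EqOn f.arcLength (fun t => g.arcLength (ψ t)) (Icc f.a f.b) := by
    refine eqOn_of_hasDerivAt_eq hf.continuousOn_arcLength
      (hg.continuousOn_arcLength.comp hψ hIcc) (fun t ht => hf.hasDerivAt_arcLength ht)
      (fun t ht => ?_) hfa (by simp [ha])
    refine ((hg.hasDerivAt_arcLength (hIoo t ht)).comp t (hψ' t ht)).congr_deriv ?_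
    have h1 : HasDerivAt f.toFun (ψ' t • g.vel (ψ t)) t := by
      refine ((hg.hasDerivAt (hIoo t ht)).scomp t (hψ' t ht)).congr_of_eventuallyEq ?_
      filter_upwards [Icc_mem_nhds ht.1 ht.2] with x hx using hfg x hx
    rw [(hf.hasDerivAt ht).unique h1, norm_smul, Real.norm_of_nonneg (hpos t ht).le, mul_comm]
  refine ⟨?_, fun s hs t ht e => ?_⟩
  · rw [len, len, key hfb, ← hb]
  · rw [key hs] at e
    rw [hfg s hs, hg.strictMonoOn_arcLength.injOn (hIcc hs) ht e]

theorem Equiv.of_eqOn (hf : f.IsCurve) (hg : g.IsCurve) (ha : f.a = g.a) (hb : f.b = g.b)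
    (h : EqOn f.toFun g.toFun (Icc f.a f.b)) : f.Equiv g :=
  Equiv.of_reparam hf hg (ψ := id) (ψ' := fun _ => 1) continuousOn_id
    (fun t _ => hasDerivAt_id t) (fun _ _ => one_pos) ha hb h

/-- Equivalence by a translation of the parameter. -/
theorem Equiv.of_shift (hf : f.IsCurve) (hg : g.IsCurve) {r : ℝ} (ha : f.a + r = g.a)
    (hb : f.b + r = g.b) (h : ∀ t ∈ Icc f.a f.b, f.toFun t = g.toFun (t + r)) : f.Equiv g :=
  Equiv.of_reparam hf hg (ψ := fun t => t + r) (ψ' := fun _ => 1) (by fun_prop)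
    (fun t _ => (hasDerivAt_id t).add_const r) (fun _ _ => one_pos) ha hb h

theorem Equiv.of_point (hf : f.a = f.b) (hg : g.a = g.b) (h : f.toFun f.a = g.toFun g.a) :
    f.Equiv g := by
  refine ⟨by simp [len, arcLength, hf, hg], fun s hs t ht _ => ?_⟩
  rw [← hf, Icc_self, mem_singleton_iff] at hs
  rw [← hg, Icc_self, mem_singleton_iff] at ht
  rw [hs, ht, h]

theorem arcLength_of_affine (hab : f.a ≤ f.b) {z v : ℂ}
    (h : ∀ t ∈ Icc f.a f.b, f.toFun t = z + ((t - f.a : ℝ) : ℂ) * v) (ht : t ∈ Icc f.a f.b) :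
    f.arcLength t = (t - f.a) * ‖v‖ := by
  rcases hab.eq_or_lt with he | hlt
  · rw [← he, Icc_self, mem_singleton_iff] at ht
    simp [arcLength, ht]
  have hv : ∀ x ∈ Icc f.a f.b, f.vel x = v := fun x hx => by
    refine vel_eq_of_hasDerivWithinAt hlt hx ?_
    have h1 : HasDerivAt (fun t : ℝ => z + ((t - f.a : ℝ) : ℂ) * v) v x := by
      have := ((((hasDerivAt_id x).sub_const f.a).ofReal_comp).mul_const v).const_add z
      simpa using this
    exact h1.hasDerivWithinAt.congr h (h x hx)
  rw [arcLength, intervalIntegral.integral_congr (g := fun _ => ‖v‖)]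
  · simp
  · intro x hx
    rw [uIcc_of_le ht.1] at hx
    simp only [hv x ⟨hx.1, hx.2.trans ht.2⟩]

/-- Compares arclengths directly, because segments of length `0` must be allowed and these are not
curves, so reparametrisation does not apply to them. -/
theorem Equiv.lineSeg_of_affine (hab : f.a ≤ f.b) {z v : ℂ}
    (h : ∀ t ∈ Icc f.a f.b, f.toFun t = z + ((t - f.a : ℝ) : ℂ) * v) {A B : ℂ}
    (hA : A = z) (hB : B = z + ((f.b - f.a : ℝ) : ℂ) * v) : f.Equiv (lineSeg A B) := by
  subst hA
  have h1 := fun t ht => arcLength_of_affine (t := t) hab h ht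
  have h2 := fun t ht => arcLength_of_affine (f := lineSeg A B) (t := t)
    (z := A) (v := B - A) zero_le_one (fun t _ => by simp [lineSeg]) ht
  have hn : ‖B - A‖ = (f.b - f.a) * ‖v‖ := by
    rw [hB, add_sub_cancel_left, norm_mul, Complex.norm_real,
      Real.norm_of_nonneg (sub_nonneg.2 hab)]
  have e0 : (lineSeg A B).a = 0 := rfl
  have e1 : (lineSeg A B).b = 1 := rfl
  rw [e0, e1, hn] at h2
  refine ⟨?_, fun s hs t ht e => ?_⟩
  · rw [len, len, h1 _ (right_mem_Icc.2 hab), e1, h2 1 (right_mem_Icc.2 zero_le_one)]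
    ring
  · rw [h1 s hs, h2 t ht] at e
    rw [h s hs]
    simp only [lineSeg]
    rw [hB, add_sub_cancel_left]
    by_cases hv : v = 0
    · simp [hv]
    · have : s - f.a = t * (f.b - f.a) := by
        have := norm_ne_zero_iff.2 hv
        apply mul_right_cancel₀ this
        rw [e]; ring
      rw [this]
      push_cast
      ring

theorem IsCurve.of_hasDerivAt {w : ℝ → ℂ} (hab : f.a < f.b)
    (hd : ∀ t ∈ Icc f.a f.b, HasDerivAt f.toFun (w t) t)
    (hw : AbsolutelyContinuousOnInterval w f.a f.b) (h0 : ∀ t ∈ Icc f.a f.b, w t ≠ 0) :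
    f.IsCurve := by
  have hv : ∀ t ∈ Icc f.a f.b, f.vel t = w t := fun t ht => vel_eq_of_hasDerivAt hab ht (hd t ht)
  refine ⟨hab, fun t ht => (hd t ht).differentiableAt.differentiableWithinAt, ?_, fun t ht => ?_⟩
  · refine hw.congr_on fun t ht => ?_
    rw [uIcc_of_le hab.le] at ht
    exact (hv t ht).symm
  · rw [hv t ht]; exact h0 t ht

theorem IsCurve.map (hf : f.IsCurve) {T : ℂ → ℂ} (L : ℂ ≃L[ℝ] ℂ) (c : ℂ)
    (hT : ∀ z, T z = L z + c) : (f.map T).IsCurve := by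
  have hd : ∀ t ∈ Icc f.a f.b,
      HasDerivWithinAt (f.map T).toFun (L (f.vel t)) (Icc f.a f.b) t := fun t ht => by
    have h1 := (L.hasFDerivAt.comp_hasDerivWithinAt t (hf.hasDerivWithinAt ht)).add_const c
    exact h1.congr (fun x _ => hT _) (hT _)
  have hv : ∀ t ∈ Icc f.a f.b, (f.map T).vel t = L (f.vel t) := fun t ht =>
    vel_eq_of_hasDerivWithinAt (f := f.map T) hf.1 ht (hd t ht)
  refine ⟨hf.1, fun t ht => (hd t ht).differentiableWithinAt, ?_, fun t ht => ?_⟩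
  · refine (hf.2.2.1.contDiff_comp (g := L) L.contDiff).congr_on fun t ht => ?_
    rw [uIcc_of_le hf.1.le] at ht
    exact (hv t ht).symm
  · rw [hv t ht]
    simpa using hf.2.2.2 t ht

/-- Multiplication by a nonzero complex number as a real linear equivalence. -/
noncomputable def mulEquiv (c : ℂ) (hc : c ≠ 0) : ℂ ≃L[ℝ] ℂ :=
  (ContinuousLinearEquiv.unitsEquivAut ℂ (Units.mk0 c hc)).restrictScalars ℝ

theorem IsCurve.map_mul_add (hf : f.IsCurve) {c₁ : ℂ} (hc : c₁ ≠ 0) (c₂ : ℂ) :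
    (f.map fun z => c₁ * z + c₂).IsCurve :=
  hf.map (mulEquiv c₁ hc) c₂ fun z => by simp [mulEquiv, mul_comm]

theorem IsCurve.map_conj_mul_add (hf : f.IsCurve) {c₁ : ℂ} (hc : c₁ ≠ 0) (c₂ : ℂ) :
    (f.map fun z => c₁ * (starRingEnd ℂ) z + c₂).IsCurve :=
  hf.map (Complex.conjCLE.trans (mulEquiv c₁ hc)) c₂ fun z => by simp [mulEquiv, mul_comm]

theorem IsCurve.map_add (hf : f.IsCurve) (c : ℂ) : (f.map fun z => z + c).IsCurve :=
  hf.map (ContinuousLinearEquiv.refl ℝ ℂ) c fun z => by simp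

end ElasticSpline.PlanePath

/-! ### The elastica with straight segments inserted. -/

namespace ElasticSpline

variable {x y b t : ℝ}

/-- The parameter of an elastica which rests at `-π` up to the time `-π`, at `0` during `[0, b]`,
and at `π` from the time `b + π` on. -/
noncomputable def pause (b x : ℝ) : ℝ :=
  max (-Real.pi) (min x 0) + min Real.pi (max (x - b) 0)

theorem pause_of_nonpos (hb : 0 ≤ b) (hx : x ≤ 0) : pause b x = max (-Real.pi) x := by
  rw [pause, min_eq_left hx, max_eq_right (show x - b ≤ 0 by linarith), min_eq_right Real.pi_pos.le, add_zero]

theorem pause_of_nonneg (hx : 0 ≤ x) : pause b x = min Real.pi (max (x - b) 0) := by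
  rw [pause, min_eq_right hx, max_eq_right (by linarith [Real.pi_pos]), zero_add]

theorem pause_of_mem_left (hb : 0 ≤ b) (hx : x ∈ Icc (-Real.pi) 0) : pause b x = x := by
  rw [pause_of_nonpos hb hx.2, max_eq_right hx.1]

theorem pause_of_mem_mid (hx : x ∈ Icc 0 b) : pause b x = 0 := by
  rw [pause_of_nonneg hx.1, max_eq_right (by linarith [hx.2]), min_eq_right Real.pi_pos.le]

theorem pause_of_mem_right (hb : 0 ≤ b) (hx : x ∈ Icc b (b + Real.pi)) : pause b x = x - b := by
  rw [pause_of_nonneg (hb.trans hx.1), max_eq_left (by linarith [hx.1]),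
    min_eq_right (by linarith [hx.2])]

theorem pause_of_le (hb : 0 ≤ b) (hx : x ≤ -Real.pi) : pause b x = -Real.pi := by
  rw [pause_of_nonpos hb (by linarith [Real.pi_pos]), max_eq_left hx]

theorem pause_of_ge (hb : 0 ≤ b) (hx : b + Real.pi ≤ x) : pause b x = Real.pi := by
  rw [pause_of_nonneg (by linarith [Real.pi_pos]), max_eq_left (by linarith [Real.pi_pos]),
    min_eq_left (by linarith)]

theorem pause_mem_of_nonpos (hb : 0 ≤ b) (hx : x ≤ 0) : pause b x ∈ Icc (-Real.pi) 0 := by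
  rw [pause_of_nonpos hb hx]
  exact ⟨le_max_left _ _, max_le (by linarith [Real.pi_pos]) hx⟩

theorem pause_mem_of_nonneg (hx : 0 ≤ x) : pause b x ∈ Icc 0 Real.pi := by
  rw [pause_of_nonneg hx]
  exact ⟨le_min Real.pi_pos.le (le_max_right _ _), min_le_left _ _⟩

theorem continuous_pause (b : ℝ) : Continuous (pause b) := by
  unfold pause
  fun_prop

theorem lipschitzWith_pause (b : ℝ) : LipschitzWith 2 (pause b) := by
  have h1 : LipschitzWith 1 fun x : ℝ => max (-Real.pi) (min x 0) :=
    (LipschitzWith.id.min_const 0).const_max _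
  have h2 : LipschitzWith 1 fun x : ℝ => min Real.pi (max (x - b) 0) := by
    have : LipschitzWith 1 fun x : ℝ => x - b :=
      LipschitzWith.of_dist_le_mul fun x y => by simp
    exact (this.max_const 0).const_min _
  have := h1.add h2
  rwa [one_add_one_eq_two] at this

theorem pause_monotone (b : ℝ) : Monotone (pause b) := fun x y h => by
  unfold pause
  gcongr

/-- Where the motion rests, the direction angle is stationary. -/
theorem hasDerivAt_elasticaAngle_pause (hb : 0 ≤ b) (x : ℝ) :
    HasDerivAt (fun x => elasticaAngle (pause b x))
      (2 * Real.sin (pause b x) / Real.sqrt (1 + Real.sin (pause b x) ^ 2)) x := by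
  -- `pause` has kinks, but only where its value is a multiple of `π`. There `elasticaAngle` has
  -- derivative zero, and a Lipschitz inner function keeps the increment `o(y - x)`.
  by_cases hs : Real.sin (pause b x) = 0
  · have h0 := hasDerivAt_elasticaAngle (pause b x)
    rw [hs] at h0 ⊢
    simp only [mul_zero, zero_div] at h0 ⊢
    rw [hasDerivAt_iff_isLittleO] at h0 ⊢
    simp only [smul_zero, sub_zero] at h0 ⊢
    refine (h0.comp_tendsto (continuous_pause b).continuousAt).trans_isBigO ?_
    refine Asymptotics.IsBigO.of_bound 2 (Filter.Eventually.of_forall fun y => ?_)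
    simpa [dist_eq_norm] using (lipschitzWith_pause b).dist_le_mul y x
  -- Where the sine is nonzero the motion is not at rest, so `pause` is locally a translation and
  -- the chain rule applies.
  · have hmove : ∃ r, pause b =ᶠ[nhds x] fun y => y - r := by
      rcases lt_or_ge x 0 with hx | hx
      · refine ⟨0, ?_⟩
        have hx' : -Real.pi < x := by
          by_contra! h
          exact hs (by rw [pause_of_le hb h]; simp)
        filter_upwards [Icc_mem_nhds hx' hx] with y hy
        rw [pause_of_mem_left hb hy, sub_zero]
      · refine ⟨b, ?_⟩
        have h1 : b < x := by
          by_contra! h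
          exact hs (by rw [pause_of_mem_mid ⟨hx, h⟩]; simp)
        have h2 : x < b + Real.pi := by
          by_contra! h
          exact hs (by rw [pause_of_ge hb h]; simp)
        filter_upwards [Icc_mem_nhds h1 h2] with y hy
        rw [pause_of_mem_right hb hy]
    obtain ⟨r, hr⟩ := hmove
    have hp : HasDerivAt (pause b) 1 x := ((hasDerivAt_id x).sub_const r).congr_of_eventuallyEq hr
    exact ((hasDerivAt_elasticaAngle (pause b x)).comp x hp).congr_deriv (mul_one _)

theorem abs_sin_eq (x : ℝ) : |Real.sin x| = Real.sqrt (Real.sin (elasticaAngle x)) := by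
  rw [sin_elasticaAngle, Real.sqrt_sq_eq_abs]

theorem elasticaVel_ne_zero (x : ℝ) : elasticaVel x ≠ 0 := by
  rw [elasticaVel_eq]
  refine mul_ne_zero ?_ (Complex.exp_ne_zero _)
  exact_mod_cast (inv_pos.2 (Real.sqrt_pos.2 (one_add_sin_sq_pos x))).ne'

theorem contDiff_elasticaVel : ContDiff ℝ 1 elasticaVel := by
  have h1 : ContDiff ℝ 1 fun x => Real.sin x ^ 2 / Real.sqrt (1 + Real.sin x ^ 2) := by
    refine ContDiff.div (by fun_prop) ?_ fun x => (Real.sqrt_pos.2 (one_add_sin_sq_pos x)).ne'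
    exact ContDiff.sqrt (by fun_prop) fun x => (one_add_sin_sq_pos x).ne'
  exact (Complex.ofRealCLM.contDiff.comp Real.contDiff_cos).add
    (contDiff_const.mul (Complex.ofRealCLM.contDiff.comp h1))

theorem absolutelyContinuous_pause (b p q : ℝ) :
    AbsolutelyContinuousOnInterval (pause b) p q :=
  (lipschitzWith_pause b).lipschitzOnWith.absolutelyContinuousOnInterval

/-- The elastica `E`, prolonged by straight segments at the parameters `-π`, `0` and `π`. -/
noncomputable def pausedElastica (b x : ℝ) : ℂ := ∫ r in (0 : ℝ)..x, elasticaVel (pause b r)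

theorem hasDerivAt_pausedElastica (b x : ℝ) :
    HasDerivAt (pausedElastica b) (elasticaVel (pause b x)) x :=
  ((continuous_elasticaVel.comp (continuous_pause b)).integral_hasStrictDerivAt 0 x).hasDerivAt

theorem continuous_pausedElastica (b : ℝ) : Continuous (pausedElastica b) :=
  continuous_iff_continuousAt.2 fun x => (hasDerivAt_pausedElastica b x).continuousAt

theorem continuous_elastica : Continuous elastica :=
  continuous_iff_continuousAt.2 fun x => (hasDerivAt_elastica x).continuousAt

@[simp] theorem pausedElastica_zero (b : ℝ) : pausedElastica b 0 = 0 := by simp [pausedElastica]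

theorem pausedElastica_left (hb : 0 ≤ b) (hx : x ∈ Icc (-Real.pi) 0) :
    pausedElastica b x = elastica x := by
  refine PlanePath.eqOn_of_hasDerivAt_eq (continuous_pausedElastica b).continuousOn
    continuous_elastica.continuousOn (fun t _ => hasDerivAt_pausedElastica b t) (fun t ht => ?_)
    (right_mem_Icc.2 (by linarith [Real.pi_pos])) (by simp) hx
  rw [pause_of_mem_left hb (Ioo_subset_Icc_self ht)]
  exact hasDerivAt_elastica t

theorem pausedElastica_mid (hx : x ∈ Icc 0 b) : pausedElastica b x = x := by
  refine PlanePath.eqOn_of_hasDerivAt_eq (H := fun x : ℝ => (x : ℂ))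
    (continuous_pausedElastica b).continuousOn
    Complex.continuous_ofReal.continuousOn (fun t _ => hasDerivAt_pausedElastica b t)
    (fun t ht => ?_) (left_mem_Icc.2 (hx.1.trans hx.2)) (by simp) hx
  rw [pause_of_mem_mid (Ioo_subset_Icc_self ht)]
  simpa [elasticaVel] using (hasDerivAt_id t).ofReal_comp

theorem pausedElastica_right (hb : 0 ≤ b) (hx : x ∈ Icc b (b + Real.pi)) :
    pausedElastica b x = b + elastica (x - b) := by
  refine PlanePath.eqOn_of_hasDerivAt_eq (H := fun x : ℝ => b + elastica (x - b))
    (continuous_pausedElastica b).continuousOn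
    (continuous_const.add (continuous_elastica.comp (by fun_prop))).continuousOn
    (fun t _ => hasDerivAt_pausedElastica b t)
    (fun t ht => ?_) (left_mem_Icc.2 (hx.1.trans hx.2))
    (by simp [pausedElastica_mid (right_mem_Icc.2 hb)]) hx
  rw [pause_of_mem_right hb (Ioo_subset_Icc_self ht)]
  simpa using ((hasDerivAt_elastica (t - b)).scomp t ((hasDerivAt_id t).sub_const b)).const_add
    (b : ℂ)

/-- The clock rests at `-π`, where the elastica has velocity `-1`; the point therefore moves along a
segment opposite to the middle one. -/
theorem pausedElastica_le (hb : 0 ≤ b) (hx : x ≤ -Real.pi) :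
    pausedElastica b x = elastica (-Real.pi) - ((x + Real.pi : ℝ) : ℂ) := by
  refine PlanePath.eqOn_of_hasDerivAt_eq
    (H := fun x : ℝ => elastica (-Real.pi) - ((x + Real.pi : ℝ) : ℂ))
    (continuous_pausedElastica b).continuousOn (by fun_prop)
    (fun t _ => hasDerivAt_pausedElastica b t)
    (fun t ht => ?_) (right_mem_Icc.2 hx)
    (by simp [pausedElastica_left hb (left_mem_Icc.2 (by linarith [Real.pi_pos]))])
    (left_mem_Icc.2 hx)
  rw [pause_of_le hb ht.2.le]
  simpa [elasticaVel] using
    (((hasDerivAt_id t).add_const Real.pi).ofReal_comp).const_sub (elastica (-Real.pi))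

theorem pausedElastica_ge (hb : 0 ≤ b) (hx : b + Real.pi ≤ x) :
    pausedElastica b x = b + elastica Real.pi - ((x - (b + Real.pi) : ℝ) : ℂ) := by
  refine PlanePath.eqOn_of_hasDerivAt_eq
    (H := fun x : ℝ => b + elastica Real.pi - ((x - (b + Real.pi) : ℝ) : ℂ))
    (continuous_pausedElastica b).continuousOn (by fun_prop)
    (fun t _ => hasDerivAt_pausedElastica b t)
    (fun t ht => ?_) (left_mem_Icc.2 hx)
    (by simp [pausedElastica_right hb (right_mem_Icc.2 (by linarith [Real.pi_pos]))])
    (right_mem_Icc.2 hx)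
  rw [pause_of_ge hb ht.1.le]
  simpa [elasticaVel] using
    (((hasDerivAt_id t).sub_const (b + Real.pi)).ofReal_comp).const_sub (b + elastica Real.pi)

open PlanePath

/-- The path `x ↦ z + μ Z(x)`, where `Z` is the elastica with segments inserted. -/
noncomputable def pausedPath (z μ : ℂ) (b A B : ℝ) : PlanePath :=
  ⟨A, B, fun x => z + μ * pausedElastica b x⟩

section pausedPath

variable {z μ : ℂ} {A B : ℝ}

theorem hasDerivAt_pausedPath (z μ : ℂ) (b A B x : ℝ) :
    HasDerivAt (pausedPath z μ b A B).toFun (μ * elasticaVel (pause b x)) x :=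
  ((hasDerivAt_pausedElastica b x).const_mul μ).const_add z

theorem isCurve_pausedPath (hμ : μ ≠ 0) (hAB : A < B) : (pausedPath z μ b A B).IsCurve := by
  refine IsCurve.of_hasDerivAt (w := fun x => μ * elasticaVel (pause b x)) hAB
    (fun t _ => hasDerivAt_pausedPath z μ b A B t) ?_
    fun t _ => mul_ne_zero hμ (elasticaVel_ne_zero _)
  exact (absolutelyContinuous_pause b A B).contDiff_comp (g := fun x => μ * elasticaVel x)
    (contDiff_const.mul contDiff_elasticaVel)

theorem vel_pausedPath (hAB : A < B) (hx : x ∈ Icc A B) :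
    (pausedPath z μ b A B).vel x = μ * elasticaVel (pause b x) :=
  vel_eq_of_hasDerivAt (f := pausedPath z μ b A B) hAB hx (hasDerivAt_pausedPath z μ b A B x)

theorem norm_elasticaVel (x : ℝ) : ‖elasticaVel x‖ = (Real.sqrt (1 + Real.sin x ^ 2))⁻¹ := by
  rw [elasticaVel_eq, norm_mul, Complex.norm_exp_ofReal_mul_I, mul_one, Complex.norm_real,
    Real.norm_of_nonneg (inv_nonneg.2 (Real.sqrt_nonneg _))]

theorem isDirectionAngle_pausedPath {r γ : ℝ} (hr : 0 < r) (hAB : A < B) :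
    (pausedPath z (r * Complex.exp (γ * Complex.I)) b A B).IsDirectionAngle
      fun x => γ + elasticaAngle (pause b x) := by
  refine ⟨(absolutelyContinuous_pause b A B).contDiff_comp (g := fun x => γ + elasticaAngle x)
    (contDiff_const.add contDiff_elasticaAngle), fun t ht => ?_⟩
  rw [vel_pausedPath hAB ht, norm_mul, norm_mul, Complex.norm_exp_ofReal_mul_I, mul_one,
    norm_elasticaVel, elasticaVel_eq, Complex.norm_real, Real.norm_of_nonneg hr.le]
  push_cast
  rw [add_mul, Complex.exp_add]
  ring

theorem isCurve_elasticaSeg (hAB : A < B) : (elasticaSeg A B).IsCurve :=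
  IsCurve.of_hasDerivAt (w := elasticaVel) hAB (fun t _ => hasDerivAt_elastica t)
    contDiff_elasticaVel.contDiffOn.absolutelyContinuousOnInterval
    fun t _ => elasticaVel_ne_zero t

theorem turning_elasticaSeg (hAB : A < B) :
    (elasticaSeg A B).turning = elasticaAngle B - elasticaAngle A := by
  refine IsDirectionAngle.turning_eq (f := elasticaSeg A B) (τ := elasticaAngle) ⟨?_, ?_⟩
    (isCurve_elasticaSeg hAB)
  · exact contDiff_elasticaAngle.contDiffOn.absolutelyContinuousOnInterval
  · intro t ht
    rw [vel_eq_of_hasDerivAt (f := elasticaSeg A B) hAB ht (hasDerivAt_elastica t),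
      norm_elasticaVel, elasticaVel_eq]

end pausedPath

end ElasticSpline

/-! ### The candidate extremals: closing condition and energy. -/

namespace ElasticSpline

open PlanePath

variable {α β γ a b d : ℝ}

/-- Admissible lengths `a`, `b`, `d` of the segments at the directions `γ + π`, `γ`, `γ + π`. -/
structure ModelShape (α β γ a b d : ℝ) : Prop where
  lt : γ < α
  le₁ : α - γ ≤ Real.pi
  le : γ ≤ β
  le₂ : β - γ ≤ Real.pi
  sin_neg : Real.sin γ < 0
  a_nonneg : 0 ≤ a
  a_eq : a = 0 ∨ α - γ = Real.pi
  b_nonneg : 0 ≤ b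
  d_nonneg : 0 ≤ d
  d_eq : d = 0 ∨ β - γ = Real.pi

/-- Admissible lengths for which the curve with these segments ends at `1`. -/
structure ModelParams (α β γ a b d : ℝ) : Prop extends ModelShape α β γ a b d where
  eq : lam α β γ * (b - a - d) = sigma α β γ

/-- The curve of minimal energy with inflection direction `γ` and segments of lengths
proportional to `a`, `b`, `d`. -/
noncomputable def model (α β γ a b d : ℝ) : PlanePath :=
  pausedPath (-(lam α β γ * Complex.exp (γ * Complex.I) *
      pausedElastica b (-(elasticaParam (α - γ) + a))))
    (lam α β γ * Complex.exp (γ * Complex.I)) b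
    (-(elasticaParam (α - γ) + a)) (b + elasticaParam (β - γ) + d)

/-- The direction angle of `model`. -/
noncomputable def modelAngle (γ b x : ℝ) : ℝ := γ + elasticaAngle (pause b x)

theorem lam_mul_sum (h : 0 < y₁ α γ + y₂ β γ) :
    lam α β γ * (y₁ α γ + y₂ β γ) = -Real.sin γ := by
  rw [lam, div_mul_cancel₀ _ h.ne']

theorem sigma_eq : sigma α β γ = Real.cos γ -
    lam α β γ * (Real.sqrt (Real.sin (α - γ)) + Real.sqrt (Real.sin (β - γ))) := by
  rw [sigma, lam]
  ring

namespace ModelShape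

theorem sum_pos (h : ModelShape α β γ a b d) : 0 < y₁ α γ + y₂ β γ :=
  ElasticSpline.sum_pos h.lt h.le₁ h.le h.le₂

theorem lam_pos (h : ModelShape α β γ a b d) : 0 < lam α β γ :=
  div_pos (neg_pos.2 h.sin_neg) h.sum_pos

theorem mem₁ (h : ModelShape α β γ a b d) : α - γ ∈ Icc 0 Real.pi :=
  ⟨by linarith [h.lt], h.le₁⟩

theorem mem₂ (h : ModelShape α β γ a b d) : β - γ ∈ Icc 0 Real.pi :=
  ⟨by linarith [h.le], h.le₂⟩

theorem param_pos (h : ModelShape α β γ a b d) : 0 < elasticaParam (α - γ) :=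
  elasticaParam_pos (by linarith [h.lt]) h.le₁

theorem A_neg (h : ModelShape α β γ a b d) : -(elasticaParam (α - γ) + a) < 0 := by
  linarith [h.param_pos, h.a_nonneg]

theorem B_nonneg (h : ModelShape α β γ a b d) : 0 ≤ b + elasticaParam (β - γ) + d := by
  linarith [(elasticaParam_mem (β - γ)).1, h.b_nonneg, h.d_nonneg]

theorem lt_end (h : ModelShape α β γ a b d) :
    -(elasticaParam (α - γ) + a) < b + elasticaParam (β - γ) + d :=
  h.A_neg.trans_le h.B_nonneg

theorem scale_ne_zero (h : ModelShape α β γ a b d) :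
    (lam α β γ : ℂ) * Complex.exp (γ * Complex.I) ≠ 0 :=
  mul_ne_zero (by exact_mod_cast h.lam_pos.ne') (Complex.exp_ne_zero _)

theorem isCurve (h : ModelShape α β γ a b d) : (model α β γ a b d).IsCurve :=
  isCurve_pausedPath h.scale_ne_zero h.lt_end

theorem pause_start (h : ModelShape α β γ a b d) :
    pause b (-(elasticaParam (α - γ) + a)) = -elasticaParam (α - γ) := by
  obtain ⟨h1, h2⟩ := elasticaParam_mem (α - γ)
  rcases h.a_eq with h0 | h0
  · rw [h0, add_zero, pause_of_mem_left h.b_nonneg ⟨by linarith, by linarith⟩]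
  · rw [h0, elasticaParam_pi, pause_of_le h.b_nonneg (by linarith [h.a_nonneg])]

theorem pause_finish (h : ModelShape α β γ a b d) :
    pause b (b + elasticaParam (β - γ) + d) = elasticaParam (β - γ) := by
  obtain ⟨h1, h2⟩ := elasticaParam_mem (β - γ)
  rcases h.d_eq with h0 | h0
  · rw [h0, add_zero, pause_of_mem_right h.b_nonneg ⟨by linarith, by linarith⟩]
    ring
  · rw [h0, elasticaParam_pi, pause_of_ge h.b_nonneg (by linarith [h.d_nonneg])]

theorem pausedElastica_start (h : ModelShape α β γ a b d) :
    pausedElastica b (-(elasticaParam (α - γ) + a)) = a - elastica (elasticaParam (α - γ)) := by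
  obtain ⟨h1, h2⟩ := elasticaParam_mem (α - γ)
  rcases h.a_eq with h0 | h0
  · rw [h0, add_zero, pausedElastica_left h.b_nonneg ⟨by linarith, by linarith⟩, elastica_neg]
    simp
  · rw [h0, elasticaParam_pi, pausedElastica_le h.b_nonneg (by linarith [h.a_nonneg]),
      elastica_neg]
    push_cast
    ring

theorem pausedElastica_finish (h : ModelShape α β γ a b d) :
    pausedElastica b (b + elasticaParam (β - γ) + d) =
      b - d + elastica (elasticaParam (β - γ)) := by
  obtain ⟨h1, h2⟩ := elasticaParam_mem (β - γ)
  rcases h.d_eq with h0 | h0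
  · rw [h0, add_zero, pausedElastica_right h.b_nonneg ⟨by linarith, by linarith⟩,
      add_sub_cancel_left]
    simp
  · rw [h0, elasticaParam_pi, pausedElastica_ge h.b_nonneg (by linarith [h.d_nonneg])]
    push_cast
    ring

end ModelShape

theorem elastica_elasticaParam {y : ℝ} (hy : y ∈ Icc 0 Real.pi) : elastica (elasticaParam y) =
    (Real.sqrt (Real.sin y) : ℂ) + Complex.I * ((1 / 2 * sqrtSinPrim y : ℝ) : ℂ) := by
  rw [elastica, sin_elasticaParam hy, xi_elasticaParam hy]

/-- The displacement condition which characterises the length `b` of the middle segment. -/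
theorem displacement_iff (hS : 0 < y₁ α γ + y₂ β γ)
    (h1 : α - γ ∈ Icc 0 Real.pi) (h2 : β - γ ∈ Icc 0 Real.pi) :
    (lam α β γ * Complex.exp (γ * Complex.I)) * ((b - d + elastica (elasticaParam (β - γ))) -
      (a - elastica (elasticaParam (α - γ)))) = 1 ↔ lam α β γ * (b - a - d) = sigma α β γ := by
  have hl := lam_mul_sum hS
  rw [y₁_eq, y₂_eq] at hl
  have e0 : (lam α β γ * Complex.exp (γ * Complex.I)) *
      ((b - d + elastica (elasticaParam (β - γ))) - (a - elastica (elasticaParam (α - γ)))) = 1 ↔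
      lam α β γ * ((b - d + elastica (elasticaParam (β - γ))) -
        (a - elastica (elasticaParam (α - γ)))) = Complex.exp ((-γ : ℝ) * Complex.I) := by
    rw [Complex.ofReal_neg, neg_mul, Complex.exp_neg, mul_right_comm,
      mul_eq_one_iff_eq_inv₀ (Complex.exp_ne_zero _)]
  -- After rotation by `-γ` the imaginary part reads `λ (y₁ + y₂) = -sin γ`, which holds by the
  -- definition of `λ`. Only the real part is a condition, and it is the one involving `σ`.
  rw [e0, elastica_elasticaParam h1, elastica_elasticaParam h2, Complex.ext_iff,
    Complex.exp_ofReal_mul_I_re, Complex.exp_ofReal_mul_I_im, Real.cos_neg, Real.sin_neg, sigma_eq]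
  simp only [Complex.mul_re, Complex.mul_im, Complex.add_re, Complex.add_im, Complex.sub_re,
    Complex.sub_im, Complex.ofReal_re, Complex.ofReal_im, Complex.I_re, Complex.I_im]
  constructor
  · rintro ⟨h, -⟩
    linarith
  · intro h
    constructor
    · linarith
    · linarith

namespace ModelParams

theorem model_start (α β γ a b d : ℝ) :
    (model α β γ a b d).toFun (model α β γ a b d).a = 0 := by
  simp [model, pausedPath]

theorem model_finish (h : ModelParams α β γ a b d) :
    (model α β γ a b d).toFun (model α β γ a b d).b = 1 := by
  have := (displacement_iff h.sum_pos h.mem₁ h.mem₂).2 h.eq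
  rw [← h.pausedElastica_start, ← h.pausedElastica_finish, mul_sub] at this
  rw [← this]
  simp only [model, pausedPath]
  ring

theorem isRightLeft (h : ModelParams α β γ a b d) :
    IsRightLeft (model α β γ a b d) (modelAngle γ b) 0 α β γ where
  curve := h.isCurve
  angle := isDirectionAngle_pausedPath h.lam_pos h.lt_end
  mem := ⟨h.A_neg, h.B_nonneg⟩
  -- The angle is even in the elastica parameter, so increasing parameters in `[-π, 0]` give
  -- decreasing angles.
  anti := fun x hx y hy hxy => by
    have e1 := pause_mem_of_nonpos h.b_nonneg hx.2
    have e2 := pause_mem_of_nonpos h.b_nonneg hy.2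
    have e3 := pause_monotone b hxy
    rw [modelAngle, modelAngle, ← elasticaAngle_neg, ← elasticaAngle_neg (pause b x)]
    exact add_le_add_right (elasticaAngle_strictMonoOn.monotoneOn
      ⟨by linarith [e2.2], by linarith [e2.1]⟩ ⟨by linarith [e1.2], by linarith [e1.1]⟩
      (neg_le_neg e3)) γ
  mono := fun x hx y hy hxy =>
    add_le_add_right (elasticaAngle_strictMonoOn.monotoneOn (pause_mem_of_nonneg hx.1)
      (pause_mem_of_nonneg hy.1) (pause_monotone b hxy)) γ
  angle_start := by
    change modelAngle γ b (-(elasticaParam (α - γ) + a)) = α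
    rw [modelAngle, h.pause_start, elasticaAngle_neg, elasticaAngle_elasticaParam h.mem₁]
    ring
  angle_mid := by
    rw [modelAngle, pause_of_mem_mid ⟨le_rfl, h.b_nonneg⟩, elasticaAngle_zero, add_zero]
  angle_finish := by
    change modelAngle γ b (b + elasticaParam (β - γ) + d) = β
    rw [modelAngle, h.pause_finish, elasticaAngle_elasticaParam h.mem₂]
    ring
  lt := h.lt
  le₁ := h.le₁
  le₂ := h.le₂
  start := model_start _ _ _ _ _ _
  finish := h.model_finish

theorem norm_vel (h : ModelParams α β γ a b d) {x : ℝ}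
    (hx : x ∈ Icc (-(elasticaParam (α - γ) + a)) (b + elasticaParam (β - γ) + d)) :
    ‖(model α β γ a b d).vel x‖ =
      lam α β γ * (Real.sqrt (1 + Real.sin (pause b x) ^ 2))⁻¹ := by
  rw [model, vel_pausedPath h.lt_end hx, norm_mul, norm_mul, Complex.norm_exp_ofReal_mul_I,
    mul_one, norm_elasticaVel, Complex.norm_real, Real.norm_of_nonneg h.lam_pos.le]

/-- The speed is `λ / √(1 + sin²)` and `|sin|` of the elastica parameter is `√sin` of its angle, so
the equality equations hold on both sides of the parameter `0`, at the resting parameters too. -/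
theorem energy (h : ModelParams α β γ a b d) :
    (model α β γ a b d).energy = ENNReal.ofReal (G α β γ) := by
  have hl := h.lam_pos.ne'
  have hd : ∀ x, deriv (modelAngle γ b) x =
      2 * Real.sin (pause b x) / Real.sqrt (1 + Real.sin (pause b x) ^ 2) := fun x =>
    ((hasDerivAt_elasticaAngle_pause h.b_nonneg x).const_add γ).deriv
  refine h.isRightLeft.energy_eq (fun t ht => ?_) (fun t ht => ?_)
  · have ht0 : t ≤ 0 := ht.2.le
    have e := pause_mem_of_nonpos h.b_nonneg ht0
    rw [hd, h.norm_vel ⟨ht.1.le, ht0.trans h.B_nonneg⟩, modelAngle, add_sub_cancel_left,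
      ← abs_sin_eq, abs_of_nonpos (Real.sin_nonpos_of_nonpos_of_neg_pi_le e.2 e.1)]
    field_simp
  · have ht0 : 0 ≤ t := ht.1.le
    have e := pause_mem_of_nonneg (b := b) ht0
    rw [hd, h.norm_vel ⟨h.A_neg.le.trans ht0, ht.2.le⟩, modelAngle, add_sub_cancel_left,
      ← abs_sin_eq, abs_of_nonneg (Real.sin_nonneg_of_mem_Icc e)]
    field_simp

end ModelParams

end ElasticSpline

/-! ### Rigidity: a curve of energy `G(γ)` is one of the candidates. -/

namespace ElasticSpline

namespace PlanePath

/-- An absolutely continuous function is the integral of its derivative, and the integral of a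
continuous function is differentiable everywhere, not just almost everywhere. -/
theorem hasDerivAt_of_ae_deriv_eq {σ F : ℝ → ℝ} {p q t : ℝ}
    (hσ : AbsolutelyContinuousOnInterval σ p q) (hF : ContinuousOn F (Icc p q))
    (h : ∀ᵐ t, t ∈ Ioc p q → deriv σ t = F t) (ht : t ∈ Ioo p q) : HasDerivAt σ (F t) t := by
  have h1 := (hasDerivAt_integral_of_continuousOn hF ht).const_add (σ p)
  refine h1.congr_of_eventuallyEq ?_
  filter_upwards [Icc_mem_nhds ht.1 ht.2] with x hx
  have hsub : uIcc p x ⊆ uIcc p q := by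
    rw [uIcc_of_le hx.1, uIcc_of_le (hx.1.trans hx.2)]; exact Icc_subset_Icc_right hx.2
  have h2 := (hσ.mono hsub).integral_deriv_eq_sub
  rw [intervalIntegral.integral_congr_ae (g := F)] at h2
  · linarith
  · filter_upwards [h] with y hy hy'
    rw [uIoc_of_le hx.1] at hy'
    exact hy ⟨hy'.1, hy'.2.trans hx.2⟩

/-- A monotone function which increases at the rate of `ψ` as long as its values lie strictly
between `lo` and `hi` is a truncation of a translate of `ψ`. -/
theorem exists_eq_truncation {q ψ : ℝ → ℝ} {p r lo hi : ℝ} (hpr : p ≤ r)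
    (hq : ContinuousOn q (Icc p r)) (hψ : ContinuousOn ψ (Icc p r))
    (hqm : MonotoneOn q (Icc p r)) (hψm : MonotoneOn ψ (Icc p r)) (hlt : q p < q r)
    (hlo : ∀ t ∈ Icc p r, lo ≤ q t) (hhi : ∀ t ∈ Icc p r, q t ≤ hi)
    (hd : ∀ t ∈ Ioo p r, lo < q t → q t < hi → HasDerivAt (fun t => q t - ψ t) 0 t) :
    ∃ x₀, ∀ t ∈ Icc p r, q t = max lo (min (ψ t - x₀) hi) := by
  have hp := left_mem_Icc.2 hpr
  have hr := right_mem_Icc.2 hpr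
  -- By monotonicity `q` stays strictly between `lo` and `hi` on all of `[s, t]`, so `q - ψ` is
  -- constant there.
  have key : ∀ s ∈ Icc p r, ∀ t ∈ Icc p r, s ≤ t → lo < q s → q t < hi →
      q t - ψ t = q s - ψ s := by
    intro s hs t ht hst h1 h2
    have hsub : Icc s t ⊆ Icc p r := Icc_subset_Icc hs.1 ht.2
    refine eqOn_of_hasDerivAt_eq (F := fun t => q t - ψ t) (H := fun _ => q s - ψ s)
      (F' := fun _ => 0) ((hq.sub hψ).mono hsub) continuousOn_const (fun x hx => ?_)
      (fun x _ => hasDerivAt_const x _) (left_mem_Icc.2 hst) rfl (right_mem_Icc.2 hst)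
    have hx' := hsub (Ioo_subset_Icc_self hx)
    exact hd x ⟨hs.1.trans_lt hx.1, hx.2.trans_le ht.2⟩ (h1.trans_le (hqm hs hx' hx.1.le))
      ((hqm hx' ht hx.2.le).trans_lt h2)
  obtain ⟨m, hm, hmv⟩ := intermediate_value_Icc hpr hq
    (show (q p + q r) / 2 ∈ Icc (q p) (q r) by constructor <;> linarith)
  have hmlo : lo < q m := by linarith [hlo p hp]
  have hmhi : q m < hi := by linarith [hhi r hr]
  refine ⟨ψ m - q m, fun t ht => ?_⟩
  -- The point `m`, where `q` is strictly between `lo` and `hi`, fixes the translation. Once `q` has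
  -- reached a bound, `ψ - x₀` has reached it too: approach the bound by intermediate values `v` and
  -- use that `ψ` is monotone.
  rcases le_total m t with hmt | hmt
  · have h1 := hqm hm ht hmt
    rcases (hhi t ht).lt_or_eq with h2 | h2
    · have := key m hm t ht hmt hmlo h2
      rw [show ψ t - (ψ m - q m) = q t by linarith, min_eq_left h2.le, max_eq_right (hlo t ht)]
    · have h3 : hi ≤ ψ t - (ψ m - q m) := by
        refine le_of_forall_lt_imp_le_of_dense fun v hv => ?_
        rcases le_total v (q m) with hvm | hvm
        · have := hψm hm ht hmt
          linarith
        · obtain ⟨x, hx, hxv⟩ := intermediate_value_Icc hmt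
            (hq.mono (Icc_subset_Icc hm.1 ht.2)) (show v ∈ Icc (q m) (q t) from
              ⟨hvm, h2 ▸ hv.le⟩)
          have hx' : x ∈ Icc p r := ⟨hm.1.trans hx.1, hx.2.trans ht.2⟩
          have e1 := key m hm x hx' hx.1 hmlo (hxv ▸ hv)
          have e2 := hψm hx' ht hx.2
          linarith
      rw [min_eq_right h3, max_eq_right (by linarith), h2]
  · have h1 := hqm ht hm hmt
    rcases (hlo t ht).lt_or_eq with h2 | h2
    · have := key t ht m hm hmt h2 hmhi
      rw [show ψ t - (ψ m - q m) = q t by linarith, min_eq_left (hhi t ht), max_eq_right h2.le]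
    · have h3 : ψ t - (ψ m - q m) ≤ lo := by
        refine le_of_forall_gt_imp_ge_of_dense fun v hv => ?_
        rcases le_total (q m) v with hvm | hvm
        · have := hψm ht hm hmt
          linarith
        · obtain ⟨x, hx, hxv⟩ := intermediate_value_Icc hmt
            (hq.mono (Icc_subset_Icc ht.1 hm.2)) (show v ∈ Icc (q t) (q m) from
              ⟨h2 ▸ hv.le, hvm⟩)
          have hx' : x ∈ Icc p r := ⟨ht.1.trans hx.1, hx.2.trans hm.2⟩
          have e1 := key x hx' m hm hx.2 (hxv ▸ hv) hmhi
          have e2 := hψm ht hx' hx.1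
          linarith
      rw [max_eq_left ((min_le_left _ _).trans h3), ← h2]

end PlanePath

open PlanePath

variable {f : PlanePath} {τ : ℝ → ℝ} {c α β γ : ℝ}

/-- The curvature equation for `τ` has non-unique solutions. In the variable `elasticaParam (τ - γ)`
it says that a monotone function follows a clock `ψ` while its value is strictly between `0` and
`π`. Hence it is a truncated translate of `ψ`, and the only freedom is the three resting times. -/
theorem PlanePath.IsRightLeft.exists_equiv_model (h : IsRightLeft f τ c α β γ)
    (hcase : γ < β ∨ γ = β ∧ c = f.b) (hE : f.energy = ENNReal.ofReal (G α β γ)) :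
    ∃ a b d, ModelParams α β γ a b d ∧ f.Equiv (model α β γ a b d) := by
  have hf := h.curve
  have hl := h.lam_pos
  obtain ⟨ae1, ae2⟩ := h.ae_deriv_eq hE
  have hτc := h.angle.continuousOn hf.1.le
  have hac : Icc f.a c ⊆ Icc f.a f.b := Icc_subset_Icc_right h.mem.2
  have hcb : Icc c f.b ⊆ Icc f.a f.b := Icc_subset_Icc_left h.mem.1.le
  have hFc : ContinuousOn (fun t => Real.sqrt (Real.sin (τ t - γ)) * ‖f.vel t‖) (Icc f.a f.b) :=
    (continuous_sqrt_sin.comp_continuousOn (hτc.sub continuousOn_const)).mul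
      hf.continuousOn_vel.norm
  have hAC1 : AbsolutelyContinuousOnInterval τ f.a c := h.angle.1.mono (by
    rwa [uIcc_of_le h.mem.1.le, uIcc_of_le hf.1.le])
  have hAC2 : AbsolutelyContinuousOnInterval τ c f.b := h.angle.1.mono (by
    rwa [uIcc_of_le h.mem.2, uIcc_of_le hf.1.le])
  have hd1 : ∀ t ∈ Ioo f.a c, HasDerivAt τ
      (-(2 / lam α β γ) * (Real.sqrt (Real.sin (τ t - γ)) * ‖f.vel t‖)) t := fun t ht =>
    hasDerivAt_of_ae_deriv_eq hAC1 (continuousOn_const.mul (hFc.mono hac)) ae1 ht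
  have hd2 : ∀ t ∈ Ioo c f.b, HasDerivAt τ
      (2 / lam α β γ * (Real.sqrt (Real.sin (τ t - γ)) * ‖f.vel t‖)) t := fun t ht =>
    hasDerivAt_of_ae_deriv_eq hAC2 (continuousOn_const.mul (hFc.mono hcb)) ae2 ht
  -- The rate of the clock: the ratio of `|f'|` to the speed `λ / √(1 + sin (τ - γ))` of the
  -- candidate curve at the same angle.
  set D : ℝ → ℝ := fun t => Real.sqrt (1 + Real.sin (τ t - γ)) * ‖f.vel t‖ / lam α β γ with hD
  have hDc : ContinuousOn D (Icc f.a f.b) :=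
    (((Real.continuous_sqrt.comp (continuous_const.add Real.continuous_sin)).comp_continuousOn
      (hτc.sub continuousOn_const)).mul hf.continuousOn_vel.norm).div_const _
  set ψ : ℝ → ℝ := fun t => ∫ r in f.a..t, D r with hψdef
  have hψd : ∀ t ∈ Ioo f.a f.b, HasDerivAt ψ (D t) t := fun t ht =>
    hasDerivAt_integral_of_continuousOn hDc ht
  have hψc : ContinuousOn ψ (Icc f.a f.b) := by
    have := intervalIntegral.continuousOn_primitive_interval (μ := volume) (f := D)
      (a := f.a) (b := f.b) (by rw [uIcc_of_le hf.1.le]; exact hDc.integrableOn_Icc)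
    rwa [uIcc_of_le hf.1.le] at this
  have hDpos : ∀ t ∈ Icc f.a f.b, 0 < D t := fun t ht => by
    have := hf.norm_vel_pos ht
    have := h.sin_nonneg ht
    simp only [hD]
    positivity
  have hψm : MonotoneOn ψ (Icc f.a f.b) := by
    refine monotoneOn_of_deriv_nonneg (convex_Icc _ _) hψc (fun t ht => ?_) fun t ht => ?_
    · rw [interior_Icc] at ht
      exact (hψd t ht).differentiableAt.differentiableWithinAt
    · rw [interior_Icc] at ht
      rw [(hψd t ht).deriv]
      exact (hDpos t (Ioo_subset_Icc_self ht)).le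
  have hψa : ψ f.a = 0 := by simp [hψdef]
  have hm : ∀ t ∈ Icc f.a f.b, τ t - γ ∈ Icc 0 Real.pi := fun t ht => h.angle_sub_mem ht
  have hqc : ContinuousOn (fun t => elasticaParam (τ t - γ)) (Icc f.a f.b) :=
    continuous_elasticaParam.comp_continuousOn (hτc.sub continuousOn_const)
  have hinner : ∀ t ∈ Icc f.a f.b, 0 < elasticaParam (τ t - γ) →
      elasticaParam (τ t - γ) < Real.pi → τ t - γ ∈ Ioo 0 Real.pi := by
    intro t ht h1 h2
    refine ⟨lt_of_le_of_ne (hm t ht).1 fun e => ?_, lt_of_le_of_ne (hm t ht).2 fun e => ?_⟩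
    · rw [← e, elasticaParam_zero] at h1
      exact h1.false
    · rw [e, elasticaParam_pi] at h2
      exact h2.false
  have hαm : α - γ ∈ Icc 0 Real.pi := ⟨by linarith [h.lt], h.le₁⟩
  have hβm : β - γ ∈ Icc 0 Real.pi := ⟨by linarith [h.le], h.le₂⟩
  have ht1pos : 0 < elasticaParam (α - γ) := elasticaParam_pos (by linarith [h.lt]) h.le₁
  obtain ⟨x₁, hx₁⟩ := exists_eq_truncation (q := fun t => -elasticaParam (τ t - γ)) (ψ := ψ)
    (lo := -Real.pi) (hi := 0) h.mem.1.le (hqc.mono hac).neg (hψc.mono hac)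
    (fun x hx y hy hxy => neg_le_neg (elasticaParam_strictMonoOn.monotoneOn (hm y (hac hy))
      (hm x (hac hx)) (sub_le_sub_right (h.anti hx hy hxy) γ))) (hψm.mono hac)
    (by
      simp only [h.angle_start, h.angle_mid, sub_self, elasticaParam_zero, neg_zero]
      linarith)
    (fun t _ => neg_le_neg (elasticaParam_mem _).2) (fun t _ => neg_nonpos.2 (elasticaParam_mem _).1)
    (fun t ht e1 e2 => by
      have ht' : t ∈ Ioo f.a f.b := ⟨ht.1, ht.2.trans_le h.mem.2⟩
      have hmem := hinner t (Ioo_subset_Icc_self ht') (by linarith) (by linarith)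
      have hs := (Real.sqrt_pos.2 (Real.sin_pos_of_mem_Ioo hmem)).ne'
      refine (((hasDerivAt_elasticaParam hmem).comp t ((hd1 t ht).sub_const γ)).neg.sub
        (hψd t ht')).congr_deriv ?_
      simp only [hD]
      field_simp
      ring)
  -- `x₁` is the clock time at which the right-turning part reaches direction `γ`, `x₂` the time at
  -- which the left-turning part departs from it. If `γ = β` there is no left-turning part, and `x₂`
  -- is set to the final time so that no last segment arises.
  obtain ⟨x₂, hx₂, hx₂'⟩ : ∃ x₂, (∀ t ∈ Icc c f.b,
      elasticaParam (τ t - γ) = max 0 (min (ψ t - x₂) Real.pi)) ∧ (γ = β → x₂ = ψ f.b) := by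
    rcases hcase with hlt | ⟨he, rfl⟩
    · obtain ⟨x₂, hx₂⟩ := exists_eq_truncation (q := fun t => elasticaParam (τ t - γ)) (ψ := ψ)
        (lo := 0) (hi := Real.pi) h.mem.2 (hqc.mono hcb) (hψc.mono hcb)
        (fun x hx y hy hxy => elasticaParam_strictMonoOn.monotoneOn (hm x (hcb hx))
          (hm y (hcb hy)) (sub_le_sub_right (h.mono hx hy hxy) γ)) (hψm.mono hcb)
        (by
          simp only [h.angle_mid, h.angle_finish, sub_self, elasticaParam_zero]
          exact elasticaParam_pos (by linarith) h.le₂)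
        (fun t _ => (elasticaParam_mem _).1) (fun t _ => (elasticaParam_mem _).2)
        (fun t ht e1 e2 => by
          have ht' : t ∈ Ioo f.a f.b := ⟨h.mem.1.trans ht.1, ht.2⟩
          have hmem := hinner t (Ioo_subset_Icc_self ht') e1 e2
          have hs := (Real.sqrt_pos.2 (Real.sin_pos_of_mem_Ioo hmem)).ne'
          refine (((hasDerivAt_elasticaParam hmem).comp t ((hd2 t ht).sub_const γ)).sub
            (hψd t ht')).congr_deriv ?_
          simp only [hD]
          field_simp
          ring)
      exact ⟨x₂, hx₂, fun he => absurd he hlt.ne⟩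
    · refine ⟨ψ f.b, fun t ht => ?_, fun _ => rfl⟩
      rw [Icc_self, mem_singleton_iff] at ht
      rw [ht, h.angle_mid]
      simp [Real.pi_pos.le]
  have hπ := Real.pi_pos
  -- At `c` the direction is `γ`: the right turn is finished and the left turn has not begun. So `x₁
  -- ≤ ψ c ≤ x₂`, and the middle segment has nonnegative length.
  have hc1 : x₁ ≤ ψ c := by
    have := hx₁ c ⟨h.mem.1.le, le_rfl⟩
    simp only [h.angle_mid, sub_self, elasticaParam_zero, neg_zero] at this
    by_contra! hlt
    rw [min_eq_left (by linarith)] at this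
    have : max (-Real.pi) (ψ c - x₁) < 0 := max_lt (by linarith) (by linarith)
    linarith
  have hc2 : ψ c ≤ x₂ := by
    have := hx₂ c ⟨le_rfl, h.mem.2⟩
    simp only [h.angle_mid, sub_self, elasticaParam_zero] at this
    by_contra! hlt
    have : 0 < min (ψ c - x₂) Real.pi := lt_min (by linarith) hπ
    have := le_max_right 0 (min (ψ c - x₂) Real.pi)
    linarith
  have hcm : c ∈ Icc f.a f.b := ⟨h.mem.1.le, h.mem.2⟩
  have hb0 : 0 ≤ x₂ - x₁ := by linarith
  have hangle : ∀ t ∈ Icc f.a f.b,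
      elasticaAngle (pause (x₂ - x₁) (ψ t - x₁)) = τ t - γ := by
    intro t ht
    rcases le_total t c with htc | htc
    · have e1 := hx₁ t ⟨ht.1, htc⟩
      have e2 := hψm ht hcm htc
      rw [pause, max_eq_right (show ψ t - x₁ - (x₂ - x₁) ≤ 0 by linarith), min_eq_right hπ.le,
        add_zero, ← e1, elasticaAngle_neg, elasticaAngle_elasticaParam (hm t ht)]
    · have e1 := hx₂ t ⟨htc, ht.2⟩
      have e2 := hψm hcm ht htc
      have e3 : elasticaParam (τ t - γ) = min Real.pi (max (ψ t - x₂) 0) := by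
        rw [e1, max_min_distrib_left, max_eq_right hπ.le, min_comm, max_comm]
      rw [pause_of_nonneg (by linarith), show ψ t - x₁ - (x₂ - x₁) = ψ t - x₂ by ring, ← e3,
        elasticaAngle_elasticaParam (hm t ht)]
  have hfa := left_mem_Icc.2 hf.1.le
  have hfb := right_mem_Icc.2 hf.1.le
  have hA := hx₁ f.a (left_mem_Icc.2 h.mem.1.le)
  simp only [h.angle_start, hψa, zero_sub] at hA
  have hA1 : min (-x₁) 0 ≤ -elasticaParam (α - γ) := hA ▸ le_max_right _ _
  have hA1' : -x₁ ≤ -elasticaParam (α - γ) := by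
    rcases min_le_iff.1 hA1 with h1 | h1
    · exact h1
    · linarith
  have hB := hx₂ f.b (right_mem_Icc.2 h.mem.2)
  rw [h.angle_finish] at hB
  have hsh : ModelShape α β γ (x₁ - elasticaParam (α - γ)) (x₂ - x₁)
      (ψ f.b - x₂ - elasticaParam (β - γ)) := by
    refine ⟨h.lt, h.le₁, h.le, h.le₂, by linarith [h.neg_sin_pos], by linarith, ?_, hb0, ?_, ?_⟩
    · rcases h.le₁.lt_or_eq with h1 | h1
      · left
        have h2 := elasticaParam_lt_pi hαm.1 h1
        rw [min_eq_left (by linarith)] at hA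
        rcases max_cases (-Real.pi) (-x₁) with ⟨h3, -⟩ | ⟨h3, -⟩ <;> linarith
      · exact Or.inr h1
    · rcases h.le.lt_or_eq with h1 | h1
      · have h2 := elasticaParam_pos (sub_pos.2 h1) h.le₂
        rcases max_cases 0 (min (ψ f.b - x₂) Real.pi) with ⟨h3, -⟩ | ⟨h3, -⟩
        · linarith
        · linarith [min_le_left (ψ f.b - x₂) Real.pi]
      · rw [hx₂' h1, ← h1]; simp
    · rcases h.le.lt_or_eq with h1 | h1
      · rcases h.le₂.lt_or_eq with h4 | h4
        · left
          have h2 := elasticaParam_pos (sub_pos.2 h1) h.le₂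
          have h5 := elasticaParam_lt_pi hβm.1 h4
          rcases max_cases 0 (min (ψ f.b - x₂) Real.pi) with ⟨h3, -⟩ | ⟨h3, -⟩
          · linarith
          · rcases min_cases (ψ f.b - x₂) Real.pi with ⟨h6, -⟩ | ⟨h6, -⟩ <;> linarith
        · exact Or.inr h4
      · left; rw [hx₂' h1, ← h1]; simp
  set a := x₁ - elasticaParam (α - γ) with ha
  set b := x₂ - x₁ with hb
  set d := ψ f.b - x₂ - elasticaParam (β - γ) with hd
  have hAeq : ψ f.a - x₁ = -(elasticaParam (α - γ) + a) := by rw [hψa, ha]; ring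
  have hBeq : ψ f.b - x₁ = b + elasticaParam (β - γ) + d := by rw [hb, hd]; ring
  -- Both sides start at `0`, and they have the same velocity: the directions agree by `hangle` and
  -- the speeds by the choice of `D`.
  have hfm : EqOn f.toFun (fun t => (model α β γ a b d).toFun (ψ t - x₁)) (Icc f.a f.b) := by
    refine eqOn_of_hasDerivAt_eq (F' := f.vel) hf.continuousOn_toFun ?_ (fun t ht => hf.hasDerivAt ht)
      (fun t ht => ?_) hfa ?_
    · have hcont : Continuous (model α β γ a b d).toFun :=
        continuous_const.add (continuous_const.mul (continuous_pausedElastica b))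
      exact hcont.comp_continuousOn (hψc.sub continuousOn_const)
    · have ht' := Ioo_subset_Icc_self ht
      refine ((hasDerivAt_pausedPath _ _ b _ _ (ψ t - x₁)).scomp t
        ((hψd t ht).sub_const x₁)).congr_deriv ?_
      have hv := h.angle.2 t ht'
      have e1 : Real.sin (pause b (ψ t - x₁)) ^ 2 = Real.sin (τ t - γ) := by
        rw [← sin_elasticaAngle, hangle t ht']
      have e2 : ((Real.sqrt (1 + Real.sin (τ t - γ)) : ℝ) : ℂ) ≠ 0 := by
        have := h.sin_nonneg ht'
        exact_mod_cast (Real.sqrt_pos.2 (by linarith)).ne'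
      have e3 : (lam α β γ : ℂ) ≠ 0 := by exact_mod_cast hl.ne'
      have e4 : Complex.exp (τ t * Complex.I) =
          Complex.exp (γ * Complex.I) * Complex.exp (((τ t - γ : ℝ) : ℂ) * Complex.I) := by
        rw [← Complex.exp_add]
        congr 1
        push_cast
        ring
      conv_rhs => rw [hv, e4]
      rw [elasticaVel_eq, hangle t ht', e1, Complex.real_smul]
      simp only [hD]
      rw [Complex.ofReal_div, Complex.ofReal_mul, Complex.ofReal_inv]
      field_simp
    · rw [h.start, hAeq]
      exact (ModelParams.model_start α β γ a b d).symm
  have hp : ModelParams α β γ a b d := by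
    refine ⟨hsh, (displacement_iff hsh.sum_pos hsh.mem₁ hsh.mem₂).1 ?_⟩
    have e := hfm hfb
    simp only [h.finish, hBeq] at e
    rw [e, ← hsh.pausedElastica_start, ← hsh.pausedElastica_finish]
    simp only [model, pausedPath]
    ring
  exact ⟨a, b, d, hp, Equiv.of_reparam hf hp.isCurve (ψ := fun t => ψ t - x₁)
    (hψc.sub continuousOn_const) (fun t ht => (hψd t ht).sub_const x₁)
    (fun t ht => hDpos t (Ioo_subset_Icc_self ht)) hAeq hBeq hfm⟩

end ElasticSpline

/-! ### The candidates in the stated forms: optimal arcs, joins, first and second form. -/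

namespace ElasticSpline

open PlanePath

variable {f : PlanePath} {τ : ℝ → ℝ} {c α β γ a b d x : ℝ}

namespace PlanePath

theorem Equiv.refl_of_isCurve (hf : f.IsCurve) : f.Equiv f :=
  Equiv.of_eqOn hf hf rfl rfl fun _ _ => rfl

theorem IsRightLeft.connects (h : IsRightLeft f τ c α β γ) : f.Connects (uVec α) (vVec β) := by
  constructor
  · rw [tangentAt, h.start, h.angle.dir_eq h.curve (left_mem_Icc.2 h.curve.1.le), h.angle_start,
      uVec]
  · rw [tangentAt, h.finish, h.angle.dir_eq h.curve (right_mem_Icc.2 h.curve.1.le),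
      h.angle_finish, vVec]

theorem IsRightLeft.mem_sClass (h : IsRightLeft f τ c α β γ) (hlt : γ < β) :
    f ∈ sClass α β γ := by
  have hcb : c < f.b := lt_of_le_of_ne h.mem.2 fun e => by
    have := h.angle_mid
    rw [e, h.angle_finish] at this
    exact hlt.ne' this
  have hs : f.SplitsRightLeft c := by
    rw [h.angle.splitsRightLeft_iff h.curve, h.angle_start, h.angle_mid, h.angle_finish]
    exact ⟨⟨h.mem.1, hcb⟩, ⟨h.anti, h.le₁⟩, h.mono, h.le₂⟩
  have hn : ¬ f.IsCCurve := by
    have e1 := left_mem_Icc.2 h.curve.1.le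
    have e2 := right_mem_Icc.2 h.curve.1.le
    have e3 : c ∈ Icc f.a f.b := ⟨h.mem.1.le, h.mem.2⟩
    rintro (hl | hr)
    · have := ((h.angle.isLeftCCurve_iff h.curve).1 hl).1 e1 e3 h.mem.1.le
      rw [h.angle_start, h.angle_mid] at this
      exact absurd h.lt this.not_gt
    · have := ((h.angle.isRightCCurve_iff h.curve).1 hr).1 e3 e2 h.mem.2
      rw [h.angle_finish, h.angle_mid] at this
      exact absurd hlt this.not_gt
  rw [sClass, if_neg fun e => hlt.ne e.2]
  refine ⟨⟨⟨h.curve, Or.inr ⟨c, Or.inl hs⟩⟩, h.connects⟩, hn, c, hs, ?_⟩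
  rw [h.angle.dir_eq h.curve ⟨h.mem.1.le, h.mem.2⟩, h.angle_mid]

theorem IsRightLeft.isRightCCurve_restrict (h : IsRightLeft f τ c α β γ) :
    (f.restrict f.a c).IsRightCCurve :=
  ((h.angle.restrict h.curve le_rfl h.mem.1 h.mem.2).isRightCCurve_iff
    (h.curve.restrict le_rfl h.mem.1 h.mem.2)).2
      ⟨h.anti, h.angle_start ▸ h.angle_mid ▸ h.le₁⟩

theorem IsRightLeft.turning_restrict (h : IsRightLeft f τ c α β γ) :
    |(f.restrict f.a c).turning| = α - γ := by
  rw [(h.angle.restrict h.curve le_rfl h.mem.1 h.mem.2).turning_eq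
    (h.curve.restrict le_rfl h.mem.1 h.mem.2)]
  change |τ c - τ f.a| = _
  rw [h.angle_start, h.angle_mid, abs_sub_comm, abs_of_pos (sub_pos.2 h.lt)]

/-- The tangent line of a curve is `ℓ_γ` if it has the direction and the distance of `ℓ_γ`. -/
theorem tangentLineAt_eq_inflectionLine {t : ℝ} (hd : f.dir t = Complex.exp (γ * Complex.I))
    (hi : (f.toFun t * Complex.exp (-(γ * Complex.I))).im =
      -Real.sin γ * (y₁ α γ / (y₁ α γ + y₂ β γ))) :
    f.tangentLineAt t = inflectionLine α β γ := by
  have hinv : Complex.exp (γ * Complex.I) * Complex.exp (-(γ * Complex.I)) = 1 := by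
    rw [← Complex.exp_add, add_neg_cancel, Complex.exp_zero]
  ext z
  simp only [tangentLineAt, inflectionLine, mem_ofPred_eq, hd, ← hi]
  constructor
  · rintro ⟨r, rfl⟩
    rw [add_mul, mul_assoc, hinv]
    simp
  · intro hz
    refine ⟨((z - f.toFun t) * Complex.exp (-(γ * Complex.I))).re, ?_⟩
    have hr : ((((z - f.toFun t) * Complex.exp (-(γ * Complex.I))).re : ℝ) : ℂ) =
        (z - f.toFun t) * Complex.exp (-(γ * Complex.I)) := by
      refine Complex.ext (by simp) ?_
      rw [Complex.ofReal_im, sub_mul, Complex.sub_im, hz, sub_self]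
    rw [hr, mul_assoc, mul_comm (Complex.exp _), hinv]
    ring

end PlanePath

theorem sClass_subset_sCurves (hf : f ∈ sClass α β γ) : f ∈ sCurves (uVec α) (vVec β) := by
  unfold sClass at hf
  split_ifs at hf
  · exact ⟨⟨hf.1.1.1, Or.inl (Or.inr hf.1)⟩, hf.2⟩
  · exact hf.1

/-- The similarity factor `λ e^{iγ}` between the elastica and `model`. -/
noncomputable abbrev scale (α β γ : ℝ) : ℂ := lam α β γ * Complex.exp (γ * Complex.I)

theorem elasticaAngle_pi_sub (x : ℝ) : elasticaAngle (Real.pi - x) = Real.pi - elasticaAngle x := by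
  rw [elasticaAngle, elasticaAngle, Real.cos_pi_sub, neg_div, Real.arcsin_neg]
  ring

theorem pausedElastica_add (hb : 0 ≤ b) (ha : 0 ≤ a) (hx : 0 ≤ x) :
    pausedElastica (b + a) (x + a) = pausedElastica b x + a := by
  refine eqOn_of_hasDerivAt_eq (F := fun x => pausedElastica (b + a) (x + a))
    (H := fun x => pausedElastica b x + a)
    ((continuous_pausedElastica _).comp (by fun_prop)).continuousOn
    ((continuous_pausedElastica _).add continuous_const).continuousOn
    (fun t ht => ?_) (fun t _ => (hasDerivAt_pausedElastica b t).add_const (a : ℂ))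
    (left_mem_Icc.2 hx) ?_ (right_mem_Icc.2 hx)
  · have := (hasDerivAt_pausedElastica (b + a) (t + a)).scomp t ((hasDerivAt_id t).add_const a)
    refine this.congr_deriv ?_
    rw [pause_of_nonneg (by linarith [ht.1]), pause_of_nonneg ht.1.le, one_smul,
      add_sub_add_right_eq_sub]
  · simp only [zero_add, pausedElastica_zero]
    exact pausedElastica_mid ⟨ha, by linarith⟩

theorem pausedElastica_add_of_le (hb : 0 ≤ b) (ha : 0 ≤ a) (hx : x ≤ b) :
    pausedElastica (b + a) x = pausedElastica b x := by
  rcases le_total 0 x with h0 | h0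
  · rw [pausedElastica_mid ⟨h0, hx⟩, pausedElastica_mid ⟨h0, by linarith⟩]
  · rcases le_total (-Real.pi) x with h1 | h1
    · rw [pausedElastica_left hb ⟨h1, h0⟩, pausedElastica_left (by linarith) ⟨h1, h0⟩]
    · rw [pausedElastica_le hb h1, pausedElastica_le (by linarith) h1]

theorem ModelShape.model_apply (h : ModelShape α β γ a b d) (x : ℝ) :
    (model α β γ a b d).toFun x =
      scale α β γ * (pausedElastica b x - a + elastica (elasticaParam (α - γ))) := by
  have := h.pausedElastica_start
  simp only [model, pausedPath, this]
  ring

namespace ModelParams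

theorem dir_model (h : ModelParams α β γ a b d) (hx : x ∈ Icc 0 b) :
    (model α β γ a b d).dir x = Complex.exp (γ * Complex.I) := by
  rw [h.isRightLeft.angle.dir_eq h.isCurve, modelAngle, pause_of_mem_mid hx, elasticaAngle_zero,
    add_zero]
  exact ⟨h.A_neg.le.trans hx.1, by
    change x ≤ b + elasticaParam (β - γ) + d
    linarith [hx.2, h.d_nonneg, (elasticaParam_mem (β - γ)).1]⟩

/-- The arc before the middle segment rises by `λ ξ = λ y₁` across the direction `γ`, which is the
distance that defines `ℓ_γ`. So the whole middle segment lies on this line. -/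
theorem im_model (h : ModelParams α β γ a b d) (hx : x ∈ Icc 0 b) :
    ((model α β γ a b d).toFun x * Complex.exp (-(γ * Complex.I))).im =
      -Real.sin γ * (y₁ α γ / (y₁ α γ + y₂ β γ)) := by
  have hinv : Complex.exp (γ * Complex.I) * Complex.exp (-(γ * Complex.I)) = 1 := by
    rw [← Complex.exp_add, add_neg_cancel, Complex.exp_zero]
  rw [h.model_apply, pausedElastica_mid hx, mul_right_comm, scale, mul_assoc (lam α β γ : ℂ), hinv,
    mul_one, elastica_elasticaParam h.mem₁, ← y₁_eq, lam]
  simp only [Complex.mul_im, Complex.add_im, Complex.sub_im, Complex.add_re, Complex.sub_re,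
    Complex.ofReal_re, Complex.ofReal_im, Complex.I_re, Complex.I_im]
  simp only [Complex.mul_re, Complex.I_re, Complex.I_im, Complex.ofReal_re, Complex.ofReal_im]
  ring

/-- The right arc runs through `E` on `[-t₁, 0]`, whereas the definition asks for an arc of `E`
ending at `π`. Since `E(t - π)` is a reflected and translated copy of `E(t)`, the arc on `[π - t₁,
π]` serves, with the conjugate branch of `Similar`. -/
theorem isOptimalRight (h : ModelParams α β γ 0 b d) :
    IsOptimalRight (uVec α) (inflectionLine α β γ)
      ((model α β γ 0 b d).restrict (model α β γ 0 b d).a 0) := by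
  have hR := h.isRightLeft
  have hcurve := hR.curve.restrict le_rfl hR.mem.1 hR.mem.2
  obtain ⟨t1, t2⟩ := elasticaParam_mem (α - γ)
  have hpos := h.param_pos
  have hb := left_mem_Icc.2 h.b_nonneg
  have hdirR := fun {t} ht => hR.curve.dir_restrict (t := t) le_rfl hR.mem.1 hR.mem.2 ht
  refine ⟨⟨hR.isRightCCurve_restrict, ?_, ?_⟩, Real.pi - elasticaParam (α - γ),
    ⟨by linarith, by linarith⟩, ?_, ?_⟩
  · rw [← hR.connects.1, tangentAt, tangentAt]
    exact Prod.ext rfl (hdirR (left_mem_Icc.2 hR.mem.1.le))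
  · refine tangentLineAt_eq_inflectionLine ?_ (h.im_model hb)
    exact (hdirR (right_mem_Icc.2 hR.mem.1.le)).trans (h.dir_model hb)
  · rw [hR.turning_restrict, turning_elasticaSeg (by linarith), elasticaAngle_pi_sub,
      elasticaAngle_pi, elasticaAngle_elasticaParam h.mem₁]
    ring
  · refine ⟨-scale α β γ, scale α β γ * (elastica (elasticaParam (α - γ)) -
      Complex.I * (xi Real.pi : ℂ)), neg_ne_zero.2 h.scale_ne_zero, Or.inr ?_⟩
    refine Equiv.of_shift (r := Real.pi) hcurve
      ((isCurve_elasticaSeg (by linarith)).map_conj_mul_add (neg_ne_zero.2 h.scale_ne_zero) _)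
      ?_ ?_ fun t ht => ?_
    · change -(elasticaParam (α - γ) + 0) + Real.pi = Real.pi - elasticaParam (α - γ)
      ring
    · change 0 + Real.pi = Real.pi
      ring
    · have ht' : t ∈ Icc (-Real.pi) 0 := by
        have : -(elasticaParam (α - γ) + 0) ≤ t := ht.1
        exact ⟨by linarith, ht.2⟩
      change (model α β γ 0 b d).toFun t = -scale α β γ * (starRingEnd ℂ) (elastica (t + Real.pi)) + _
      have e := elastica_sub_pi (t + Real.pi)
      rw [add_sub_cancel_right] at e
      rw [h.model_apply, pausedElastica_left h.b_nonneg ht', e]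
      push_cast
      ring

/-- The left arc starts where the middle segment ends, at the parameter `b`, and is `E` on `[0, t₂]`
shifted by `b`. Strictness of `γ < β` makes the arc non-trivial. -/
theorem isOptimalLeft (h : ModelParams α β γ a b 0) (hlt : γ < β) :
    IsOptimalLeft (inflectionLine α β γ) (vVec β)
      ((model α β γ a b 0).restrict b (model α β γ a b 0).b) := by
  have hR := h.isRightLeft
  have hpos : 0 < elasticaParam (β - γ) := elasticaParam_pos (sub_pos.2 hlt) h.le₂
  have hb0 := h.b_nonneg
  have hab : (model α β γ a b 0).a ≤ b := h.A_neg.le.trans hb0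
  have hbb : b < (model α β γ a b 0).b := by
    change b < b + elasticaParam (β - γ) + 0
    linarith
  have hcurve := hR.curve.restrict hab hbb le_rfl
  have hangle := hR.angle.restrict hR.curve hab hbb le_rfl
  have hb := right_mem_Icc.2 hb0
  have hdirR := fun {t} ht => hR.curve.dir_restrict (t := t) hab hbb le_rfl ht
  have hmid : modelAngle γ b b = γ := by
    rw [modelAngle, pause_of_mem_mid hb, elasticaAngle_zero, add_zero]
  refine ⟨⟨(hangle.isLeftCCurve_iff hcurve).2 ⟨?_, ?_⟩, ?_, ?_⟩, elasticaParam (β - γ),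
    ⟨hpos, (elasticaParam_mem _).2⟩, ?_, ?_⟩
  · exact hR.mono.mono (Icc_subset_Icc_left hb0)
  · change modelAngle γ b (model α β γ a b 0).b - modelAngle γ b b ≤ _
    rw [hR.angle_finish, hmid]
    exact h.le₂
  · refine tangentLineAt_eq_inflectionLine ?_ (h.im_model hb)
    exact (hdirR (left_mem_Icc.2 hbb.le)).trans (h.dir_model hb)
  · rw [← hR.connects.2, tangentAt, tangentAt]
    exact Prod.ext rfl (hdirR (right_mem_Icc.2 hbb.le))
  · rw [hangle.turning_eq hcurve, turning_elasticaSeg hpos]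
    change _ = |modelAngle γ b (model α β γ a b 0).b - modelAngle γ b b|
    rw [hR.angle_finish, hmid, elasticaAngle_elasticaParam h.mem₂, elasticaAngle_zero, sub_zero,
      abs_of_pos (sub_pos.2 hlt)]
  · refine ⟨scale α β γ, scale α β γ * (b - a + elastica (elasticaParam (α - γ))),
      h.scale_ne_zero, Or.inl ?_⟩
    refine Equiv.of_shift (r := -b) hcurve
      ((isCurve_elasticaSeg hpos).map_mul_add h.scale_ne_zero _) ?_ ?_ fun t ht => ?_
    · change b + -b = 0
      ring
    · change b + elasticaParam (β - γ) + 0 + -b = elasticaParam (β - γ)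
      ring
    · have ht' : t ∈ Icc b (b + Real.pi) := by
        have : t ≤ b + elasticaParam (β - γ) + 0 := ht.2
        exact ⟨ht.1, by linarith [(elasticaParam_mem (β - γ)).2]⟩
      change (model α β γ a b 0).toFun t = scale α β γ * elastica (t + -b) + _
      rw [h.model_apply, pausedElastica_right hb0 ht', ← sub_eq_add_neg]
      ring

theorem isJoin (h : ModelParams α β γ 0 b 0) (hlt : γ < β) :
    (model α β γ 0 b 0).IsJoin [(model α β γ 0 b 0).restrict (model α β γ 0 b 0).a 0,
      lineSeg ((model α β γ 0 b 0).restrict (model α β γ 0 b 0).a 0).finish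
        ((model α β γ 0 b 0).restrict b (model α β γ 0 b 0).b).start,
      (model α β γ 0 b 0).restrict b (model α β γ 0 b 0).b] := by
  have hR := h.isRightLeft
  have hpos : 0 < elasticaParam (β - γ) := elasticaParam_pos (sub_pos.2 hlt) h.le₂
  have hb0 := h.b_nonneg
  have hbb : b < (model α β γ 0 b 0).b := by
    change b < b + elasticaParam (β - γ) + 0
    linarith
  have hab : (model α β γ 0 b 0).a ≤ b := h.A_neg.le.trans hb0
  refine ⟨h.isCurve, 0, ⟨h.A_neg.le, h.B_nonneg⟩,
    Equiv.refl_of_isCurve (hR.curve.restrict le_rfl hR.mem.1 hR.mem.2), b, ⟨hb0, hbb.le⟩,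
    ?_, (model α β γ 0 b 0).b, ⟨hbb.le, le_rfl⟩,
    Equiv.refl_of_isCurve (hR.curve.restrict hab hbb le_rfl), rfl⟩
  have hval : ∀ t ∈ Icc 0 b, (model α β γ 0 b 0).toFun t =
      (model α β γ 0 b 0).toFun 0 + ((t - 0 : ℝ) : ℂ) * scale α β γ := fun t ht => by
    rw [h.model_apply, h.model_apply, pausedElastica_mid ht, pausedElastica_zero]
    push_cast
    ring
  exact Equiv.lineSeg_of_affine hb0 hval rfl (hval b (right_mem_Icc.2 hb0))

theorem isJoin_of_eq_zero (h : ModelParams α β γ 0 0 0) (hlt : γ < β) :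
    (model α β γ 0 0 0).IsJoin [(model α β γ 0 0 0).restrict (model α β γ 0 0 0).a 0,
      (model α β γ 0 0 0).restrict 0 (model α β γ 0 0 0).b] := by
  have hR := h.isRightLeft
  have hbb : 0 < (model α β γ 0 0 0).b := by
    change 0 < 0 + elasticaParam (β - γ) + 0
    linarith [elasticaParam_pos (sub_pos.2 hlt) h.le₂]
  exact ⟨h.isCurve, 0, ⟨h.A_neg.le, h.B_nonneg⟩,
    Equiv.refl_of_isCurve (hR.curve.restrict le_rfl hR.mem.1 hR.mem.2),
    (model α β γ 0 0 0).b, ⟨hbb.le, le_rfl⟩,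
    Equiv.refl_of_isCurve (hR.curve.restrict h.A_neg.le hbb le_rfl), rfl⟩

theorem isFirstForm (h : ModelParams α β γ 0 0 0) (h1 : α - γ < Real.pi) (h2 : β - γ < Real.pi) :
    IsFirstForm (-elasticaParam (α - γ)) (elasticaParam (β - γ)) (model α β γ 0 0 0) := by
  have e1 := elasticaParam_lt_pi h.mem₁.1 h1
  have e2 := elasticaParam_lt_pi h.mem₂.1 h2
  have e3 := h.param_pos
  have e4 := (elasticaParam_mem (β - γ)).1
  refine ⟨by linarith, by linarith, e2, scale α β γ,
    scale α β γ * elastica (elasticaParam (α - γ)), h.scale_ne_zero, ?_⟩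
  refine Equiv.of_eqOn h.isCurve
    ((isCurve_elasticaSeg (by linarith)).map_mul_add h.scale_ne_zero _) ?_ ?_ fun t ht => ?_
  · change -(elasticaParam (α - γ) + 0) = -elasticaParam (α - γ)
    ring
  · change 0 + elasticaParam (β - γ) + 0 = elasticaParam (β - γ)
    ring
  · have h3 : -(elasticaParam (α - γ) + 0) ≤ t := ht.1
    have h4 : t ≤ 0 + elasticaParam (β - γ) + 0 := ht.2
    have hval : pausedElastica 0 t = elastica t := by
      rcases le_total t 0 with h0 | h0
      · exact pausedElastica_left le_rfl ⟨by linarith, h0⟩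
      · rw [pausedElastica_right le_rfl ⟨h0, by linarith⟩]
        simp
    change (model α β γ 0 0 0).toFun t = scale α β γ * elastica t + _
    rw [h.model_apply, hval]
    push_cast
    ring

/-- The reference join is the unscaled paused elastica itself, started at `-π`; the similarity is
multiplication by `λ e^{iγ}` followed by the translation that moves the initial point to `0`. -/
theorem isSecondForm (h : ModelParams α β γ 0 b 0) (h1 : α - γ = Real.pi) (hlt : γ < β) :
    IsSecondForm b (elasticaParam (β - γ)) (model α β γ 0 b 0) := by
  have hb0 := h.b_nonneg
  have hpos : 0 < elasticaParam (β - γ) := elasticaParam_pos (sub_pos.2 hlt) h.le₂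
  have hle := (elasticaParam_mem (β - γ)).2
  have hπ := Real.pi_pos
  have hcurve : (pausedPath 0 1 b (-Real.pi) (b + elasticaParam (β - γ))).IsCurve :=
    isCurve_pausedPath one_ne_zero (by linarith)
  refine ⟨hb0, elasticaParam_mem _, pausedPath 0 1 b (-Real.pi) (b + elasticaParam (β - γ)), ?_,
    scale α β γ, scale α β γ * elastica Real.pi, h.scale_ne_zero, ?_⟩
  · refine ⟨hcurve, 0, ⟨by change -Real.pi ≤ 0; linarith, by
      change 0 ≤ b + elasticaParam (β - γ); linarith⟩, ?_, b, ⟨hb0, by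
      change b ≤ b + elasticaParam (β - γ); linarith⟩, ?_, b + elasticaParam (β - γ),
      ⟨by change b ≤ b + elasticaParam (β - γ); linarith, le_rfl⟩, ?_, rfl⟩
    · refine Equiv.of_eqOn (hcurve.restrict le_rfl (by change -Real.pi < 0; linarith)
        (by change 0 ≤ b + elasticaParam (β - γ); linarith))
        (isCurve_elasticaSeg (by linarith)) rfl rfl fun t ht => ?_
      change 0 + 1 * pausedElastica b t = elastica t
      rw [pausedElastica_left hb0 ht]
      ring
    · refine Equiv.lineSeg_of_affine (z := 0) (v := 1) hb0 (fun t ht => ?_) rfl ?_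
      · change 0 + 1 * pausedElastica b t = 0 + ((t - 0 : ℝ) : ℂ) * 1
        rw [pausedElastica_mid (show t ∈ Icc 0 b from ht)]
        simp
      · change (b : ℂ) = 0 + ((b - 0 : ℝ) : ℂ) * 1
        simp
    · refine Equiv.of_shift (r := -b) (hcurve.restrict (by change -Real.pi ≤ b; linarith)
        (by change b < b + elasticaParam (β - γ); linarith) le_rfl) ?_ ?_ ?_ fun t ht => ?_
      · have := (isCurve_elasticaSeg hpos).map_add (b : ℂ)
        simpa only [add_comm (b : ℂ)] using this
      · change b + -b = 0
        ring
      · change b + elasticaParam (β - γ) + -b = elasticaParam (β - γ)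
        ring
      · change 0 + 1 * pausedElastica b t = b + elastica (t + -b)
        have ht2 : t ≤ b + elasticaParam (β - γ) := ht.2
        rw [pausedElastica_right hb0 ⟨ht.1, by linarith⟩, ← sub_eq_add_neg]
        ring
  · refine Equiv.of_eqOn h.isCurve (hcurve.map_mul_add h.scale_ne_zero _) ?_ ?_ fun t _ => ?_
    · change -(elasticaParam (α - γ) + 0) = -Real.pi
      rw [h1, elasticaParam_pi, add_zero]
    · change b + elasticaParam (β - γ) + 0 = b + elasticaParam (β - γ)
      ring
    · change _ = scale α β γ * (0 + 1 * pausedElastica b t) + _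
      rw [h.model_apply, h1, elasticaParam_pi]
      push_cast
      ring

end ModelParams

end ElasticSpline

/-! ### Extra end segments are elongations of u-turns. -/

namespace ElasticSpline

open PlanePath

variable {f : PlanePath} {α β γ a b d x : ℝ}

namespace ModelParams

/-- Lengthening the first segment and, by the same amount, the middle one elongates the u-turn
between them. -/
theorem isElongation_first (h : ModelParams α β γ 0 b 0) (hlt : γ < β) (h1 : α - γ = Real.pi)
    (h' : ModelParams α β γ a (b + a) 0) (ha : 0 < a) :
    (model α β γ 0 b 0).IsElongation (model α β γ a (b + a) 0) := by
  have hR := h.isRightLeft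
  have hπ := Real.pi_pos
  have hb0 := h.b_nonneg
  have ht2 : 0 < elasticaParam (β - γ) := elasticaParam_pos (sub_pos.2 hlt) h.le₂
  have ht2' := (elasticaParam_mem (β - γ)).2
  have hMa : (model α β γ 0 b 0).a = -Real.pi := by
    change -(elasticaParam (α - γ) + 0) = -Real.pi
    rw [h1, elasticaParam_pi, add_zero]
  have hMb : (model α β γ 0 b 0).b = b + elasticaParam (β - γ) := add_zero _
  have hNa : (model α β γ a (b + a) 0).a = -(Real.pi + a) := by
    change -(elasticaParam (α - γ) + a) = -(Real.pi + a)
    rw [h1, elasticaParam_pi]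
  have hNb : (model α β γ a (b + a) 0).b = b + a + elasticaParam (β - γ) := add_zero _
  have hdir : (model α β γ 0 b 0).dir (model α β γ 0 b 0).a = -Complex.exp (γ * Complex.I) := by
    rw [hR.angle.dir_eq hR.curve (left_mem_Icc.2 hR.curve.1.le), hR.angle_start,
      show α = γ + Real.pi by linarith]
    push_cast
    rw [add_mul, Complex.exp_add, Complex.exp_pi_mul_I]
    ring
  -- The candidate is a copy of the elastica scaled by `λ`, so parameter length `a` means Euclidean
  -- length `λ a`; the initial direction is `γ + π`.
  have hvec : ((lam α β γ * a : ℝ) : ℂ) * (model α β γ 0 b 0).dir (model α β γ 0 b 0).a =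
      -(a * scale α β γ) := by
    rw [hdir, scale]
    push_cast
    ring
  have hM : ∀ x, (model α β γ 0 b 0).toFun x =
      scale α β γ * (pausedElastica b x + elastica Real.pi) := fun x => by
    rw [h.model_apply, h1, elasticaParam_pi]
    push_cast
    ring
  have hN : ∀ x, (model α β γ a (b + a) 0).toFun x =
      scale α β γ * (pausedElastica (b + a) x - a + elastica Real.pi) := fun x => by
    rw [h'.model_apply, h1, elasticaParam_pi]
  have hba : 0 ≤ b + a := h'.b_nonneg
  have hMcurve := h.isCurve
  have hNcurve := h'.isCurve
  refine ⟨(model α β γ 0 b 0).a, 0, lam α β γ * a, le_rfl, h.A_neg, h.B_nonneg,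
    mul_pos h.lam_pos ha, ⟨Or.inr hR.isRightCCurve_restrict, by rw [hR.turning_restrict, h1]⟩, ?_⟩
  rw [hvec]
  -- The u-turn starts at the initial point, so the first piece is a point. Then come the segment up
  -- to `-π`, the u-turn on `[-π, 0]`, the returning segment `[0, a]` taken from the longer middle
  -- segment, and the rest of the old curve shifted by `a`.
  refine ⟨hNcurve, (model α β γ a (b + a) 0).a, ⟨le_rfl, hNcurve.1.le⟩, ?_, -Real.pi, ?_, ?_,
    0, ⟨by change -Real.pi ≤ 0; linarith, h'.B_nonneg⟩, ?_, a, ?_, ?_,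
    (model α β γ a (b + a) 0).b, ?_, ?_, rfl⟩
  · refine Equiv.of_point rfl rfl ?_
    exact (model_start α β γ a (b + a) 0).trans (model_start α β γ 0 b 0).symm
  · change -Real.pi ∈ Icc (model α β γ a (b + a) 0).a (model α β γ a (b + a) 0).b
    rw [hNa, hNb]
    constructor <;> linarith
  · have hval : ∀ t ∈ Icc (-(Real.pi + a)) (-Real.pi), (model α β γ a (b + a) 0).toFun t =
        0 + ((t - -(Real.pi + a) : ℝ) : ℂ) * -scale α β γ := fun t ht => by
      rw [hN, pausedElastica_le hba ht.2, elastica_neg]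
      push_cast
      ring
    refine Equiv.lineSeg_of_affine (f := ((model α β γ a (b + a) 0).restrict
      (model α β γ a (b + a) 0).a _).restrict _ (-Real.pi)) (z := 0) (v := -scale α β γ) ?_ ?_
      (model_start _ _ _ _ _ _) ?_
    · change (model α β γ a (b + a) 0).a ≤ -Real.pi
      rw [hNa]; linarith
    · change ∀ t ∈ Icc (model α β γ a (b + a) 0).a (-Real.pi), (model α β γ a (b + a) 0).toFun t =
        0 + ((t - (model α β γ a (b + a) 0).a : ℝ) : ℂ) * -scale α β γ
      rw [hNa]
      exact hval
    · change (model α β γ 0 b 0).toFun (model α β γ 0 b 0).a + -(a * scale α β γ) =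
        0 + ((-Real.pi - (model α β γ a (b + a) 0).a : ℝ) : ℂ) * -scale α β γ
      rw [model_start, hNa]
      push_cast
      ring
  · have hNle : (model α β γ a (b + a) 0).a ≤ -Real.pi := by rw [hNa]; linarith
    refine Equiv.of_eqOn (f := PlanePath.restrict _ (-Real.pi) 0)
      (hNcurve.restrict hNle (neg_neg_of_pos hπ) h'.B_nonneg)
      ((hMcurve.restrict le_rfl h.A_neg h.B_nonneg).map_add _) hMa.symm rfl fun t ht => ?_
    change (model α β γ a (b + a) 0).toFun t = (model α β γ 0 b 0).toFun t + -(a * scale α β γ)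
    rw [hM, hN, pausedElastica_left hba ht, pausedElastica_left hb0 ht]
    ring
  · change a ∈ Icc 0 (model α β γ a (b + a) 0).b
    rw [hNb]
    constructor <;> linarith
  · refine Equiv.lineSeg_of_affine (f := PlanePath.restrict _ 0 a)
      (z := (model α β γ 0 b 0).toFun 0 + -(a * scale α β γ)) (v := scale α β γ) ha.le
      (fun t ht => ?_) rfl ?_
    · change (model α β γ a (b + a) 0).toFun t = _ + ((t - 0 : ℝ) : ℂ) * scale α β γ
      have ht' : t ∈ Icc 0 (b + a) := ⟨ht.1, (show t ≤ a from ht.2).trans (by linarith)⟩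
      rw [hN, hM, pausedElastica_mid ht', pausedElastica_zero]
      push_cast
      ring
    · change _ = _ + ((a - 0 : ℝ) : ℂ) * scale α β γ
      push_cast
      ring
  · change _ ∈ Icc a (model α β γ a (b + a) 0).b
    rw [hNb]
    constructor <;> linarith
  · refine Equiv.of_shift (f := PlanePath.restrict _ a (model α β γ a (b + a) 0).b) (r := -a)
      (hNcurve.restrict (h'.A_neg.le.trans ha.le) (by rw [hNb]; linarith) le_rfl)
      (hMcurve.restrict h.A_neg.le (by rw [hMb]; linarith) le_rfl) ?_ ?_ fun t ht => ?_
    · change a + -a = 0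
      ring
    · change (model α β γ a (b + a) 0).b + -a = (model α β γ 0 b 0).b
      rw [hMb, hNb]; ring
    · have ht' : a ≤ t := ht.1
      have e := pausedElastica_add (b := b) (a := a) (x := t + -a) hb0 ha.le (by linarith)
      rw [neg_add_cancel_right] at e
      change (model α β γ a (b + a) 0).toFun t = (model α β γ 0 b 0).toFun (t + -a)
      rw [hM, hN, e]
      ring

/-- Lengthening the last segment and, by the same amount, the middle one elongates the u-turn
between them. -/
theorem isElongation_last (h : ModelParams α β γ a b 0) (h2 : β - γ = Real.pi)
    (h' : ModelParams α β γ a (b + d) d) (hd : 0 < d) :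
    (model α β γ a b 0).IsElongation (model α β γ a (b + d) d) := by
  have hR := h.isRightLeft
  have hπ := Real.pi_pos
  have hb0 := h.b_nonneg
  have hMb : (model α β γ a b 0).b = b + Real.pi := by
    change b + elasticaParam (β - γ) + 0 = b + Real.pi
    rw [h2, elasticaParam_pi, add_zero]
  have hNb : (model α β γ a (b + d) d).b = b + d + Real.pi + d := by
    change b + d + elasticaParam (β - γ) + d = b + d + Real.pi + d
    rw [h2, elasticaParam_pi]
  have hMab : (model α β γ a b 0).a ≤ b := h.A_neg.le.trans hb0
  have hbM : b < (model α β γ a b 0).b := by rw [hMb]; linarith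
  have hvec : ((lam α β γ * d : ℝ) : ℂ) * (model α β γ a b 0).dir b = d * scale α β γ := by
    rw [h.dir_model (right_mem_Icc.2 hb0), scale]
    push_cast
    ring
  have hM := h.model_apply
  have hN := h'.model_apply
  have hMcurve := h.isCurve
  have hNcurve := h'.isCurve
  have hbd : 0 ≤ b + d := h'.b_nonneg
  have hmid : modelAngle γ b b = γ := by
    rw [modelAngle, pause_of_mem_mid (right_mem_Icc.2 hb0), elasticaAngle_zero, add_zero]
  have hUcurve := hMcurve.restrict hMab hbM le_rfl
  have hUangle := hR.angle.restrict hMcurve hMab hbM le_rfl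
  have hturn : |((model α β γ a b 0).restrict b (model α β γ a b 0).b).turning| = Real.pi := by
    rw [hUangle.turning_eq hUcurve]
    change |modelAngle γ b (model α β γ a b 0).b - modelAngle γ b b| = _
    rw [hR.angle_finish, hmid, h2, abs_of_pos hπ]
  have hU : ((model α β γ a b 0).restrict b (model α β γ a b 0).b).IsLeftCCurve :=
    ⟨(hUangle.isLeftCurve_iff hUcurve).2 (hR.mono.mono (Icc_subset_Icc_left hb0)), hturn.le⟩
  refine ⟨b, (model α β γ a b 0).b, lam α β γ * d, hMab, hbM, le_rfl, mul_pos h.lam_pos hd,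
    ⟨Or.inl hU, hturn⟩, ?_⟩
  rw [hvec]
  have hNa : (model α β γ a (b + d) d).a ≤ b := h'.A_neg.le.trans hb0
  have hA : (model α β γ a b 0).a < b := h.A_neg.trans_le hb0
  -- The old curve is kept up to `b`. The added part `[b, b + d]` of the middle segment leads to the
  -- shifted u-turn, the final segment returns to the end point, and the last piece is a point.
  refine ⟨hNcurve, b, ⟨hNa, by rw [hNb]; linarith⟩, ?_, b + d, ?_, ?_, b + d + Real.pi, ?_, ?_,
    (model α β γ a (b + d) d).b, ?_, ?_, (model α β γ a (b + d) d).b, ⟨le_rfl, le_rfl⟩, ?_, rfl⟩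
  · refine Equiv.of_eqOn (hNcurve.restrict le_rfl (h'.A_neg.trans_le hb0)
      (by rw [hNb]; linarith)) (hMcurve.restrict le_rfl hA hbM.le) rfl rfl fun t ht => ?_
    change (model α β γ a (b + d) d).toFun t = (model α β γ a b 0).toFun t
    rw [hM, hN, pausedElastica_add_of_le hb0 hd.le ht.2]
  · change b + d ∈ Icc b (model α β γ a (b + d) d).b
    rw [hNb]
    constructor <;> linarith
  · refine Equiv.lineSeg_of_affine (f := PlanePath.restrict _ b (b + d))
      (z := (model α β γ a b 0).toFun b) (v := scale α β γ) (by change b ≤ b + d; linarith)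
      (fun t ht => ?_) rfl ?_
    · change (model α β γ a (b + d) d).toFun t = _ + ((t - b : ℝ) : ℂ) * scale α β γ
      have ht' : b ≤ t := ht.1
      rw [hN, hM, pausedElastica_mid (b := b + d) ⟨hb0.trans ht', ht.2⟩,
        pausedElastica_mid (right_mem_Icc.2 hb0)]
      push_cast
      ring
    · change _ = _ + ((b + d - b : ℝ) : ℂ) * scale α β γ
      push_cast
      ring
  · change b + d + Real.pi ∈ Icc (b + d) (model α β γ a (b + d) d).b
    rw [hNb]
    constructor <;> linarith
  · refine Equiv.of_shift (f := PlanePath.restrict _ (b + d) (b + d + Real.pi)) (r := -d)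
      (hNcurve.restrict (h'.A_neg.le.trans hbd) (by linarith) (by rw [hNb]; linarith))
      (hUcurve.map_add _) ?_ ?_ fun t ht => ?_
    · change b + d + -d = b
      ring
    · change b + d + Real.pi + -d = (model α β γ a b 0).b
      rw [hMb]; ring
    · have ht' : b + d ≤ t := ht.1
      have e := pausedElastica_add (b := b) (a := d) (x := t + -d) hb0 hd.le (by linarith)
      rw [neg_add_cancel_right] at e
      change (model α β γ a (b + d) d).toFun t =
        (model α β γ a b 0).toFun (t + -d) + d * scale α β γ
      rw [hM, hN, e]
      ring
  · change _ ∈ Icc (b + d + Real.pi) (model α β γ a (b + d) d).b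
    rw [hNb]
    constructor <;> linarith
  · have hq : (model α β γ a b 0).toFun (model α β γ a b 0).b =
        scale α β γ * (b + elastica Real.pi - a + elastica (elasticaParam (α - γ))) := by
      rw [hM, hMb, pausedElastica_right hb0 ⟨by linarith, le_rfl⟩, add_sub_cancel_left]
    refine Equiv.lineSeg_of_affine
      (f := PlanePath.restrict _ (b + d + Real.pi) (model α β γ a (b + d) d).b)
      (z := (model α β γ a b 0).toFun (model α β γ a b 0).b + d * scale α β γ)
      (v := -scale α β γ) (by change b + d + Real.pi ≤ (model α β γ a (b + d) d).b; rw [hNb]; linarith)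
      (fun t ht => ?_) rfl ?_
    · change (model α β γ a (b + d) d).toFun t =
        _ + ((t - (b + d + Real.pi) : ℝ) : ℂ) * -scale α β γ
      rw [hN, hq, pausedElastica_ge hbd ht.1]
      push_cast
      ring
    · change _ = _ + (((model α β γ a (b + d) d).b - (b + d + Real.pi) : ℝ) : ℂ) * -scale α β γ
      rw [hNb]
      push_cast
      ring
  · exact Equiv.of_point rfl rfl (h'.model_finish.trans h.model_finish.symm)

/-- The closing condition fixes `b' - a - d`, so end segments of lengths `a` and `d` lengthen the
middle one by exactly `a + d`. Each positive length is one elongation; `d > 0` needs `β - γ = π`,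
which makes the left arc a u-turn. -/
theorem elongatesTo (h0 : ModelParams α β γ 0 b 0) (hlt : γ < β) (h1 : α - γ = Real.pi) {b' : ℝ}
    (h : ModelParams α β γ a b' d) (hf : f.IsCurve) (he : f.Equiv (model α β γ a b' d)) :
    (model α β γ 0 b 0).ElongatesTo f := by
  have hb' : b' = b + a + d := by
    have := h0.eq.trans h.eq.symm
    have := mul_left_cancel₀ h.lam_pos.ne' this
    linarith
  subst hb'
  have ha0 := h.a_nonneg
  have hd0 := h.d_nonneg
  have h2 : ModelParams α β γ a (b + a) 0 :=
    ⟨⟨h.lt, h.le₁, h.le, h.le₂, h.sin_neg, ha0, Or.inr h1, add_nonneg h0.b_nonneg ha0, le_rfl,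
      Or.inl rfl⟩, by rw [← h0.eq]; ring⟩
  have s1 : (model α β γ 0 b 0).ElongatesTo (model α β γ a (b + a) 0) := by
    rcases ha0.eq_or_lt with ha | ha
    · subst ha
      rw [add_zero]
      exact Relation.ReflTransGen.refl
    · exact Relation.ReflTransGen.single
        ⟨h0.isCurve, h2.isCurve, Or.inr (h0.isElongation_first hlt h1 h2 ha)⟩
  have s2 : (model α β γ a (b + a) 0).ElongatesTo (model α β γ a (b + a + d) d) := by
    rcases hd0.eq_or_lt with hd | hd
    · subst hd
      rw [add_zero]
      exact Relation.ReflTransGen.refl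
    · exact Relation.ReflTransGen.single ⟨h2.isCurve, h.isCurve, Or.inr
        (h2.isElongation_last (h.d_eq.resolve_left hd.ne') h hd)⟩
  exact (s1.trans s2).tail ⟨h.isCurve, hf, Or.inl he.symm⟩

end ModelParams

end ElasticSpline

/-! ### First order conditions at a minimum of `G` and the three types of minimiser. -/

namespace ElasticSpline

open PlanePath

variable {α β γ : ℝ}

theorem turning_elasticaSeg_param {x : ℝ} (h0 : 0 < x) (h1 : x ≤ Real.pi) :
    (elasticaSeg 0 (elasticaParam x)).turning = x := by
  rw [turning_elasticaSeg (elasticaParam_pos h0 h1), elasticaAngle_zero, sub_zero,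
    elasticaAngle_elasticaParam ⟨h0.le, h1⟩]

theorem left_mem_GammaSet (hα : α ∈ Ioo 0 Real.pi) (hβ : α - Real.pi < β) :
    α - Real.pi ∈ GammaSet α β := by
  unfold GammaSet
  split_ifs
  · exact ⟨le_rfl, hβ.le⟩
  · exact ⟨le_rfl, by linarith [hα.2]⟩

theorem right_mem_GammaSet (hβ : α - Real.pi < β) (h0 : β < 0) : β ∈ GammaSet α β := by
  rw [GammaSet, if_pos h0]
  exact ⟨hβ.le, le_rfl⟩

theorem mem_GammaSet_of_mem_Ioo (hγ : γ ∈ Ioo (α - Real.pi) (min β 0)) : γ ∈ GammaSet α β := by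
  obtain ⟨h1, h2⟩ := hγ
  unfold GammaSet
  split_ifs
  · exact ⟨h1.le, (h2.trans_le (min_le_left _ _)).le⟩
  · exact ⟨h1.le, h2.trans_le (min_le_right _ _)⟩

theorem sigma_left_nonneg (hα : α ∈ Ioo 0 Real.pi) (hβα : |β| ≤ α) (hβ : α - Real.pi < β)
    (hmin : ∀ x ∈ GammaSet α β, G α β (α - Real.pi) ≤ G α β x) :
    0 ≤ sigma α β (α - Real.pi) := by
  obtain ⟨x, hx, hlt⟩ : ∃ x ∈ GammaSet α β, α - Real.pi < x := by
    obtain ⟨x, hx⟩ := exists_between (lt_min hβ (sub_neg.2 hα.2))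
    exact ⟨x, mem_GammaSet_of_mem_Ioo hx, hx.1⟩
  exact nonneg_of_mul_nonneg_left (sigma_mul_nonneg hα hβα (left_mem_GammaSet hα hβ) hmin hx)
    (sub_pos.2 hlt)

theorem sigma_interior_eq_zero (hα : α ∈ Ioo 0 Real.pi) (hβα : |β| ≤ α) (hβ : α - Real.pi < β)
    (hγ : γ ∈ Ioo (α - Real.pi) (min β 0)) (hmin : ∀ x ∈ GammaSet α β, G α β γ ≤ G α β x) :
    sigma α β γ = 0 := by
  have hmem := mem_GammaSet_of_mem_Ioo hγ
  obtain ⟨x, hx⟩ := exists_between hγ.2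
  have h1 := sigma_mul_nonneg hα hβα hmem hmin (mem_GammaSet_of_mem_Ioo ⟨hγ.1.trans hx.1, hx.2⟩)
  have h2 := sigma_mul_nonneg hα hβα hmem hmin (left_mem_GammaSet hα hβ)
  exact le_antisymm (nonpos_of_mul_nonneg_left h2 (sub_neg.2 hγ.1))
    (nonneg_of_mul_nonneg_left h1 (sub_pos.2 hx.1))

theorem sigma_right_nonpos (hα : α ∈ Ioo 0 Real.pi) (hβα : |β| ≤ α) (hβ : α - Real.pi < β)
    (h0 : β < 0) (hmin : ∀ x ∈ GammaSet α β, G α β β ≤ G α β x) : sigma α β β ≤ 0 :=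
  nonpos_of_mul_nonneg_left (sigma_mul_nonneg hα hβα (right_mem_GammaSet hβ h0) hmin
    (left_mem_GammaSet hα hβ)) (sub_neg.2 hβ)

/-- The parameters of the minimal curves without segments in opposite directions. -/
theorem modelParams_of_mem_GammaSet (hα : α ∈ Ioo 0 Real.pi) (hβα : |β| ≤ α)
    (hγ : γ ∈ GammaSet α β) (hσ : 0 ≤ sigma α β γ) :
    ModelParams α β γ 0 (sigma α β γ / lam α β γ) 0 := by
  obtain ⟨b1, b2, b3⟩ := GammaSet_bounds hγ
  obtain ⟨hs, hS⟩ := GammaSet_pos hα hβα hγ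
  have hl : 0 < lam α β γ := div_pos (neg_pos.2 hs) hS
  exact ⟨⟨by linarith [hα.1], by linarith, b3, by linarith [(abs_le.1 hβα).2], hs, le_rfl,
    Or.inl rfl, div_nonneg hσ hl.le, le_rfl, Or.inl rfl⟩, by field_simp; ring⟩

/-- Without u-turns, a minimal curve is determined up to equivalence. -/
theorem equiv_model_of_turning_lt {f : PlanePath} (hα : α ∈ Ioo 0 Real.pi) (hβα : |β| ≤ α)
    (hβ : α - Real.pi < β) (hγ : γ ∈ GammaSet α β) (hlt : α - Real.pi < γ)
    (hσ : sigma α β γ = 0) (hf : f ∈ sClass α β γ)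
    (hE : f.energy = ENNReal.ofReal (G α β γ)) : f.Equiv (model α β γ 0 0 0) := by
  obtain ⟨τ, c, h, hcase⟩ := exists_isRightLeft_of_mem_sClass hα hβα hβ hγ hf
  obtain ⟨a, b, d, hM, he⟩ := h.exists_equiv_model hcase hE
  -- `β - γ ≤ α - γ < π` excludes u-turns, hence both outer segments; with `σ = 0` the closing
  -- condition then removes the middle one.
  have ha := hM.a_eq.resolve_right (by linarith)
  have hd := hM.d_eq.resolve_right (by linarith [(abs_le.1 hβα).2])
  have hb := hM.eq
  subst ha hd
  rw [hσ, sub_zero, sub_zero] at hb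
  rwa [(mul_eq_zero.1 hb).resolve_left hM.lam_pos.ne'] at he


theorem minimal_left (hα : α ∈ Set.Ioo 0 Real.pi) (hβα : |β| ≤ α)
    (hβ : α - Real.pi < β)
    (hmin : ∀ x ∈ GammaSet α β, G α β (α - Real.pi) ≤ G α β x) :
        0 ≤ sigma α β (α - Real.pi) ∧
        ∃ fγ r l : PlanePath,
          IsOptimalRight (uVec α) (inflectionLine α β (α - Real.pi)) r ∧
          IsOptimalLeft (inflectionLine α β (α - Real.pi)) (vVec β) l ∧
          fγ.IsJoin [r, PlanePath.lineSeg r.finish l.start, l] ∧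
          (∃ t₂ ∈ Set.Icc 0 Real.pi, (elasticaSeg 0 t₂).turning = β - (α - Real.pi) ∧
            IsSecondForm (sigma α β (α - Real.pi) / lam α β (α - Real.pi)) t₂ fγ) ∧
          fγ ∈ sClass α β (α - Real.pi) ∧
          fγ.energy = ENNReal.ofReal (G α β (α - Real.pi)) ∧
          ∀ f ∈ sClass α β (α - Real.pi), f.energy = ENNReal.ofReal (G α β (α - Real.pi)) →
            fγ.ElongatesTo f := by
  have hσ := sigma_left_nonneg hα hβα hβ hmin
  have hmem := left_mem_GammaSet hα hβ
  have hM := modelParams_of_mem_GammaSet hα hβα hmem hσ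
  have h1 : α - (α - Real.pi) = Real.pi := sub_sub_cancel _ _
  refine ⟨hσ, _, _, _, hM.isOptimalRight, hM.isOptimalLeft hβ, hM.isJoin hβ,
    ⟨_, elasticaParam_mem _, turning_elasticaSeg_param (sub_pos.2 hβ) hM.le₂,
      hM.isSecondForm h1 hβ⟩, hM.isRightLeft.mem_sClass hβ, hM.energy, fun f hf hE => ?_⟩
  obtain ⟨τ, c, h, hcase⟩ := exists_isRightLeft_of_mem_sClass hα hβα hβ hmem hf
  obtain ⟨a, b, d, hM', he⟩ := h.exists_equiv_model hcase hE
  exact hM.elongatesTo hβ h1 hM' h.curve he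

theorem minimal_interior (hα : α ∈ Set.Ioo 0 Real.pi) (hβα : |β| ≤ α)
    (hβ : α - Real.pi < β) (hγ : γ ∈ Set.Ioo (α - Real.pi) (min β 0))
    (hmin : ∀ x ∈ GammaSet α β, G α β γ ≤ G α β x) :
        sigma α β γ = 0 ∧
        ∃ fγ r l : PlanePath,
          IsOptimalRight (uVec α) (inflectionLine α β γ) r ∧
          IsOptimalLeft (inflectionLine α β γ) (vVec β) l ∧
          fγ.IsJoin [r, l] ∧
          (∃ t₁ ∈ Set.Icc 0 Real.pi, ∃ t₂ ∈ Set.Icc 0 Real.pi,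
            (elasticaSeg 0 t₁).turning = α - γ ∧ (elasticaSeg 0 t₂).turning = β - γ ∧
            IsFirstForm (-t₁) t₂ fγ) ∧
          fγ ∈ sClass α β γ ∧
          fγ.energy = ENNReal.ofReal (G α β γ) ∧
          ∀ f ∈ sClass α β γ, f.energy = ENNReal.ofReal (G α β γ) → f.Equiv fγ := by
  have hσ := sigma_interior_eq_zero hα hβα hβ hγ hmin
  have hmem := mem_GammaSet_of_mem_Ioo hγ
  have hM := modelParams_of_mem_GammaSet hα hβα hmem hσ.ge
  rw [hσ, zero_div] at hM
  have hlt : γ < β := hγ.2.trans_le (min_le_left _ _)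
  have h1 : α - Real.pi < γ := hγ.1
  exact ⟨hσ, _, _, _, hM.isOptimalRight, hM.isOptimalLeft hlt, hM.isJoin_of_eq_zero hlt,
    ⟨_, elasticaParam_mem _, _, elasticaParam_mem _,
      turning_elasticaSeg_param (sub_pos.2 hM.lt) hM.le₁,
      turning_elasticaSeg_param (sub_pos.2 hlt) hM.le₂,
      hM.isFirstForm (by linarith) (by linarith [(abs_le.1 hβα).2])⟩,
    hM.isRightLeft.mem_sClass hlt, hM.energy,
    fun f hf hE => equiv_model_of_turning_lt hα hβα hβ hmem h1 hσ hf hE⟩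

theorem minimal_right (hα : α ∈ Set.Ioo 0 Real.pi) (hβα : |β| ≤ α)
    (hβ : α - Real.pi < β) (h0 : β < 0) (hσ : 0 ≤ sigma α β β)
    (hmin : ∀ x ∈ GammaSet α β, G α β β ≤ G α β x) :
        sigma α β β = 0 ∧
        ∃ fβ : PlanePath,
          IsOptimalRight (uVec α) (inflectionLine α β β) fβ ∧
          (∃ t₁ ∈ Set.Icc 0 Real.pi, (elasticaSeg 0 t₁).turning = α - β ∧
            IsFirstForm (-t₁) 0 fβ) ∧
          fβ ∈ sClass α β β ∧
          fβ.energy = ENNReal.ofReal (G α β β) ∧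
          ∀ f ∈ sClass α β β, f.energy = ENNReal.ofReal (G α β β) → f.Equiv fβ := by
  -- Minimality at the right end gives only `σ(β) ≤ 0`; the assumption supplies the other
  -- inequality.
  replace hσ := le_antisymm (sigma_right_nonpos hα hβα hβ h0 hmin) hσ
  have hmem := right_mem_GammaSet hβ h0
  have hM := modelParams_of_mem_GammaSet hα hβα hmem hσ.ge
  rw [hσ, zero_div] at hM
  have ht : elasticaParam (β - β) = 0 := by rw [sub_self, elasticaParam_zero]
  have hb : (model α β β 0 0 0).b = 0 := by
    change 0 + elasticaParam (β - β) + 0 = 0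
    rw [ht, add_zero, add_zero]
  -- For `γ = β` the left arc has parameter length `0`, so the candidate ends at the parameter `0`
  -- and coincides with its right arc.
  have hr : (model α β β 0 0 0).restrict (model α β β 0 0 0).a 0 = model α β β 0 0 0 :=
    congrArg (PlanePath.restrict _ _) hb.symm
  refine ⟨hσ, model α β β 0 0 0, hr ▸ hM.isOptimalRight,
    ⟨_, elasticaParam_mem _, turning_elasticaSeg_param (sub_pos.2 hM.lt) hM.le₁, ?_⟩, ?_,
    hM.energy, fun f hf hE => equiv_model_of_turning_lt hα hβα hβ hmem hβ hσ hf hE⟩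
  · simpa only [ht] using hM.isFirstForm (by linarith) (by rw [sub_self]; exact Real.pi_pos)
  · rw [sClass, if_pos ⟨h0, rfl⟩]
    exact ⟨hr ▸ hM.isRightLeft.isRightCCurve_restrict, hM.isRightLeft.connects⟩
end ElasticSpline

theorem corollary5p12 (α β : ℝ) (hα : α ∈ Set.Ioo 0 Real.pi) (hβα : |β| ≤ α)
    (hβ : α - Real.pi < β) (hσ : β < 0 → 0 ≤ sigma α β β) :
    ∃ Gmin : ℝ, IsLeast (G α β '' GammaSet α β) Gmin ∧
      -- (i)
      (β < 0 → ∀ f ∈ sCurvesLR (uVec α) (vVec β), ENNReal.ofReal Gmin < f.energy) ∧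
      -- (ii)
      (∀ γ ∈ GammaSet α β, Gmin < G α β γ →
        ∀ f ∈ sClass α β γ, ENNReal.ofReal Gmin < f.energy) ∧
      -- (iii)
      (G α β (α - Real.pi) = Gmin →
        0 ≤ sigma α β (α - Real.pi) ∧
        ∃ fγ r l : PlanePath,
          IsOptimalRight (uVec α) (inflectionLine α β (α - Real.pi)) r ∧
          IsOptimalLeft (inflectionLine α β (α - Real.pi)) (vVec β) l ∧
          fγ.IsJoin [r, PlanePath.lineSeg r.finish l.start, l] ∧
          (∃ t₂ ∈ Set.Icc 0 Real.pi, (elasticaSeg 0 t₂).turning = β - (α - Real.pi) ∧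
            IsSecondForm (sigma α β (α - Real.pi) / lam α β (α - Real.pi)) t₂ fγ) ∧
          fγ ∈ sClass α β (α - Real.pi) ∧
          fγ.energy = ENNReal.ofReal Gmin ∧
          ∀ f ∈ sClass α β (α - Real.pi), f.energy = ENNReal.ofReal Gmin →
            fγ.ElongatesTo f) ∧
      -- (iv)
      (∀ γ ∈ Set.Ioo (α - Real.pi) (min β 0), G α β γ = Gmin →
        sigma α β γ = 0 ∧
        ∃ fγ r l : PlanePath,
          IsOptimalRight (uVec α) (inflectionLine α β γ) r ∧
          IsOptimalLeft (inflectionLine α β γ) (vVec β) l ∧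
          fγ.IsJoin [r, l] ∧
          (∃ t₁ ∈ Set.Icc 0 Real.pi, ∃ t₂ ∈ Set.Icc 0 Real.pi,
            (elasticaSeg 0 t₁).turning = α - γ ∧ (elasticaSeg 0 t₂).turning = β - γ ∧
            IsFirstForm (-t₁) t₂ fγ) ∧
          fγ ∈ sClass α β γ ∧
          fγ.energy = ENNReal.ofReal Gmin ∧
          ∀ f ∈ sClass α β γ, f.energy = ENNReal.ofReal Gmin → f.Equiv fγ) ∧
      -- (v)
      (β < 0 → G α β β = Gmin →
        sigma α β β = 0 ∧
        ∃ fβ : PlanePath,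
          IsOptimalRight (uVec α) (inflectionLine α β β) fβ ∧
          (∃ t₁ ∈ Set.Icc 0 Real.pi, (elasticaSeg 0 t₁).turning = α - β ∧
            IsFirstForm (-t₁) 0 fβ) ∧
          fβ ∈ sClass α β β ∧
          fβ.energy = ENNReal.ofReal Gmin ∧
          ∀ f ∈ sClass α β β, f.energy = ENNReal.ofReal Gmin → f.Equiv fβ) ∧
      -- (vi)
      IsLeast (PlanePath.energy '' sCurves (uVec α) (vVec β)) (ENNReal.ofReal Gmin) := by

  obtain ⟨Gmin, hG⟩ := exists_isLeast_G hα hβα hβ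
  refine ⟨Gmin, hG, ?_⟩
  obtain ⟨⟨γ₀, hγ₀, rfl⟩, hlb⟩ := hG
  replace hlb : ∀ x ∈ GammaSet α β, G α β γ₀ ≤ G α β x := fun x hx => hlb ⟨x, hx, rfl⟩
  have hG0 : 0 ≤ G α β γ₀ := by
    have := neg_pos.2 (GammaSet_pos hα hβα hγ₀).1
    unfold G
    positivity
  have left : G α β (α - Real.pi) = G α β γ₀ → _ := fun e =>
    minimal_left hα hβα hβ (e ▸ hlb)
  have interior : ∀ γ ∈ Ioo (α - Real.pi) (min β 0), G α β γ = G α β γ₀ → _ := fun γ hγ e =>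
    minimal_interior hα hβα hβ hγ (e ▸ hlb)
  have right : ∀ _ : β < 0, G α β β = G α β γ₀ → _ := fun h0 e =>
    minimal_right hα hβα hβ h0 (hσ h0) (e ▸ hlb)
  refine ⟨fun h0 f hf => ?_, fun γ hγ hlt f hf => ?_, fun e => e ▸ left e,
    fun γ hγ e => e ▸ interior γ hγ e, fun h0 e => e ▸ right h0 e, ?_, ?_⟩
  · obtain ⟨hs, hn, c, hc⟩ := hf
    exact (ENNReal.ofReal_le_ofReal (hlb β (right_mem_GammaSet hβ h0))).trans_lt
      (hc.lt_energy hα hβα hβ hs.1.1 hs.2 hn).2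
  · obtain ⟨τ, c, h, -⟩ := exists_isRightLeft_of_mem_sClass hα hβα hβ hγ hf
    exact ((ENNReal.ofReal_lt_ofReal_iff_of_nonneg hG0).2 hlt).trans_le h.energy_ge
  -- The minimiser `γ₀` is the left end, the right end `β < 0`, or below `min β 0` and inside; each
  -- case supplies a curve of energy `G(γ₀)`.
  · obtain ⟨b1, b2, b3⟩ := GammaSet_bounds hγ₀
    rcases b1.eq_or_lt with rfl | b1
    · obtain ⟨-, f, -, -, -, -, -, -, hf, hE, -⟩ := left rfl
      exact ⟨f, sClass_subset_sCurves hf, hE⟩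
    rcases b3.eq_or_lt with rfl | b3
    · obtain ⟨-, f, -, -, hf, hE, -⟩ := right b2 rfl
      exact ⟨f, sClass_subset_sCurves hf, hE⟩
    · obtain ⟨-, f, -, -, -, -, -, -, hf, hE, -⟩ := interior γ₀ ⟨b1, lt_min b3 b2⟩ rfl
      exact ⟨f, sClass_subset_sCurves hf, hE⟩
  · rintro _ ⟨f, hf, rfl⟩
    exact ofReal_le_energy_of_mem_sCurves hα hβα hβ hlb hf
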